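/- Let $\mathbb{L}$ be the Lazard ring with its universal commutative formal group law $F_{\mathbb{L}}(u,v)=u+v+\sum_{i,j\ge 1}a_{i,j}u^iv^j$. Write $u\oplus v=F_{\mathbb{L}}(u,v)$ and let $\overline{u}\in\mathbb{L}[[u]]$ be the formal inverse, $u\oplus\overline{u}=0$. Let $\mathbb{L}[[b]]=\mathbb{L}[[b_1,b_2,\dots]]$ and $\mathbf{x}_n=(x_1,\dots,x_n)$. Let $\Gamma^{\mathbb{L}}(\mathbf{x}_n)$ be the ring of symmetric $f\in\mathbb{L}[[x_1,\dots,x_n]]$ with $f(t,\overline{t},x_3,\dots,x_n)=f(0,0,x_3,\dots,x_n)$ (no condition beyond symmetry if $n<2$), and let $\Gamma_+^{\mathbb{L}}(\mathbf{x}_n)$ be its subring of those $f$ for which $f(t,x_2,\dots,x_n)-f(0,x_2,\dots,x_n)$ is divisible by $t\oplus t$. Let $\Gamma^{\mathbb{L}}(\mathbf{x}_n|b)=\mathbb{L}[[b]]\,\hat\otimes_{\mathbb{L}}\,\Gamma^{\mathbb{L}}(\mathbf{x}_n)$ and $\Gamma_+^{\mathbb{L}}(\mathbf{x}_n|b)=\mathbb{L}[[b]]\,\hat\otimes_{\mathbb{L}}\,\Gamma_+^{\mathbb{L}}(\mathbf{x}_n)$,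 that is, the rings of formal power series in $b$ with coefficients in $\Gamma^{\mathbb{L}}(\mathbf{x}_n)$, respectively $\Gamma^{\mathbb{L}}_+(\mathbf{x}_n)$, and let $\Gamma^{\mathbb{L}}(\mathbf{x}|b)$, $\Gamma_+^{\mathbb{L}}(\mathbf{x}|b)$ be their inverse limits over $n$ along the specialisations $x_{n+1}=0$. Put $[t|b]^k=\prod_{i=1}^k(t\oplus b_i)$, $[[t|b]]^k=(t\oplus t)[t|b]^{k-1}$ for $k\ge1$, and $[[t|b]]^0=1$. For a strict partition $\lambda=(\lambda_1>\dots>\lambda_r>0)$ of length $r\le n$ let $$P^{\mathbb{L}}_\lambda(\mathbf{x}_n|b)=\frac1{(n-r)!}\sum_{w\in S_n}w\Big[\prod_{i=1}^r[x_i|b]^{\lambda_i}\prod_{i=1}^r\prod_{j=i+1}^n\frac{x_i\oplus x_j}{x_i\oplus\overline{x}_j}\Big],$$ $$Q^{\mathbb{L}}_\lambda(\mathbf{x}_n|b)=\frac1{(n-r)!}\sum_{w\in S_n}w\Big[\prod_{i=1}^r[[x_i|b]]^{\lambda_i}\prod_{i=1}^r\prod_{j=i+1}^n\frac{x_i\oplus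 x_j}{x_i\oplus\overline{x}_j}\Big],$$ where $S_n$ permutes $x_1,\dots,x_n$, and let both be $0$ if $r>n$. Let $P^{\mathbb{L}}_\lambda(\mathbf{x}_n|b)^+$ be $P^{\mathbb{L}}_\lambda(x_1,\dots,x_n|b)$ if $n$ is even and $P^{\mathbb{L}}_\lambda(x_1,\dots,x_n,0|b)$ if $n$ is odd. Let $\mathcal{SP}$ be the set of strict partitions and $\mathcal{SP}_n$ the set of those of length at most $n$. A family $(e_\lambda)$ of elements of one of these rings $\Gamma$ is a formal $\mathbb{L}[[b]]$-basis of $\Gamma$ if, for the topology of coefficientwise stabilisation (in the limit rings: coefficientwise for every $n$), every sum $\sum_\lambda c_\lambda e_\lambda$ with $c_\lambda\in\mathbb{L}[[b]]$ converges to an element of $\Gamma$, and every element of $\Gamma$ is such a sum for exactly one family $(c_\lambda)$. Theorem. The sums above, formed in the total ring of fractions, are power series in $x_1,\dots,x_n,b_1,b_2,\dots$ over $\mathbb{L}$. For every $n\ge0$: 1. the $P^{\mathbb{L}}_\lambda(\mathbf{x}_n|b)^+$, $\lambda\in\mathcal{SP}_n$, form a formal $\mathbb{L}[[b]]$-basis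 of $\Gamma^{\mathbb{L}}(\mathbf{x}_n|b)$; 2. the $Q^{\mathbb{L}}_\lambda(\mathbf{x}_n|b)$, $\lambda\in\mathcal{SP}_n$, form a formal $\mathbb{L}[[b]]$-basis of $\Gamma_+^{\mathbb{L}}(\mathbf{x}_n|b)$. In the limit $n\to\infty$, for every $\lambda\in\mathcal{SP}$ the sequences $P^{\mathbb{L}}_\lambda(\mathbf{x}|b)^+=(P^{\mathbb{L}}_\lambda(\mathbf{x}_n|b)^+)_n$ and $Q^{\mathbb{L}}_\lambda(\mathbf{x}|b)=(Q^{\mathbb{L}}_\lambda(\mathbf{x}_n|b))_n$ are compatible with the specialisations $x_{n+1}=0$. The $P^{\mathbb{L}}_\lambda(\mathbf{x}|b)^+$, $\lambda\in\mathcal{SP}$, form a formal $\mathbb{L}[[b]]$-basis of $\Gamma^{\mathbb{L}}(\mathbf{x}|b)$, and the $Q^{\mathbb{L}}_\lambda(\mathbf{x}|b)$, $\lambda\in\mathcal{SP}$, form a formal $\mathbb{L}[[b]]$-basis of $\Gamma_+^{\mathbb{L}}(\mathbf{x}|b)$. -/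

import Mathlib

open scoped MvPowerSeries.WithPiTopology

noncomputable section

namespace UnivSchur

/-! ### The Lazard ring and the universal formal group law -/

/-- The polynomial ring `ℤ[a_{i,j} : i, j ≥ 1]`; the variable `X (i, j)` stands for
`a_{i+1, j+1}`. -/
abbrev LazardGen : Type := MvPolynomial (ℕ × ℕ) ℤ

/-- The generic series `u + v + ∑_{i, j ≥ 1} a_{i,j} u ^ i v ^ j`. -/
def genericSeries : MvPowerSeries (Fin 2) LazardGen := fun d =>
  if d 0 = 0 then (if d 1 = 1 then 1 else 0)
  else if d 1 = 0 then (if d 0 = 1 then 1 else 0)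
  else MvPolynomial.X (d 0 - 1, d 1 - 1)

/-- `F(F(u, v), w)` for the generic series `F`. -/
def genericAssocLeft : MvPowerSeries (Fin 3) LazardGen :=
  genericSeries.subst
    ![genericSeries.subst ![(MvPowerSeries.X 0 : MvPowerSeries (Fin 3) LazardGen),
        MvPowerSeries.X 1], MvPowerSeries.X 2]

/-- `F(u, F(v, w))` for the generic series `F`. -/
def genericAssocRight : MvPowerSeries (Fin 3) LazardGen :=
  genericSeries.subst
    ![MvPowerSeries.X 0,
      genericSeries.subst ![(MvPowerSeries.X 1 : MvPowerSeries (Fin 3) LazardGen),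
        MvPowerSeries.X 2]]

/-- `F(v, u)` for the generic series `F`. -/
def genericSwap : MvPowerSeries (Fin 2) LazardGen :=
  genericSeries.subst ![(MvPowerSeries.X 1 : MvPowerSeries (Fin 2) LazardGen), MvPowerSeries.X 0]

/-- The ideal of relations expressing that the generic series is a commutative formal group
law. -/
def lazardIdeal : Ideal LazardGen :=
  Ideal.span
    (Set.range (fun d : Fin 2 →₀ ℕ =>
        MvPowerSeries.coeff d genericSeries - MvPowerSeries.coeff d genericSwap) ∪
      Set.range (fun d : Fin 3 →₀ ℕ =>
        MvPowerSeries.coeff d genericAssocLeft - MvPowerSeries.coeff d genericAssocRight))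

/-- The Lazard ring. -/
def Lazard : Type := LazardGen ⧸ lazardIdeal

instance : CommRing Lazard := inferInstanceAs (CommRing (LazardGen ⧸ lazardIdeal))

/-- The Lazard ring carries the discrete topology, so that convergence of power series over it is
coefficientwise stabilisation. -/
instance : TopologicalSpace Lazard := ⊥

instance : DiscreteTopology Lazard := ⟨rfl⟩

/-- The quotient map onto the Lazard ring. -/
def lazardMk : LazardGen →+* Lazard := Ideal.Quotient.mk lazardIdeal

theorem lazardMk_eq_of_sub_mem {a b : LazardGen} (h : a - b ∈ lazardIdeal) :
    lazardMk a = lazardMk b := Ideal.Quotient.eq.mpr h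

theorem coeff_genericSeries (d : Fin 2 →₀ ℕ) :
    MvPowerSeries.coeff d genericSeries =
      if d 0 = 0 then (if d 1 = 1 then 1 else 0)
      else if d 1 = 0 then (if d 0 = 1 then 1 else 0)
      else MvPolynomial.X (d 0 - 1, d 1 - 1) := rfl

theorem constantCoeff_genericSeries : MvPowerSeries.constantCoeff genericSeries = 0 := by
  rw [← MvPowerSeries.coeff_zero_eq_constantCoeff_apply, coeff_genericSeries]
  simp

theorem map_comp_vec {σ R S : Type*} [CommRing R] [CommRing S] (f : R →+* S)
    (g₁ g₂ : MvPowerSeries σ R) :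
    (fun i => (![g₁, g₂] i).map f) = ![g₁.map f, g₂.map f] := by
  ext1 i; fin_cases i <;> rfl

/-- The universal formal group law `F_𝕃`. -/
def lazardFGL : FormalGroup Lazard where
  toPowerSeries := genericSeries.map lazardMk
  zero_constantCoeff := by
    rw [MvPowerSeries.constantCoeff_map, constantCoeff_genericSeries, map_zero]
  lin_coeff_X := by
    rw [MvPowerSeries.coeff_map, coeff_genericSeries]; simp
  lin_coeff_Y := by
    rw [MvPowerSeries.coeff_map, coeff_genericSeries]; simp
  assoc := by
    have key : genericAssocLeft.map lazardMk = genericAssocRight.map lazardMk := by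
      ext d
      rw [MvPowerSeries.coeff_map, MvPowerSeries.coeff_map]
      exact lazardMk_eq_of_sub_mem (Ideal.subset_span (Or.inr ⟨d, rfl⟩))
    rw [genericAssocLeft, genericAssocRight,
      MvPowerSeries.map_subst (MvPowerSeries.HasSubst.cons_subst_zero_left (0 : Fin 3) 1 2
        constantCoeff_genericSeries),
      MvPowerSeries.map_subst (MvPowerSeries.HasSubst.cons_subst_zero_right (0 : Fin 3) 1 2
        constantCoeff_genericSeries), map_comp_vec, map_comp_vec,
      MvPowerSeries.map_subst .X_X, MvPowerSeries.map_subst .X_X, map_comp_vec, map_comp_vec]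
      at key
    simpa only [MvPowerSeries.map_X] using key

instance : lazardFGL.IsComm where
  comm := by
    have key : genericSeries.map lazardMk = genericSwap.map lazardMk := by
      ext d
      rw [MvPowerSeries.coeff_map, MvPowerSeries.coeff_map]
      exact lazardMk_eq_of_sub_mem (Ideal.subset_span (Or.inl ⟨d, rfl⟩))
    rw [genericSwap, MvPowerSeries.map_subst .X_X, map_comp_vec] at key
    simp only [MvPowerSeries.map_X] at key
    exact key

/-- Coefficients of the formal inverse `χ`: the one of degree `n + 1` is determined by
requiring that the coefficient of degree `n + 1` of `F(t, χ(t))` vanishes. -/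
def invCoeff : ℕ → Lazard
  | 0 => 0
  | n + 1 => - PowerSeries.coeff (n + 1)
      (lazardFGL.toPowerSeries.subst
        ![(PowerSeries.X : PowerSeries Lazard),
          ∑ i : Fin (n + 1), PowerSeries.C (invCoeff i.1) * PowerSeries.X ^ i.1])

/-- The formal inverse `χ(t)` of the universal formal group law. -/
def invSeries : PowerSeries Lazard := PowerSeries.mk invCoeff

theorem constantCoeff_invSeries : PowerSeries.constantCoeff invSeries = 0 := by
  simp [invSeries, invCoeff]

/-- Changing `B` by `e` of order `> n` changes `F(t, B)` in degree `n + 1` as it changes `B`. -/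
theorem coeff_subst_add {n : ℕ} {B e : PowerSeries Lazard}
    (hB : PowerSeries.constantCoeff B = 0) (he : PowerSeries.X ^ (n + 1) ∣ e) :
    PowerSeries.coeff (n + 1) (lazardFGL.toPowerSeries.subst ![PowerSeries.X, B + e]) =
      PowerSeries.coeff (n + 1) (lazardFGL.toPowerSeries.subst ![PowerSeries.X, B]) +
        PowerSeries.coeff (n + 1) e := by
  have hBe : PowerSeries.constantCoeff (B + e) = 0 := by
    obtain ⟨u, rfl⟩ := he
    simp [hB]
  have s1 : MvPowerSeries.HasSubst ![(PowerSeries.X : PowerSeries Lazard), B + e] :=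
    MvPowerSeries.hasSubst_of_constantCoeff_zero fun i => by
      fin_cases i
      · exact PowerSeries.constantCoeff_X
      · exact hBe
  have s2 : MvPowerSeries.HasSubst ![(PowerSeries.X : PowerSeries Lazard), B] :=
    MvPowerSeries.hasSubst_of_constantCoeff_zero fun i => by
      fin_cases i
      · exact PowerSeries.constantCoeff_X
      · exact hB
  have hp : ∀ (C : PowerSeries Lazard) (d : Fin 2 →₀ ℕ),
      (d.prod fun s k => (![(PowerSeries.X : PowerSeries Lazard), C] s) ^ k) =
        PowerSeries.X ^ d 0 * C ^ d 1 := fun C d => by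
    rw [Finsupp.prod_fintype _ _ (fun i => pow_zero _), Fin.prod_univ_two]; rfl
  have hX : (PowerSeries.X : PowerSeries Lazard) ∣ B + e := PowerSeries.X_dvd_iff.mpr hBe
  have hX' : (PowerSeries.X : PowerSeries Lazard) ∣ B := PowerSeries.X_dvd_iff.mpr hB
  have key : ∀ d : Fin 2 →₀ ℕ,
      MvPowerSeries.coeff d lazardFGL.toPowerSeries •
          PowerSeries.coeff (n + 1) (PowerSeries.X ^ d 0 * (B + e) ^ d 1) =
        MvPowerSeries.coeff d lazardFGL.toPowerSeries •
          PowerSeries.coeff (n + 1) (PowerSeries.X ^ d 0 * B ^ d 1) +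
        if d = Finsupp.single 1 1 then PowerSeries.coeff (n + 1) e else 0 := by
    intro d
    by_cases hd : d = Finsupp.single 1 1
    · subst hd
      simp [lazardFGL.lin_coeff_Y]
    · rw [if_neg hd, add_zero]
      congr 1
      rw [← sub_eq_zero, ← map_sub, ← mul_sub]
      have h : PowerSeries.X ^ (n + 2) ∣ PowerSeries.X ^ d 0 * ((B + e) ^ d 1 - B ^ d 1) := by
        have hdiff : PowerSeries.X ^ (n + 1) ∣ (B + e) ^ d 1 - B ^ d 1 :=
          (he.trans (by simp)).trans (sub_dvd_pow_sub_pow (B + e) B (d 1))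
        rcases Nat.eq_zero_or_pos (d 0) with h0 | h0
        · obtain ⟨k, hk⟩ | hk : (∃ k, d 1 = k + 2) ∨ d 1 < 2 := by
            by_cases h2 : d 1 < 2
            · exact Or.inr h2
            · exact Or.inl ⟨d 1 - 2, by omega⟩
          · have hdiff' : PowerSeries.X ^ (n + 1) ∣ (B + e) ^ (k + 1) - B ^ (k + 1) :=
              (he.trans (by simp)).trans (sub_dvd_pow_sub_pow (B + e) B (k + 1))
            have e1 : PowerSeries.X ^ d 0 * ((B + e) ^ d 1 - B ^ d 1) =
                ((B + e) ^ (k + 1) - B ^ (k + 1)) * (B + e) + e * B * B ^ k := by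
              rw [h0, hk]; ring
            rw [e1, pow_succ PowerSeries.X (n + 1)]
            exact dvd_add (mul_dvd_mul hdiff' hX) ((mul_dvd_mul he hX').mul_right _)
          · have h1 : d 1 = 0 := by
              by_contra h1
              apply hd
              ext i
              fin_cases i
              · simpa using h0
              · have : d 1 = 1 := by omega
                simpa using this
            rw [h1]; simp
        · obtain ⟨k, hk⟩ : ∃ k, d 0 = k + 1 := ⟨d 0 - 1, by omega⟩
          rw [hk, pow_succ PowerSeries.X (n + 1), mul_comm (PowerSeries.X ^ (k + 1))]
          exact mul_dvd_mul hdiff (dvd_pow_self _ (Nat.succ_ne_zero k))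
      exact PowerSeries.X_pow_dvd_iff.mp h _ (by omega)
  have c1 := MvPowerSeries.coeff_subst s1 lazardFGL.toPowerSeries (Finsupp.single () (n + 1))
  have c2 := MvPowerSeries.coeff_subst s2 lazardFGL.toPowerSeries (Finsupp.single () (n + 1))
  have f2 := MvPowerSeries.coeff_subst_finite s2 lazardFGL.toPowerSeries
    (Finsupp.single () (n + 1))
  simp only [hp] at c1 c2 f2
  refine c1.trans ?_
  refine (finsum_congr key).trans ?_
  refine (finsum_add_distrib f2
    ((Set.finite_singleton (Finsupp.single 1 1)).subset fun d hd => by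
      by_contra h
      exact hd (if_neg h))).trans ?_
  congr 1
  · exact c2.symm
  · rw [finsum_eq_single _ (Finsupp.single 1 1) (fun d hd => if_neg hd), if_pos rfl]

/-- The defining property of the formal inverse: `F(t, χ(t)) = 0`. -/
theorem subst_invSeries :
    lazardFGL.toPowerSeries.subst ![(PowerSeries.X : PowerSeries Lazard), invSeries] = 0 := by
  have h0 : ∀ n, PowerSeries.constantCoeff
      (∑ i : Fin (n + 1), PowerSeries.C (invCoeff i.1) * PowerSeries.X ^ i.1) = 0 := by
    intro n
    rw [Fin.sum_univ_succ]
    simp [invCoeff]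
  have hdvd : ∀ n, PowerSeries.X ^ n ∣ invSeries -
      ∑ i : Fin n, PowerSeries.C (invCoeff i.1) * PowerSeries.X ^ i.1 := by
    intro n
    rw [PowerSeries.X_pow_dvd_iff]
    intro m hm
    simp +contextual [invSeries, PowerSeries.coeff_X_pow,
      Finset.sum_eq_single (⟨m, hm⟩ : Fin n), Fin.ext_iff, @eq_comm _ m]
  ext n
  rcases n with _ | n
  · rw [map_zero, PowerSeries.coeff_zero_eq_constantCoeff_apply]
    refine MvPowerSeries.constantCoeff_subst_eq_zero
      (MvPowerSeries.hasSubst_of_constantCoeff_zero fun i => ?_) (fun i => ?_)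
      lazardFGL.zero_constantCoeff
    all_goals fin_cases i
    · exact PowerSeries.constantCoeff_X
    · exact constantCoeff_invSeries
    · exact PowerSeries.constantCoeff_X
    · exact constantCoeff_invSeries
  · have h := coeff_subst_add (h0 n) (hdvd (n + 1))
    rw [add_sub_cancel] at h
    rw [h, map_zero, map_sub, map_sum]
    have hz : ∀ i : Fin (n + 1), PowerSeries.coeff (n + 1)
        (PowerSeries.C (invCoeff i.1) * PowerSeries.X ^ i.1) = 0 := fun i => by
      rw [PowerSeries.coeff_C_mul_X_pow, if_neg (by omega)]
    rw [Finset.sum_eq_zero fun i _ => hz i, sub_zero, invSeries, PowerSeries.coeff_mk, invCoeff]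
    exact add_neg_cancel _

/-! ### Formal sums of power series -/

/-- `f ⊕ g = F_𝕃(f, g)` for power series without constant term. -/
def fadd {σ : Type} (f g : MvPowerSeries σ Lazard) : MvPowerSeries σ Lazard :=
  lazardFGL.toPowerSeries.subst ![f, g]

/-- The formal inverse `χ(f)` of a power series without constant term. -/
def fneg {σ : Type} (f : MvPowerSeries σ Lazard) : MvPowerSeries σ Lazard :=
  invSeries.subst f

/-! ### Supersymmetric series in `x_1, …, x_n` -/

/-- Power series `𝕃[[x_1, …, x_n]]`. -/
abbrev XSeries (n : ℕ) : Type := MvPowerSeries (Fin n) Lazard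

/-- The substitution `x_i = t`, `x_j = χ(t)`; the variable `x_i` is reused for `t`. -/
def pairVars {n : ℕ} (i j : Fin n) : Fin n → XSeries n := fun k =>
  if k = i then MvPowerSeries.X i else if k = j then fneg (MvPowerSeries.X i)
  else MvPowerSeries.X k

/-- The substitution of `0` for the variables in `s`. -/
def zeroVars {n : ℕ} (s : Finset (Fin n)) : Fin n → XSeries n := fun k =>
  if k ∈ s then 0 else MvPowerSeries.X k

theorem constantCoeff_fneg_X {σ : Type} (i : σ) :
    MvPowerSeries.constantCoeff (fneg (MvPowerSeries.X i : MvPowerSeries σ Lazard)) = 0 :=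
  PowerSeries.constantCoeff_subst_eq_zero (by simp) _ constantCoeff_invSeries

theorem hasSubst_pairVars {n : ℕ} (i j : Fin n) : MvPowerSeries.HasSubst (pairVars i j) :=
  MvPowerSeries.hasSubst_of_constantCoeff_zero fun k => by
    unfold pairVars
    split_ifs
    · simp
    · exact constantCoeff_fneg_X i
    · simp

theorem hasSubst_zeroVars {n : ℕ} (s : Finset (Fin n)) :
    MvPowerSeries.HasSubst (zeroVars s) :=
  MvPowerSeries.hasSubst_of_constantCoeff_zero fun k => by
    unfold zeroVars
    split_ifs <;> simp

/-- The ring `Γ(x_n)` of supersymmetric series: symmetric series `f` such that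
`f(t, χ(t), x_3, …, x_n) = f(0, 0, x_3, …, x_n)`. As `f` is symmetric, the two special variables
may be taken to be `x_i, x_j` for any `i ≠ j`. -/
def Gam (n : ℕ) : Subalgebra Lazard (XSeries n) where
  carrier := {f | (∀ w : Equiv.Perm (Fin n), MvPowerSeries.renameEquiv Lazard w f = f) ∧
    ∀ i j : Fin n, i ≠ j → f.subst (pairVars i j) = f.subst (zeroVars {i, j})}
  mul_mem' := by
    rintro f g ⟨hf, hf'⟩ ⟨hg, hg'⟩
    refine ⟨fun w => by rw [map_mul, hf, hg], fun i j hij => ?_⟩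
    rw [MvPowerSeries.subst_mul (hasSubst_pairVars i j),
      MvPowerSeries.subst_mul (hasSubst_zeroVars _), hf' i j hij, hg' i j hij]
  add_mem' := by
    rintro f g ⟨hf, hf'⟩ ⟨hg, hg'⟩
    refine ⟨fun w => by rw [map_add, hf, hg], fun i j hij => ?_⟩
    rw [MvPowerSeries.subst_add (hasSubst_pairVars i j),
      MvPowerSeries.subst_add (hasSubst_zeroVars _), hf' i j hij, hg' i j hij]
  algebraMap_mem' := by
    intro r
    refine ⟨fun w => AlgEquiv.commutes _ _, fun i j _ => ?_⟩
    rw [← MvPowerSeries.substAlgHom_apply (hasSubst_pairVars i j),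
      ← MvPowerSeries.substAlgHom_apply (hasSubst_zeroVars _), AlgHom.commutes, AlgHom.commutes]

/-- The ring `Γ_+(x_n)`: the `f ∈ Γ(x_n)` such that `f(t, x_2, …, x_n) - f(0, x_2, …, x_n)` is
divisible by `t ⊕ t`. As `f` is symmetric, `t` may take the place of any variable `x_i`. -/
def GamPlus (n : ℕ) : Subalgebra Lazard (XSeries n) where
  carrier := {f | f ∈ Gam n ∧ ∀ i : Fin n,
    fadd (MvPowerSeries.X i) (MvPowerSeries.X i) ∣ f - f.subst (zeroVars {i})}
  mul_mem' := by
    rintro f g ⟨hf, hf'⟩ ⟨hg, hg'⟩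
    refine ⟨mul_mem hf hg, fun i => ?_⟩
    rw [MvPowerSeries.subst_mul (hasSubst_zeroVars _)]
    have : f * g - f.subst (zeroVars {i}) * g.subst (zeroVars {i}) =
        f * (g - g.subst (zeroVars {i})) + (f - f.subst (zeroVars {i})) *
          g.subst (zeroVars {i}) := by ring
    rw [this]
    exact dvd_add ((hg' i).mul_left _) ((hf' i).mul_right _)
  add_mem' := by
    rintro f g ⟨hf, hf'⟩ ⟨hg, hg'⟩
    refine ⟨add_mem hf hg, fun i => ?_⟩
    rw [MvPowerSeries.subst_add (hasSubst_zeroVars _), add_sub_add_comm]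
    exact dvd_add (hf' i) (hg' i)
  algebraMap_mem' := by
    intro r
    refine ⟨(Gam n).algebraMap_mem r, fun i => ?_⟩
    rw [← MvPowerSeries.substAlgHom_apply (hasSubst_zeroVars _), AlgHom.commutes, sub_self]
    exact dvd_zero _

/-! ### Equivariant coefficients -/

/-- The coefficient ring `𝕃[[b]]`; the variable with index `k` stands for `b_{k+1}`. -/
abbrev BSeries : Type := MvPowerSeries ℕ Lazard

/-- Power series over `𝕃` in `x_1, …, x_n` and `b_1, b_2, …`. -/
abbrev XBSeries (n : ℕ) : Type := MvPowerSeries (Fin n ⊕ ℕ) Lazard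

/-- The inclusion of `𝕃[[b]]` into the series in `x_1, …, x_n, b_1, b_2, …`. -/
def bIncl (n : ℕ) : BSeries →+* XBSeries n :=
  (MvPowerSeries.rename (R := Lazard) (Function.Embedding.inr : ℕ ↪ Fin n ⊕ ℕ)).toRingHom

instance (n : ℕ) : Algebra BSeries (XBSeries n) := (bIncl n).toAlgebra

/-- The coefficient of `b ^ β`, a series in `x_1, …, x_n`. -/
def bCoeff {n : ℕ} (β : ℕ →₀ ℕ) (f : XBSeries n) : XSeries n := fun α =>
  MvPowerSeries.coeff (α.sumElim β) f

theorem coeff_bCoeff {n : ℕ} (β : ℕ →₀ ℕ) (f : XBSeries n) (α : Fin n →₀ ℕ) :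
    MvPowerSeries.coeff α (bCoeff β f) = MvPowerSeries.coeff (α.sumElim β) f := rfl

theorem bCoeff_add {n : ℕ} (β : ℕ →₀ ℕ) (f g : XBSeries n) :
    bCoeff β (f + g) = bCoeff β f + bCoeff β g := by
  ext α; simp [coeff_bCoeff]

theorem bCoeff_mul {n : ℕ} (β : ℕ →₀ ℕ) (f g : XBSeries n) :
    bCoeff β (f * g) =
      ∑ p ∈ Finset.HasAntidiagonal.antidiagonal β, bCoeff p.1 f * bCoeff p.2 g := by
  classical
  ext α
  rw [coeff_bCoeff, MvPowerSeries.coeff_mul, map_sum,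
    ← Finsupp.image_sumElim_product_antidiagonal, Finset.sum_image, Finset.sum_product_right]
  · simp only [MvPowerSeries.coeff_mul, coeff_bCoeff]
  · rintro ⟨⟨a, b⟩, c, d⟩ _ ⟨⟨a', b'⟩, c', d'⟩ _ h
    simp only [Prod.mk.injEq] at h
    have h1 := fun i => DFunLike.congr_fun h.1 i
    have h2 := fun i => DFunLike.congr_fun h.2 i
    have e1 : a = a' := Finsupp.ext fun i => by simpa using h1 (Sum.inl i)
    have e2 : c = c' := Finsupp.ext fun i => by simpa using h1 (Sum.inr i)
    have e3 : b = b' := Finsupp.ext fun i => by simpa using h2 (Sum.inl i)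
    have e4 : d = d' := Finsupp.ext fun i => by simpa using h2 (Sum.inr i)
    rw [e1, e2, e3, e4]

theorem bCoeff_bIncl {n : ℕ} (β : ℕ →₀ ℕ) (c : BSeries) :
    bCoeff β (bIncl n c) = algebraMap Lazard (XSeries n) (MvPowerSeries.coeff β c) := by
  classical
  ext α
  rw [coeff_bCoeff, MvPowerSeries.algebraMap_apply, MvPowerSeries.coeff_C]
  change MvPowerSeries.coeff _ (MvPowerSeries.rename
    (Function.Embedding.inr : ℕ ↪ Fin n ⊕ ℕ) c) = _
  split_ifs with h
  · subst h
    have : (0 : Fin n →₀ ℕ).sumElim β =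
        Finsupp.embDomain (Function.Embedding.inr : ℕ ↪ Fin n ⊕ ℕ) β := by
      ext (i | i)
      · rw [Finsupp.embDomain_of_notMem_range]
        · rfl
        · rintro ⟨k, hk⟩; cases hk
      · exact (Finsupp.embDomain_apply_self (Function.Embedding.inr : ℕ ↪ Fin n ⊕ ℕ) β i).symm
    rw [this, MvPowerSeries.coeff_embDomain_rename]; rfl
  · refine MvPowerSeries.coeff_rename_eq_zero _ _ ?_
    rintro ⟨γ, hγ⟩
    apply h
    ext i
    have := DFunLike.congr_fun hγ (Sum.inl i)
    rw [Finsupp.mapDomain_of_notMem_range] at this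
    · exact this.symm
    · rintro ⟨k, hk⟩; cases hk

/-- The completed tensor product `𝕃[[b]] ⊗̂ Γ` for a subring `Γ` of `𝕃[[x_1, …, x_n]]`: power
series in `b` with coefficients in `Γ`. -/
def bExtend {n : ℕ} (G : Subalgebra Lazard (XSeries n)) : Subalgebra BSeries (XBSeries n) where
  carrier := {f | ∀ β, bCoeff β f ∈ G}
  mul_mem' := by
    intro f g hf hg β
    rw [bCoeff_mul]
    exact sum_mem fun p _ => mul_mem (hf _) (hg _)
  add_mem' := by
    intro f g hf hg β
    rw [bCoeff_add]
    exact add_mem (hf _) (hg _)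
  algebraMap_mem' := by
    intro c β
    change bCoeff β (bIncl n c) ∈ G
    rw [bCoeff_bIncl]
    exact G.algebraMap_mem _

/-- The ring `Γ(x_n|b)`. -/
def GamB (n : ℕ) : Subalgebra BSeries (XBSeries n) := bExtend (Gam n)

/-- The ring `Γ_+(x_n|b)`. -/
def GamPlusB (n : ℕ) : Subalgebra BSeries (XBSeries n) := bExtend (GamPlus n)

/-- The specialisation `x_{n+1} = 0`. -/
def specLast (n : ℕ) : XBSeries (n + 1) →ₐ[Lazard] XBSeries n :=
  MvPowerSeries.killCompl (R := Lazard)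
    (Function.Embedding.sumMap Fin.castSuccEmb (Function.Embedding.refl ℕ))

theorem specLast_bIncl (n : ℕ) (c : BSeries) : specLast n (bIncl (n + 1) c) = bIncl n c := by
  have hE : ∀ (α : Fin n →₀ ℕ) (β : ℕ →₀ ℕ),
      Finsupp.embDomain (Function.Embedding.sumMap Fin.castSuccEmb (Function.Embedding.refl ℕ))
        (α.sumElim β) = (Finsupp.embDomain Fin.castSuccEmb α).sumElim β := by
    intro α β
    ext (i | i)
    · refine Fin.lastCases ?_ (fun k => ?_) i
      · rw [Finsupp.embDomain_of_notMem_range, Finsupp.sumElim_inl,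
          Finsupp.embDomain_of_notMem_range]
        · rintro ⟨k, hk⟩; exact (Fin.castSucc_lt_last k).ne hk
        · rintro ⟨k | k, hk⟩
          · exact (Fin.castSucc_lt_last k).ne (Sum.inl_injective hk)
          · cases hk
      · refine (Finsupp.embDomain_apply_self
          (Function.Embedding.sumMap Fin.castSuccEmb (Function.Embedding.refl ℕ))
          (α.sumElim β) (Sum.inl k)).trans ?_
        exact (Finsupp.embDomain_apply_self Fin.castSuccEmb α k).symm
    · exact Finsupp.embDomain_apply_self
        (Function.Embedding.sumMap Fin.castSuccEmb (Function.Embedding.refl ℕ))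
        (α.sumElim β) (Sum.inr i)
  have hd : ∀ (m : ℕ) (α : Fin m →₀ ℕ) (β : ℕ →₀ ℕ),
      MvPowerSeries.coeff (α.sumElim β) (bIncl m c) =
        if α = 0 then MvPowerSeries.coeff β c else 0 := by
    intro m α β
    classical
    rw [← coeff_bCoeff, bCoeff_bIncl, MvPowerSeries.algebraMap_apply, MvPowerSeries.coeff_C]
    rfl
  ext d
  obtain ⟨α, β, rfl⟩ : ∃ (α : Fin n →₀ ℕ) (β : ℕ →₀ ℕ), d = α.sumElim β :=
    ⟨_, _, (Finsupp.comapDomain_sumElim_comapDomain d).symm⟩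
  rw [specLast, MvPowerSeries.coeff_killCompl, hE, hd, hd]
  simp only [Finsupp.embDomain_eq_zero]

/-- The inverse limit over `n` of subrings `Γ_n` of `𝕃[[b]][[x_1, …, x_n]]` along the
specialisations `x_{n+1} = 0`, as a ring of compatible sequences. -/
def limRing (G : ∀ n, Subalgebra BSeries (XBSeries n)) :
    Subalgebra BSeries (∀ n, XBSeries n) where
  carrier := {F | (∀ n, F n ∈ G n) ∧ ∀ n, specLast n (F (n + 1)) = F n}
  mul_mem' := by
    rintro f g ⟨hf, hf'⟩ ⟨hg, hg'⟩
    exact ⟨fun n => mul_mem (hf n) (hg n), fun n => by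
      rw [Pi.mul_apply, map_mul, hf', hg', Pi.mul_apply]⟩
  add_mem' := by
    rintro f g ⟨hf, hf'⟩ ⟨hg, hg'⟩
    exact ⟨fun n => add_mem (hf n) (hg n), fun n => by
      rw [Pi.add_apply, map_add, hf', hg', Pi.add_apply]⟩
  algebraMap_mem' := by
    intro c
    exact ⟨fun n => (G n).algebraMap_mem c, fun n => specLast_bIncl n c⟩

/-- The ring `Γ(x|b)`. -/
def GamBLim : Subalgebra BSeries (∀ n, XBSeries n) := limRing GamB

/-- The ring `Γ_+(x|b)`. -/
def GamPlusBLim : Subalgebra BSeries (∀ n, XBSeries n) := limRing GamPlusB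

/-! ### Universal factorial Schur `P`- and `Q`-functions -/

/-- A strict partition `λ_1 > ⋯ > λ_r > 0`. -/
structure StrictPartition where
  /-- The list `λ_1, …, λ_r`. -/
  parts : List ℕ
  strict : parts.Pairwise (· > ·)
  pos : ∀ p ∈ parts, 0 < p

/-- The length `r` of `λ`. -/
def StrictPartition.length (lam : StrictPartition) : ℕ := lam.parts.length

/-- The part `λ_{i+1}`, which is `0` when `i ≥ r`. -/
def StrictPartition.part (lam : StrictPartition) (i : ℕ) : ℕ := lam.parts.getD i 0

/-- The set of strict partitions of length at most `n`. -/
abbrev SP (n : ℕ) : Type := {lam : StrictPartition // lam.length ≤ n}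

/-- The variable `x_{i+1}`. -/
def xVar {n : ℕ} (i : Fin n) : XBSeries n := MvPowerSeries.X (Sum.inl i)

/-- The variable `b_{k+1}`. -/
def bVar (n k : ℕ) : XBSeries n := MvPowerSeries.X (Sum.inr k)

/-- `[t|b]^k = (t ⊕ b_1) ⋯ (t ⊕ b_k)`. -/
def factPow {n : ℕ} (t : XBSeries n) (k : ℕ) : XBSeries n :=
  ∏ l ∈ Finset.range k, fadd t (bVar n l)

/-- `[[t|b]]^k = (t ⊕ t) (t ⊕ b_1) ⋯ (t ⊕ b_{k-1})`, and `[[t|b]]^0 = 1`. -/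
def factPowQ {n : ℕ} (t : XBSeries n) : ℕ → XBSeries n
  | 0 => 1
  | k + 1 => fadd t t * factPow t k

/-- The total ring of fractions of `𝕃[[x_1, …, x_n, b_1, b_2, …]]`. -/
abbrev XBFrac (n : ℕ) : Type := FractionRing (XBSeries n)

/-- The fraction `(s ⊕ t) / (s ⊕ χ(t))`. -/
def fgRatio {n : ℕ} (s t : XBSeries n) : XBFrac n :=
  algebraMap (XBSeries n) (XBFrac n) (fadd s t) *
    Ring.inverse (algebraMap (XBSeries n) (XBFrac n) (fadd s (fneg t)))

/-- `1/(n-r)! ∑_w w [m(x_1, λ_1) ⋯ m(x_r, λ_r) ∏_{i ≤ r} ∏_{i < j ≤ n} (x_i ⊕ x_j)/(x_i ⊕ χ(x_j))]`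
with `r` the length of `λ`, where `m(t, k)` plays the role of a `k`-th power of `t` and
`m(t, 0) = 1`. -/
def hallLittlewoodSum (n : ℕ) (m : XBSeries n → ℕ → XBSeries n) (lam : StrictPartition) :
    XBFrac n :=
  Ring.inverse ((n - lam.length).factorial : XBFrac n) *
    ∑ w : Equiv.Perm (Fin n),
      algebraMap (XBSeries n) (XBFrac n) (∏ i : Fin n, m (xVar (w i)) (lam.part i)) *
        ∏ i : Fin n with i.val < lam.length, ∏ j ∈ Finset.Ioi i,
          fgRatio (xVar (w i)) (xVar (w j))

/-- The power series equal to a given fraction. -/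
def toSeries {n : ℕ} : XBFrac n → XBSeries n :=
  Function.invFun (algebraMap (XBSeries n) (XBFrac n))

/-- `P_λ(x_n|b)`, which is `0` when the length of `λ` exceeds `n`. -/
def schurP (n : ℕ) (lam : StrictPartition) : XBSeries n :=
  if lam.length ≤ n then toSeries (hallLittlewoodSum n factPow lam) else 0

/-- `Q_λ(x_n|b)`, which is `0` when the length of `λ` exceeds `n`. -/
def schurQ (n : ℕ) (lam : StrictPartition) : XBSeries n :=
  if lam.length ≤ n then toSeries (hallLittlewoodSum n factPowQ lam) else 0

/-- `P_λ(x_n|b)⁺`, which is `P_λ(x_1, …, x_n|b)` for even `n` and `P_λ(x_1, …, x_n, 0|b)` for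
odd `n`. -/
def schurPEven (n : ℕ) (lam : StrictPartition) : XBSeries n :=
  if Even n then schurP n lam else specLast n (schurP (n + 1) lam)

/-! ### Formal bases -/

/-- The family `e` is a formal `A`-basis of `Γ`: all its members lie in `Γ`, every (infinite)
`A`-linear combination of them converges to an element of `Γ`, and every element of `Γ` is such
a combination for exactly one family of coefficients. -/
def IsFormalBasis {A M ι : Type} [CommRing A] [CommRing M] [Algebra A M] [TopologicalSpace M]
    (G : Subalgebra A M) (e : ι → M) : Prop :=
  (∀ i, e i ∈ G) ∧
  (∀ c : ι → A, ∃ F ∈ G, HasSum (fun i => c i • e i) F) ∧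
  ∀ F ∈ G, ∃! c : ι → A, HasSum (fun i => c i • e i) F

end UnivSchur

end

open scoped MvPowerSeries.WithPiTopology
noncomputable section
namespace UnivSchur

/-! ### Well-founded recursion -/

/-! Both families are treated at once: a Boolean `q` selects Q (`true`) or P (`false`), and ψ(t) = t
⊕ t or ψ(t) = t accordingly.

Arithmetic. By Lazard's theorem (`lazardEquiv`) 𝕃 is a polynomial ring over ℤ, hence a domain of
characteristic zero in which 2 is prime; moreover 2 does not divide a_{1,1}. Therefore power series
rings over 𝕃 are domains, the series x_i ⊕ x_j and x_i ⊖ x_j with i ≠ j are prime (up to a unit they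
are x_i - a with a free of x_i), and the ψ(x_i) are regular modulo each other. Such regularity
statements (`RegularMod`) take the place of unique factorisation.

The functions. Let D be the product of x_k ⊖ x_l over all ordered pairs k ≠ l. Multiplication by D
turns the sum of fractions into a power series `hlSum`, indexed by the injections giving the places
of x_1, …, x_r. It is symmetric and each summand is divisible by x_a - x_b, hence the sum is
divisible by (x_a - x_b)² and thus by D (`exists_isHL`). Modulo x_i ⊕ x_j the summands that involve
i or j in their first r places vanish, and the others lose x_i and x_j; cancelling the factors of D
gives supersymmetry (`IsHL.pair`). Modulo ψ(x_i) a single variable drops out if ψ(x_i) divides the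
monomials (`IsHL.single`). These two facts also give the compatibility with specialisation, for P
with b ≠ 0 only two variables at a time.

The bases at b = 0. The kernel of x_n = 0 on Γ or Γ_+ consists of multiples of ∏ ψ(x_i) ∏_{i<j} (x_i
⊕ x_j) (`psiProd_dvd`). After this division the functions of length n become alternating sums of x^β
U with U of constant term 1, which are unitriangular with respect to the strictly decreasing
exponents (`existsUnique_hasSum_altSum`). Induction on n then gives the basis of the whole ring.

Lifting. The coefficient of b^β in ∑ c_λ e_λ involves the coefficient of b^β in c_λ only through the
functions at b = 0; the rest comes from coefficients of smaller degree. So the basis lifts by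
recursion on |β| (`isFormalBasis_bExtend`). In the limit the even n are cofinal and the coefficient
of λ is already determined at any even n ≥ ℓ(λ) (`isFormalBasis_limRing`). All sums converge because
the functions have order at least |λ|, and they stay in the rings because principal ideals of power
series are closed. -/

theorem existsUnique_forall_eq_of_wellFounded {α : Type*} {r : α → α → Prop} (hr : WellFounded r)
    {C : α → Type*} (Φ : ∀ a, (∀ b, r b a → C b) → C a) :
    ∃! c : ∀ a, C a, ∀ a, c a = Φ a fun b _ => c b := by
  refine ⟨hr.fix Φ, fun a => hr.fix_eq Φ a, fun c hc => funext fun a => ?_⟩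
  induction a using hr.induction with
  | _ a ih =>
    rw [hc a, hr.fix_eq]
    congr 1
    ext b hb
    exact ih b hb

/-! ### Symmetric two-cocycles -/

/-- Lucas: C(p^v m, p^v) ≡ m modulo p, and here m = l / p^v is prime to p. -/
theorem not_dvd_choose_prime_pow {p v l : ℕ} (hp : p.Prime) (h : p ^ v ∣ l)
    (h' : ¬ p ^ (v + 1) ∣ l) : ¬ p ∣ l.choose (p ^ v) := by
  have := Fact.mk hp
  obtain ⟨m, rfl⟩ := h
  intro hd
  have h1 := Choose.choose_pow_mul_pow_mul_modEq_choose_nat (p := p) (k := v) (a := m) (b := 1)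
  rw [mul_one, Nat.choose_one_right] at h1
  apply h'
  rw [pow_succ]
  exact mul_dvd_mul_left _ ((h1.dvd_iff dvd_rfl).mp hd)

/-- Put s = p^t - p^v < p^t. Then N - p^v = s + p^t k, so its lowest t digits in base p are those of
s, and Lucas' product is a product of factors C(d, d) = 1. -/
theorem not_dvd_choose_sub_prime_pow {p v t N : ℕ} (hp : p.Prime) (hN : 0 < N) (h : p ^ t ∣ N)
    (hv : v ≤ t) : ¬ p ∣ (N - p ^ v).choose (p ^ t - p ^ v) := by
  have := Fact.mk hp
  obtain ⟨m, rfl⟩ := h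
  obtain ⟨k, rfl⟩ : ∃ k, m = k + 1 := ⟨m - 1, by
    have : m ≠ 0 := by rintro rfl; simp at hN
    omega⟩
  have hle : p ^ v ≤ p ^ t := Nat.pow_le_pow_right hp.pos hv
  have hpv : 0 < p ^ v := pow_pos hp.pos v
  set s := p ^ t - p ^ v with hs
  have e : p ^ t * (k + 1) - p ^ v = s + p ^ t * k := by rw [mul_add]; omega
  rw [e]
  have h1 := Choose.choose_modEq_choose_mul_prod_range_choose (p := p) (n := s + p ^ t * k)
    (k := s) t
  have h2 : s / p ^ t = 0 := Nat.div_eq_of_lt (by omega)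
  rw [h2, Nat.choose_zero_right, Finset.prod_eq_one, Nat.cast_one, one_mul] at h1
  · intro hd
    have h3 : ((s + p ^ t * k).choose s : ℤ) ≡ 0 [ZMOD p] :=
      (Int.modEq_zero_iff_dvd).mpr (by exact_mod_cast hd)
    have h4 : ((1 : ℕ) : ℤ) ≡ 0 [ZMOD p] := by simpa using h1.symm.trans h3
    rw [Int.modEq_zero_iff_dvd] at h4
    exact hp.one_lt.ne' (Nat.dvd_one.mp (by exact_mod_cast h4))
  · intro i hi
    have hi' : i + 1 ≤ t := Finset.mem_range.mp hi
    have e2 : (s + p ^ t * k) / p ^ i % p = s / p ^ i % p := by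
      obtain ⟨d, rfl⟩ := Nat.exists_eq_add_of_le hi'
      rw [show p ^ (i + 1 + d) * k = p ^ i * (p * (p ^ d * k)) by ring,
        Nat.add_mul_div_left _ _ (pow_pos hp.pos i), Nat.add_mul_mod_self_left]
    rw [e2, Nat.choose_self]

/-- The relations satisfied by the coefficients `a_{i,N-i}` modulo decomposable elements. -/
def IsCocycle {M : Type*} [AddCommGroup M] (N : ℕ) (a : ℕ → M) : Prop :=
  (∀ i, 0 < i → i < N → a i = a (N - i)) ∧
    ∀ i l, 0 < i → i < l → l < N → l.choose i • a l = (N - i).choose (l - i) • a i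

theorem IsCocycle.map {M M' : Type*} [AddCommGroup M] [AddCommGroup M'] {N : ℕ} {a : ℕ → M}
    (h : IsCocycle N a) (f : M →+ M') : IsCocycle N fun i => f (a i) :=
  ⟨fun i h1 h2 => congrArg f (h.1 i h1 h2), fun i l h1 h2 h3 => by
    rw [← map_nsmul, h.2 i l h1 h2 h3, map_nsmul]⟩

/-- The coefficients of (u + v)^N; divided by their greatest common divisor they are the reference
cocycle in `IsCocycle.mem_zmultiples`. -/
theorem isCocycle_choose (N : ℕ) : IsCocycle N fun i => (N.choose i : ℤ) := by
  refine ⟨fun i _ h => by simp only [Nat.choose_symm h.le], fun i l _ h1 h2 => ?_⟩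
  have := Nat.choose_mul (n := N) (k := l) (s := i) h1.le
  simp only [nsmul_eq_mul]
  rw [mul_comm, mul_comm (((N - i).choose (l - i) : ℕ) : ℤ)]
  exact_mod_cast this

/-- In the relation between p^v and p^t the coefficient of a(p^v) is a unit, so a(p^t) = 0 gives
a(p^v) = 0 for v ≤ t. If p^v exactly divides l, the relation between p^v and l has a unit in front
of a(l). This settles all l not divisible by p^(t+1); for the others the symmetry l ↔ N - l helps.
-/
theorem IsCocycle.eq_zero {p N t : ℕ} [Fact p.Prime] {a : ℕ → ZMod p} (h : IsCocycle N a)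
    (ht : p ^ t ∣ N) (htN : p ^ t < N)
    (hN : ∀ l, 0 < l → l < N → ¬ p ^ (t + 1) ∣ l ∨ ¬ p ^ (t + 1) ∣ N - l) (h0 : a (p ^ t) = 0) :
    ∀ l, 0 < l → l < N → a l = 0 := by
  have hp : p.Prime := Fact.out
  have hpw : ∀ v ≤ t, a (p ^ v) = 0 := by
    intro v hv
    rcases hv.eq_or_lt with rfl | hv'
    · exact h0
    have h1 := h.2 (p ^ v) (p ^ t) (pow_pos hp.pos v) (Nat.pow_lt_pow_right hp.one_lt hv') htN
    rw [h0, smul_zero, nsmul_eq_mul, eq_comm, mul_eq_zero, ZMod.natCast_eq_zero_iff] at h1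
    exact h1.resolve_left (not_dvd_choose_sub_prime_pow hp (by omega) ht hv)
  have key : ∀ l, 0 < l → l < N → ¬ p ^ (t + 1) ∣ l → a l = 0 := by
    intro l hl hlN hd
    set v := padicValNat p l with hv
    have hvl : p ^ v ∣ l := pow_padicValNat_dvd
    have hvl' : ¬ p ^ (v + 1) ∣ l := pow_succ_padicValNat_not_dvd hl.ne'
    have hvt : v ≤ t := by
      by_contra hvt
      exact hd ((pow_dvd_pow p (by omega)).trans hvl)
    rcases (Nat.le_of_dvd hl hvl).eq_or_lt with heq | hlt
    · rw [← heq]; exact hpw v hvt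
    · have h1 := h.2 (p ^ v) l (pow_pos hp.pos v) hlt hlN
      rw [hpw v hvt, smul_zero, nsmul_eq_mul, mul_eq_zero, ZMod.natCast_eq_zero_iff] at h1
      exact h1.resolve_left (not_dvd_choose_prime_pow hp hvl hvl')
  intro l hl hlN
  rcases hN l hl hlN with hd | hd
  · exact key l hl hlN hd
  · rw [h.1 l hl hlN]
    exact key _ (by omega) (by omega) hd

/-- In general t is the p-adic valuation of N. If N is itself a power of p, then p^t < N requires t
to be one less, and p^(t+1) = N divides no l < N. -/
theorem exists_cocycle_exponent {p N : ℕ} (hp : p.Prime) (hN : 2 ≤ N) :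
    ∃ t, p ^ t ∣ N ∧ p ^ t < N ∧
      ∀ l, 0 < l → l < N → ¬ p ^ (t + 1) ∣ l ∨ ¬ p ^ (t + 1) ∣ N - l := by
  have := Fact.mk hp
  set s := padicValNat p N with hs
  have hsN : p ^ s ∣ N := pow_padicValNat_dvd
  have hsN' : ¬ p ^ (s + 1) ∣ N := pow_succ_padicValNat_not_dvd (by omega)
  rcases (Nat.le_of_dvd (by omega) hsN).eq_or_lt with heq | hlt
  · obtain ⟨t, ht⟩ : ∃ t, s = t + 1 := ⟨s - 1, by
      have : s ≠ 0 := by intro h; rw [h] at heq; simp at heq; omega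
      omega⟩
    refine ⟨t, (pow_dvd_pow p (by omega)).trans hsN, ?_, fun l hl hlN => Or.inl fun hd => ?_⟩
    · rw [← heq, ht]; exact Nat.pow_lt_pow_right hp.one_lt (by omega)
    · rw [← ht, heq] at hd
      exact absurd (Nat.le_of_dvd hl hd) (by omega)
  · refine ⟨s, hsN, hlt, fun l hl hlN => ?_⟩
    by_contra! hd
    apply hsN'
    have := dvd_add hd.1 hd.2
    rwa [Nat.add_sub_cancel' hlN.le] at this

/-- Symmetric two-cocycles of degree `N` with values in `𝔽_p` are determined by one entry. -/
theorem IsCocycle.eq_zero_of_pairing {p N : ℕ} [Fact p.Prime] (hN : 2 ≤ N) {a c : ℕ → ZMod p}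
    (ha : IsCocycle N a) (hc : IsCocycle N c) {k : ℕ → ℤ}
    (hka : ∑ j ∈ Finset.Ioo 0 N, k j • a j = 0) (hkc : ∑ j ∈ Finset.Ioo 0 N, k j • c j ≠ 0) :
    ∀ l, 0 < l → l < N → a l = 0 := by
  have hp : p.Prime := Fact.out
  obtain ⟨t, h1, h2, h3⟩ := exists_cocycle_exponent hp hN
  have hc0 : c (p ^ t) ≠ 0 := fun h0 => hkc <| Finset.sum_eq_zero fun j hj => by
    rw [hc.eq_zero h1 h2 h3 h0 j (Finset.mem_Ioo.mp hj).1 (Finset.mem_Ioo.mp hj).2, smul_zero]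
  -- By `IsCocycle.eq_zero` a cocycle is determined by its entry at p^t, so `a` is q times `c`; the
  -- pairing with `k` then forces q = 0.
  set q := a (p ^ t) / c (p ^ t) with hq
  have hd : IsCocycle N fun i => a i - q * c i := by
    refine ⟨fun i h1 h2 => ?_, fun i l h1 h2 h3 => ?_⟩
    · simp only; rw [ha.1 i h1 h2, hc.1 i h1 h2]
    · have e1 := ha.2 i l h1 h2 h3
      have e2 := hc.2 i l h1 h2 h3
      simp only [nsmul_eq_mul] at e1 e2 ⊢
      linear_combination e1 - q * e2
  have hz := hd.eq_zero h1 h2 h3 (by simp only [hq]; rw [div_mul_cancel₀ _ hc0, sub_self])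
  have hz' : ∀ j ∈ Finset.Ioo 0 N, a j = q * c j := fun j hj =>
    sub_eq_zero.mp (hz j (Finset.mem_Ioo.mp hj).1 (Finset.mem_Ioo.mp hj).2)
  have hq0 : q = 0 := by
    have hs : ∑ j ∈ Finset.Ioo 0 N, k j • a j = q * ∑ j ∈ Finset.Ioo 0 N, k j • c j := by
      rw [Finset.mul_sum]
      exact Finset.sum_congr rfl fun j hj => by rw [hz' j hj, mul_smul_comm]
    rw [hs] at hka
    exact (mul_eq_zero.mp hka).resolve_right hkc
  intro l hl hlN
  rw [hz' l (Finset.mem_Ioo.mpr ⟨hl, hlN⟩), hq0, zero_mul]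

/-- Bezout coefficients for the binomial coefficients `C(N, j)`, `0 < j < N`. -/
theorem exists_bezout_choose (N : ℕ) : ∃ (k : ℕ → ℤ) (d : ℤ),
    ∑ j ∈ Finset.Ioo 0 N, k j * (N.choose j : ℤ) = d ∧
      ∀ j ∈ Finset.Ioo 0 N, d ∣ (N.choose j : ℤ) := by
  obtain ⟨d, hd⟩ := (IsPrincipalIdealRing.principal
    (Ideal.span ((fun j => (N.choose j : ℤ)) '' (Finset.Ioo 0 N : Set ℕ)))).principal
  have hmem : d ∈ Ideal.span ((fun j => (N.choose j : ℤ)) '' (Finset.Ioo 0 N : Set ℕ)) := by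
    rw [hd]; exact Submodule.mem_span_singleton_self d
  obtain ⟨k, hk⟩ := (Submodule.mem_span_image_finset_iff_exists_fun ℤ).mp hmem
  classical
  refine ⟨fun j => if hj : j ∈ Finset.Ioo 0 N then k ⟨j, hj⟩ else 0, d, ?_, fun j hj => ?_⟩
  · rw [← hk, ← Finset.sum_attach]
    refine Finset.sum_congr rfl fun j _ => ?_
    simp only [dif_pos j.2, smul_eq_mul]
  have : (N.choose j : ℤ) ∈ Ideal.span {d} := by
    rw [← Ideal.submodule_span_eq, ← hd]
    exact Ideal.subset_span ⟨j, by simpa using hj, rfl⟩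
  exact Ideal.mem_span_singleton.mp this

/-- The Bezout coefficients used to define the polynomial generators of the Lazard ring. -/
def bez (N : ℕ) : ℕ → ℤ := (exists_bezout_choose N).choose

/-- The greatest common divisor of the binomial coefficients `C(N, j)`, `0 < j < N`. -/
def bezGcd (N : ℕ) : ℤ := (exists_bezout_choose N).choose_spec.choose

theorem sum_bez (N : ℕ) : ∑ j ∈ Finset.Ioo 0 N, bez N j * (N.choose j : ℤ) = bezGcd N :=
  (exists_bezout_choose N).choose_spec.choose_spec.1

theorem bezGcd_dvd {N j : ℕ} (hj : j ∈ Finset.Ioo 0 N) : bezGcd N ∣ (N.choose j : ℤ) :=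
  (exists_bezout_choose N).choose_spec.choose_spec.2 j hj

theorem bezGcd_ne_zero {N : ℕ} (hN : 2 ≤ N) : bezGcd N ≠ 0 := fun h => by
  have h1 := bezGcd_dvd (N := N) (j := 1) (Finset.mem_Ioo.mpr ⟨one_pos, hN⟩)
  rw [h, zero_dvd_iff, Nat.choose_one_right] at h1
  omega

/-- The values of a symmetric two-cocycle are multiples of one of their combinations. -/
theorem IsCocycle.mem_zmultiples {M : Type*} [AddCommGroup M] {N : ℕ} (hN : 2 ≤ N) {a : ℕ → M}
    (ha : IsCocycle N a) {i : ℕ} (hi : i ∈ Finset.Ioo 0 N) :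
    a i ∈ AddSubgroup.zmultiples (∑ j ∈ Finset.Ioo 0 N, bez N j • a j) := by
  classical
  set g := ∑ j ∈ Finset.Ioo 0 N, bez N j • a j with hg
  set A : Submodule ℤ M := Submodule.span ℤ (a '' (Finset.Ioo 0 N : Set ℕ)) with hA
  have haA : ∀ j ∈ Finset.Ioo 0 N, a j ∈ A := fun j hj =>
    Submodule.subset_span ⟨j, by simpa using hj, rfl⟩
  have hgA : g ∈ A := Submodule.sum_mem _ fun j hj => A.smul_mem _ (haA j hj)
  have : Module.Finite ℤ A := Module.Finite.span_of_finite ℤ ((Finset.finite_toSet _).image _)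
  set G : Submodule ℤ A := Submodule.span ℤ {(⟨g, hgA⟩ : A)} with hG
  suffices hGt : G = ⊤ by
    have h1 : (⟨a i, haA i hi⟩ : A) ∈ G := hGt ▸ Submodule.mem_top
    obtain ⟨c, hc⟩ := Submodule.mem_span_singleton.mp h1
    exact ⟨c, congrArg Subtype.val hc⟩
  -- If `g` did not generate the finitely generated group `A`, a maximal proper subgroup containing
  -- it would have quotient 𝔽_p for some prime p, giving a map `f` to 𝔽_p with kernel `P` that kills
  -- `g`.
  by_contra hGt
  obtain ⟨P, hP, hGP⟩ := (eq_top_or_exists_le_coatom G).resolve_left hGt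
  have : IsSimpleModule ℤ (A ⧸ P) := isSimpleModule_iff_isCoatom.mpr hP
  obtain ⟨m, hm, ⟨e⟩⟩ := isSimpleModule_iff_quot_maximal.mp ‹IsSimpleModule ℤ (A ⧸ P)›
  obtain ⟨q, rfl⟩ := (IsPrincipalIdealRing.principal m).principal
  have hq : Prime q := by
    have hne : (Ideal.span {q} : Ideal ℤ) ≠ ⊥ := fun hb =>
      Ring.ne_bot_of_isMaximal_of_not_isField (M := Ideal.span {q}) hm Int.not_isField hb
    exact (Ideal.span_singleton_prime (by rintro rfl; simp at hne)).mp hm.isPrime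
  set p := q.natAbs with hp
  have : Fact p.Prime := ⟨Int.prime_iff_natAbs_prime.mp hq⟩
  set f : A →+ ZMod p := ((Int.quotientSpanEquivZMod q).toAddMonoidHom.comp
    e.toAddEquiv.toAddMonoidHom).comp P.mkQ.toAddMonoidHom with hf
  have hf0 : ∀ y, f y = 0 → y ∈ P := by
    intro y hy
    have h1 : e (P.mkQ y) = 0 := (Int.quotientSpanEquivZMod q).injective (by
      rw [map_zero]; exact hy)
    rw [LinearEquiv.map_eq_zero_iff] at h1
    simpa using h1
  have hfP : ∀ y ∈ P, f y = 0 := by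
    intro y hy
    have h1 : P.mkQ y = 0 := by simpa using hy
    change (Int.quotientSpanEquivZMod q) (e (P.mkQ y)) = 0
    rw [h1, map_zero, map_zero]
  set a' : ℕ → A := fun j => if hj : j ∈ Finset.Ioo 0 N then ⟨a j, haA j hj⟩ else 0 with ha'
  have hval : ∀ j, 0 < j → j < N → (a' j : M) = a j := fun j h1 h2 => by
    simp only [ha', dif_pos (Finset.mem_Ioo.mpr ⟨h1, h2⟩)]
  have hca : IsCocycle N a' := by
    refine ⟨fun i h1 h2 => Subtype.ext ?_, fun i l h1 h2 h3 => Subtype.ext ?_⟩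
    · rw [hval i h1 h2, hval _ (by omega) (by omega), ha.1 i h1 h2]
    · rw [AddSubmonoidClass.coe_nsmul, AddSubmonoidClass.coe_nsmul, hval i h1 (by omega), hval l (by omega) h3,
        ha.2 i l h1 h2 h3]
  -- The binomial coefficients themselves may all vanish modulo p. Divided by their gcd they pair to
  -- 1 with `bez N`, hence to a nonzero element modulo every prime.
  obtain ⟨u, hu⟩ : ∃ u : ℕ → ℤ, ∀ j ∈ Finset.Ioo 0 N, (N.choose j : ℤ) = bezGcd N * u j :=
    ⟨fun j => (N.choose j : ℤ) / bezGcd N, fun j hj => (Int.mul_ediv_cancel' (bezGcd_dvd hj)).symm⟩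
  have hd0 := bezGcd_ne_zero hN
  have hcu : IsCocycle N u := by
    have h := isCocycle_choose N
    refine ⟨fun i h1 h2 => ?_, fun i l h1 h2 h3 => ?_⟩
    · have e := h.1 i h1 h2
      simp only at e
      rw [hu i (Finset.mem_Ioo.mpr ⟨h1, h2⟩),
        hu (N - i) (Finset.mem_Ioo.mpr ⟨by omega, by omega⟩)] at e
      exact mul_left_cancel₀ hd0 e
    · have e := h.2 i l h1 h2 h3
      simp only [nsmul_eq_mul] at e ⊢
      rw [hu i (Finset.mem_Ioo.mpr ⟨h1, by omega⟩),
        hu l (Finset.mem_Ioo.mpr ⟨by omega, h3⟩)] at e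
      apply mul_left_cancel₀ hd0
      linear_combination e
  have hku : ∑ j ∈ Finset.Ioo 0 N, bez N j • u j = 1 := by
    have h1 := sum_bez N
    rw [Finset.sum_congr rfl fun j hj => by rw [hu j hj, mul_left_comm], ← Finset.mul_sum] at h1
    exact mul_left_cancel₀ hd0 (by rw [mul_one]; exact h1)
  have hga : ∑ j ∈ Finset.Ioo 0 N, bez N j • a' j = ⟨g, hgA⟩ := by
    apply Subtype.ext
    rw [AddSubmonoidClass.coe_finsetSum]
    refine Finset.sum_congr rfl fun j hj => ?_
    rw [Submodule.coe_smul, hval j (Finset.mem_Ioo.mp hj).1 (Finset.mem_Ioo.mp hj).2]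
  -- The image of `a` under `f` pairs to f(g) = 0 and that of `u` to 1, so `f` kills all generators
  -- of `A`, contrary to P ≠ ⊤.
  have hz := IsCocycle.eq_zero_of_pairing hN (hca.map f) (hcu.map (Int.castAddHom (ZMod p)))
    (k := bez N) (by
      simp only [← map_zsmul]
      rw [← map_sum, hga]
      exact hfP _ (hGP (Submodule.mem_span_singleton_self _))) (by
      simp only [← map_zsmul]
      rw [← map_sum, hku]
      simp)
  apply hP.1
  rw [eq_top_iff]
  rintro ⟨y, hy⟩ -
  induction hy using Submodule.span_induction with
  | mem y hy =>
    obtain ⟨j, hj, rfl⟩ := hy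
    have hj' : j ∈ Finset.Ioo 0 N := by simpa using hj
    have h1 := hz j (Finset.mem_Ioo.mp hj').1 (Finset.mem_Ioo.mp hj').2
    have h2 := hf0 _ h1
    simp only [ha', dif_pos hj'] at h2
    exact h2
  | zero => exact P.zero_mem
  | add y z hy hz h1 h2 => exact P.add_mem h1 h2
  | smul c y hy h1 => exact P.smul_mem c h1

open Finsupp (single)

/-! ### Generators of the Lazard ring -/

/-- The exponent `u ^ i v ^ j`. -/
def expPair (i j : ℕ) : Fin 2 →₀ ℕ := single 0 i + single 1 j

@[simp] theorem expPair_zero (i j : ℕ) : expPair i j 0 = i := by simp [expPair]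
@[simp] theorem expPair_one (i j : ℕ) : expPair i j 1 = j := by simp [expPair]

theorem eq_expPair (d : Fin 2 →₀ ℕ) : d = expPair (d 0) (d 1) := by
  ext i; fin_cases i <;> simp

theorem degree_fin_two (d : Fin 2 →₀ ℕ) : d.degree = d 0 + d 1 := by
  rw [Finsupp.degree_eq_sum, Fin.sum_univ_two]

/-! ### Associativity and the cocycle relations modulo lower coefficients -/

section Assoc

variable {R : Type} [CommRing R]

/-- Applied to F and u + v: the leading form of F^m is (u + v)^m. -/
theorem add_one_le_order_pow_sub_pow {σ : Type*} {f g : MvPowerSeries σ R}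
    (hf : 1 ≤ f.order) (hg : 1 ≤ g.order) (h : 2 ≤ (f - g).order) (m : ℕ) :
    (m + 1 : ℕ) ≤ (f ^ m - g ^ m).order := by
  induction m with
  | zero => simp
  | succ m ih =>
    have e : f ^ (m + 1) - g ^ (m + 1) = f ^ m * (f - g) + (f ^ m - g ^ m) * g := by ring
    rw [e]
    refine le_trans (le_min ?_ ?_) MvPowerSeries.min_order_le_add
    · refine le_trans ?_ MvPowerSeries.le_order_mul
      have h1 : (m : ℕ∞) ≤ (f ^ m).order :=
        le_trans (by simpa using nsmul_le_nsmul_right hf m) (MvPowerSeries.le_order_pow m)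
      refine le_trans ?_ (add_le_add h1 h)
      push_cast; rw [add_assoc]; norm_num
    · refine le_trans ?_ MvPowerSeries.le_order_mul
      refine le_trans ?_ (add_le_add ih hg)
      push_cast; rfl

/-- Series of the form `u + v + (terms divisible by u v)`. -/
structure IsAddLike (F : MvPowerSeries (Fin 2) R) : Prop where
  left : ∀ i, MvPowerSeries.coeff (expPair i 0) F = if i = 1 then 1 else 0
  right : ∀ j, MvPowerSeries.coeff (expPair 0 j) F = if j = 1 then 1 else 0

variable {F : MvPowerSeries (Fin 2) R}

theorem IsAddLike.constantCoeff (h : IsAddLike F) : MvPowerSeries.constantCoeff F = 0 := by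
  rw [← MvPowerSeries.coeff_zero_eq_constantCoeff_apply]
  simpa [expPair] using h.left 0

theorem IsAddLike.two_le_order_sub (h : IsAddLike F) :
    2 ≤ (F - (MvPowerSeries.X 0 + MvPowerSeries.X 1)).order := by
  refine MvPowerSeries.nat_le_order (n := 2) fun d hd => ?_
  rw [degree_fin_two] at hd
  have h1 := h.left (d 0)
  have h2 := h.right (d 1)
  rcases Nat.eq_zero_or_pos (d 1) with hz | hz
  · have e : d = expPair (d 0) 0 := by rw [← hz]; exact eq_expPair d
    have e1 : d = single 0 (d 0) := by rw [e]; simp [expPair]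
    rw [e1, ← show expPair (d 0) 0 = single 0 (d 0) by simp [expPair], map_sub, h1, map_add,
      MvPowerSeries.coeff_X, MvPowerSeries.coeff_X]
    have : expPair (d 0) 0 ≠ single 1 1 := fun hh => by
      have := DFunLike.congr_fun hh 1; simp at this
    rw [if_neg this]
    have : expPair (d 0) 0 = single 0 1 ↔ d 0 = 1 := by
      constructor
      · intro hh; simpa using DFunLike.congr_fun hh 0
      · intro hh; rw [hh]; simp [expPair]
    simp only [this]; simp
  · have hz0 : d 0 = 0 := by omega
    have hz1 : d 1 = 1 := by omega
    have e : d = single 1 1 := by rw [eq_expPair d, hz0, hz1]; simp [expPair]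
    have h3 : MvPowerSeries.coeff (single 1 1) F = 1 := by simpa [hz1, expPair] using h2
    have h4 : (single 1 1 : Fin 2 →₀ ℕ) ≠ single 0 1 := fun hh => by
      have := DFunLike.congr_fun hh 1
      simp at this
    rw [e, map_sub, map_add, h3, MvPowerSeries.coeff_X, MvPowerSeries.coeff_X, if_neg h4,
      if_pos rfl, zero_add, sub_self]

theorem IsAddLike.coeff_pow (h : IsAddLike F) (i j : ℕ) :
    MvPowerSeries.coeff (expPair i j) (F ^ (i + j)) = ((i + j).choose i : R) := by
  have hL : 1 ≤ (MvPowerSeries.X 0 + MvPowerSeries.X 1 : MvPowerSeries (Fin 2) R).order := by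
    rw [MvPowerSeries.one_le_order_iff_constCoeff_eq_zero]; simp
  have hF : 1 ≤ F.order := by
    rw [MvPowerSeries.one_le_order_iff_constCoeff_eq_zero]; exact h.constantCoeff
  have h1 := add_one_le_order_pow_sub_pow hF hL h.two_le_order_sub (i + j)
  have h2 : MvPowerSeries.coeff (expPair i j)
      (F ^ (i + j) - (MvPowerSeries.X 0 + MvPowerSeries.X 1) ^ (i + j)) = 0 := by
    refine MvPowerSeries.coeff_of_lt_order (lt_of_lt_of_le ?_ h1)
    rw [degree_fin_two]; simp only [expPair_zero, expPair_one]
    exact_mod_cast Nat.lt_succ_self _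
  rw [map_sub, sub_eq_zero] at h2
  rw [h2]
  have h3 := PowerSeries.coeff_subst_X_zero_add_X_one (PowerSeries.X ^ (i + j) : PowerSeries R)
    (expPair i j)
  have hs : PowerSeries.HasSubst
      (MvPowerSeries.X 0 + MvPowerSeries.X 1 : MvPowerSeries (Fin 2) R) :=
    PowerSeries.HasSubst.of_constantCoeff_zero (by simp)
  rw [PowerSeries.subst_pow hs, PowerSeries.subst_X hs] at h3
  rw [h3]
  simp [PowerSeries.coeff_X_pow]

/-- Coefficients of degree less than `N` of products of series whose coefficients of degree
less than `N` lie in a subring. -/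
def coeffSubring {σ : Type*} (B : Subring R) (N : ℕ) : Subring (MvPowerSeries σ R) where
  carrier := {f | ∀ d : σ →₀ ℕ, d.degree < N → MvPowerSeries.coeff d f ∈ B}
  mul_mem' := by
    classical
    intro f g hf hg d hd
    rw [MvPowerSeries.coeff_mul]
    refine B.sum_mem fun p hp => B.mul_mem (hf _ ?_) (hg _ ?_)
    all_goals
      rw [Finset.HasAntidiagonal.mem_antidiagonal] at hp
      rw [← hp, map_add] at hd
      omega
  one_mem' := by
    classical
    intro d _
    rw [MvPowerSeries.coeff_one]
    split_ifs
    exacts [B.one_mem, B.zero_mem]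
  add_mem' := fun hf hg d hd => by
    rw [map_add]; exact B.add_mem (hf d hd) (hg d hd)
  zero_mem' := fun d _ => by rw [map_zero]; exact B.zero_mem
  neg_mem' := fun hf d hd => by rw [map_neg]; exact B.neg_mem (hf d hd)

/-- The exponent `u ^ i v ^ j w ^ k`. -/
def expTriple (i j k : ℕ) : Fin 3 →₀ ℕ := single 0 i + single 1 j + single 2 k

/-- F(u, v) is free of w, so the exponent of w comes from the second factor alone. -/
theorem coeff_subst_castSucc_pow_mul (i j k p q : ℕ) :
    MvPowerSeries.coeff (expTriple i j k)
      ((F.subst ![(MvPowerSeries.X 0 : MvPowerSeries (Fin 3) R), MvPowerSeries.X 1]) ^ p *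
        MvPowerSeries.X 2 ^ q) =
      if q = k then MvPowerSeries.coeff (expPair i j) (F ^ p) else 0 := by
  classical
  have hren : F.subst ![(MvPowerSeries.X 0 : MvPowerSeries (Fin 3) R), MvPowerSeries.X 1] =
      MvPowerSeries.rename (Fin.castSuccEmb : Fin 2 ↪ Fin 3) F := by
    rw [MvPowerSeries.rename_eq_subst]
    congr 1; ext1 s; fin_cases s <;> rfl
  have hT : ∀ l, expTriple i j l = Finsupp.embDomain (Fin.castSuccEmb : Fin 2 ↪ Fin 3)
      (expPair i j) + single 2 l := by
    intro l
    rw [expPair, Finsupp.embDomain_add, Finsupp.embDomain_single, Finsupp.embDomain_single]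
    rfl
  rw [hren, ← map_pow, MvPowerSeries.X_pow_eq, MvPowerSeries.coeff_mul_monomial, mul_one]
  by_cases hqk : q = k
  · subst hqk
    rw [if_pos rfl, if_pos (by simp [expTriple]), hT q, add_tsub_cancel_right,
      MvPowerSeries.coeff_embDomain_rename]
  · rw [if_neg hqk]
    split_ifs with hle
    · refine MvPowerSeries.coeff_rename_eq_zero _ _ ?_
      rintro ⟨γ, hγ⟩
      have h2 := DFunLike.congr_fun hγ 2
      rw [Finsupp.mapDomain_of_notMem_range] at h2
      · have h3 := hle 2
        simp [expTriple] at h2 h3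
        omega
      · rintro ⟨s, hs⟩; fin_cases s <;> simp [Fin.ext_iff] at hs
    · rfl

/-- The coefficient of u^i v^j w^k in F(F(u,v), w) is the sum over p of a_{p,k} times the
coefficient of u^i v^j in F^p. For p > i + j the latter is zero, for p = i + j it is the binomial
coefficient, and for p < i + j both factors involve only coefficients of F of degree below i + j +
k; for the second factor this uses k > 0. -/
theorem IsAddLike.coeff_assocLeft_sub_mem (h : IsAddLike F) {B : Subring R} {i j k : ℕ}
    (hk : 0 < k)
    (hB : ∀ d : Fin 2 →₀ ℕ, d.degree < i + j + k → MvPowerSeries.coeff d F ∈ B) :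
    MvPowerSeries.coeff (expTriple i j k)
      (F.subst ![F.subst ![(MvPowerSeries.X 0 : MvPowerSeries (Fin 3) R), MvPowerSeries.X 1],
        MvPowerSeries.X 2]) -
      ((i + j).choose i : R) * MvPowerSeries.coeff (expPair (i + j) k) F ∈ B := by
  classical
  have hs := MvPowerSeries.HasSubst.cons_subst_zero_left (R := R) (0 : Fin 3) 1 2 h.constantCoeff
  have hfin := MvPowerSeries.coeff_subst_finite hs F (expTriple i j k)
  rw [MvPowerSeries.coeff_subst hs]
  set G := F.subst ![(MvPowerSeries.X 0 : MvPowerSeries (Fin 3) R), MvPowerSeries.X 1] with hG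
  have hp : ∀ d : Fin 2 →₀ ℕ,
      (d.prod fun s e => (![G, (MvPowerSeries.X 2 : MvPowerSeries (Fin 3) R)] s) ^ e) =
        G ^ d 0 * MvPowerSeries.X 2 ^ d 1 := fun d => by
    rw [Finsupp.prod_fintype _ _ (fun i => pow_zero _), Fin.prod_univ_two]; rfl
  have hF : F ∈ coeffSubring B (i + j + k) := hB
  have hterm : ∀ d : Fin 2 →₀ ℕ, d ≠ expPair (i + j) k → MvPowerSeries.coeff d F •
      MvPowerSeries.coeff (expTriple i j k)
        (d.prod fun s e => (![G, (MvPowerSeries.X 2 : MvPowerSeries (Fin 3) R)] s) ^ e) ∈ B := by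
    intro d hd
    rw [hp, hG, coeff_subst_castSucc_pow_mul]
    split_ifs with hq
    · rcases lt_trichotomy (d 0) (i + j) with hlt | heq | hgt
      · refine B.mul_mem (hB d (by rw [degree_fin_two]; omega)) ?_
        refine (Subring.pow_mem _ hF (d 0)) (expPair i j) ?_
        rw [degree_fin_two]; simp; omega
      · exact absurd (by rw [eq_expPair d, heq, hq]) hd
      · have hz : MvPowerSeries.coeff (expPair i j) (F ^ d 0) = 0 := by
          refine MvPowerSeries.coeff_of_lt_order (lt_of_lt_of_le ?_
            (MvPowerSeries.le_order_pow_of_constantCoeff_eq_zero (d 0) h.constantCoeff))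
          rw [degree_fin_two]
          simpa using by exact_mod_cast hgt
        rw [hz, smul_zero]
        exact B.zero_mem
    · rw [smul_zero]; exact B.zero_mem
  have hmain : MvPowerSeries.coeff (expPair (i + j) k) F • MvPowerSeries.coeff (expTriple i j k)
      ((expPair (i + j) k).prod fun s e =>
        (![G, (MvPowerSeries.X 2 : MvPowerSeries (Fin 3) R)] s) ^ e) =
      ((i + j).choose i : R) * MvPowerSeries.coeff (expPair (i + j) k) F := by
    rw [hp, hG, coeff_subst_castSucc_pow_mul]
    simp only [expPair_zero, expPair_one, if_true]
    rw [h.coeff_pow, smul_eq_mul, mul_comm]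
  rw [finsum_eq_sum_of_support_subset (s := insert (expPair (i + j) k) hfin.toFinset) _ (by
    intro x hx; simp only [Finset.coe_insert]; exact Or.inr (by simpa using hx)),
    ← Finset.add_sum_erase _ _ (Finset.mem_insert_self _ _), hmain, add_sub_cancel_left]
  exact B.sum_mem fun d hd => hterm d (Finset.ne_of_mem_erase hd)

/-- The coefficients of a commutative formal group law form a cocycle modulo any subring
containing the coefficients of smaller degree. -/
theorem isCocycle_coeff (G : FormalGroup R) [G.IsComm] (h : IsAddLike G.toPowerSeries)
    {B : Subring R} {N : ℕ}
    (hB : ∀ d : Fin 2 →₀ ℕ, d.degree < N → MvPowerSeries.coeff d G.toPowerSeries ∈ B) :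
    IsCocycle N fun i => QuotientAddGroup.mk' B.toAddSubgroup
      (MvPowerSeries.coeff (expPair i (N - i)) G.toPowerSeries) := by
  set F := G.toPowerSeries with hF
  have hsymm : ∀ i j, MvPowerSeries.coeff (expPair i j) F =
      MvPowerSeries.coeff (expPair j i) F := by
    intro i j
    have h1 : F = MvPowerSeries.rename (Equiv.swap (0 : Fin 2) 1).toEmbedding F := by
      conv_lhs => rw [hF, FormalGroup.IsComm.comm (F := G)]
      rw [MvPowerSeries.rename_eq_subst]
      congr 1; ext1 s; fin_cases s <;> rfl
    conv_lhs => rw [h1]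
    have h2 : expPair i j = Finsupp.embDomain (Equiv.swap (0 : Fin 2) 1).toEmbedding
        (expPair j i) := by
      rw [expPair, expPair, Finsupp.embDomain_add, Finsupp.embDomain_single,
        Finsupp.embDomain_single, add_comm]; rfl
    rw [h2, MvPowerSeries.coeff_embDomain_rename]
  refine ⟨fun i _ hi => ?_, fun i l hi hl hlN => ?_⟩
  · simp only; rw [Nat.sub_sub_self hi.le, hsymm]
  · obtain ⟨j, rfl⟩ := Nat.exists_eq_add_of_lt hl
    obtain ⟨k, rfl⟩ := Nat.exists_eq_add_of_lt hlN
    have e1 := h.coeff_assocLeft_sub_mem (B := B) (i := i) (j := j + 1) (k := k + 1)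
      (by omega) fun d hd => hB d (by omega)
    have e2 := h.coeff_assocLeft_sub_mem (B := B) (i := k + 1) (j := j + 1) (k := i)
      hi fun d hd => hB d (by omega)
    -- Associativity and commutativity make F(F(u,v), w) invariant under u ↔ w. The two expansions
    -- of the same coefficient, `e1` and `e2`, then differ by the cocycle relation.
    have hrev : MvPowerSeries.coeff (expTriple i (j + 1) (k + 1))
        (F.subst ![F.subst ![(MvPowerSeries.X 0 : MvPowerSeries (Fin 3) R), MvPowerSeries.X 1],
          MvPowerSeries.X 2]) = MvPowerSeries.coeff (expTriple (k + 1) (j + 1) i)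
        (F.subst ![F.subst ![(MvPowerSeries.X 0 : MvPowerSeries (Fin 3) R), MvPowerSeries.X 1],
          MvPowerSeries.X 2]) := by
      have h2 : expTriple i (j + 1) (k + 1) = Finsupp.embDomain
          (Equiv.swap (0 : Fin 3) 2).toEmbedding (expTriple (k + 1) (j + 1) i) := by
        rw [expTriple, expTriple, Finsupp.embDomain_add, Finsupp.embDomain_add,
          Finsupp.embDomain_single, Finsupp.embDomain_single, Finsupp.embDomain_single]
        ext s; fin_cases s <;> simp [Equiv.swap_apply_def]
      have hs := MvPowerSeries.HasSubst.cons_subst_zero_left (R := R) (0 : Fin 3) 1 2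
        h.constantCoeff
      have hX : ∀ s : Fin 3, PowerSeries.HasSubst (MvPowerSeries.X s : MvPowerSeries (Fin 3) R) :=
        fun s => PowerSeries.HasSubst.of_constantCoeff_zero (by simp)
      have hF2 : ∀ s t : Fin 3, PowerSeries.HasSubst (F.subst
          ![(MvPowerSeries.X s : MvPowerSeries (Fin 3) R), MvPowerSeries.X t]) := fun s t =>
        PowerSeries.HasSubst.of_constantCoeff_zero
          (MvPowerSeries.constantCoeff_subst_eq_zero .X_X
            (fun i => by fin_cases i <;> simp) h.constantCoeff)
      have h3 : F.subst ![F.subst ![(MvPowerSeries.X 0 : MvPowerSeries (Fin 3) R),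
          MvPowerSeries.X 1], MvPowerSeries.X 2] =
          MvPowerSeries.rename (Equiv.swap (0 : Fin 3) 2).toEmbedding
          (F.subst ![F.subst ![(MvPowerSeries.X 0 : MvPowerSeries (Fin 3) R),
          MvPowerSeries.X 1], MvPowerSeries.X 2]) := by
        conv_rhs => rw [MvPowerSeries.rename_eq_subst, MvPowerSeries.subst_comp_subst_apply hs
          (MvPowerSeries.HasSubst.X_comp _)]
        rw [G.assoc, G.comm' (hX 0) (hF2 1 2), G.comm' (hX 1) (hX 2)]
        congr 1; ext1 s
        fin_cases s
        · simp only [Fin.zero_eta, Matrix.cons_val_zero]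
          rw [MvPowerSeries.subst_comp_subst_apply .X_X (MvPowerSeries.HasSubst.X_comp _)]
          congr 1; ext1 s
          fin_cases s
          · simp [MvPowerSeries.subst_X (MvPowerSeries.HasSubst.X_comp _)]
          · simp [MvPowerSeries.subst_X (MvPowerSeries.HasSubst.X_comp _), Equiv.swap_apply_def]
        · simp [MvPowerSeries.subst_X (MvPowerSeries.HasSubst.X_comp _)]
      conv_lhs => rw [h3, h2]
      rw [MvPowerSeries.coeff_embDomain_rename]
    rw [hrev] at e1
    have e3 := B.sub_mem e2 e1
    rw [sub_sub_sub_cancel_left] at e3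
    simp only
    rw [← map_nsmul (QuotientAddGroup.mk' B.toAddSubgroup), ← map_nsmul (QuotientAddGroup.mk' B.toAddSubgroup), ← sub_eq_zero,
      ← map_sub (QuotientAddGroup.mk' B.toAddSubgroup)]
    refine (QuotientAddGroup.eq_zero_iff _).mpr ?_
    simp only [nsmul_eq_mul]
    rw [show i + j + 1 + k + 1 - i = k + 1 + (j + 1) by omega,
      show i + j + 1 - i = k + 1 + (j + 1) - (k + 1) by omega,
      show i + j + 1 + k + 1 - (i + j + 1) = k + 1 by omega, Nat.choose_symm (by omega),
      hsymm i]
    exact e3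

end Assoc

/-! ### Universality and the structure of the Lazard ring -/

theorem coeff_subst_X_zero {R : Type} [CommRing R] (F : MvPowerSeries (Fin 2) R) (i : ℕ) :
    PowerSeries.coeff i (F.subst ![(PowerSeries.X : PowerSeries R), 0]) =
      MvPowerSeries.coeff (expPair i 0) F := by
  rw [PowerSeries.coeff, MvPowerSeries.coeff_subst
    (show MvPowerSeries.HasSubst ![(PowerSeries.X : PowerSeries R), 0] from .X_zero),
    finsum_eq_single _ (expPair i 0)]
  · rw [Finsupp.prod_fintype _ _ (fun i => pow_zero _), Fin.prod_univ_two]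
    have := PowerSeries.coeff_X_pow (R := R) i i
    simp only [PowerSeries.coeff] at this
    simp [this]
  · intro d hd
    rw [Finsupp.prod_fintype _ _ (fun i => pow_zero _), Fin.prod_univ_two]
    have h1 := PowerSeries.coeff_X_pow (R := R) i (d 0)
    simp only [PowerSeries.coeff] at h1
    by_cases hd1 : d 1 = 0
    · have : i ≠ d 0 := fun h => hd (by rw [eq_expPair d, hd1, h])
      simp [hd1, h1, this]
    · simp [hd1]

theorem coeff_subst_zero_X {R : Type} [CommRing R] (F : MvPowerSeries (Fin 2) R) (i : ℕ) :
    PowerSeries.coeff i (F.subst ![0, (PowerSeries.X : PowerSeries R)]) =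
      MvPowerSeries.coeff (expPair 0 i) F := by
  rw [PowerSeries.coeff, MvPowerSeries.coeff_subst
    (show MvPowerSeries.HasSubst ![0, (PowerSeries.X : PowerSeries R)] from .zero_X),
    finsum_eq_single _ (expPair 0 i)]
  · rw [Finsupp.prod_fintype _ _ (fun i => pow_zero _), Fin.prod_univ_two]
    have := PowerSeries.coeff_X_pow (R := R) i i
    simp only [PowerSeries.coeff] at this
    simp [this]
  · intro d hd
    rw [Finsupp.prod_fintype _ _ (fun i => pow_zero _), Fin.prod_univ_two]
    have h1 := PowerSeries.coeff_X_pow (R := R) i (d 1)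
    simp only [PowerSeries.coeff] at h1
    by_cases hd1 : d 0 = 0
    · have : i ≠ d 1 := fun h => hd (by rw [eq_expPair d, hd1, h])
      simp [hd1, h1, this]
    · simp [hd1]

theorem isAddLike {R : Type} [CommRing R] (G : FormalGroup R) : IsAddLike G.toPowerSeries where
  left i := by
    rw [← coeff_subst_X_zero]
    exact (congrArg (PowerSeries.coeff i) G.Xzero_eq_X).trans (PowerSeries.coeff_X i)
  right j := by
    rw [← coeff_subst_zero_X]
    exact (congrArg (PowerSeries.coeff j) G.zeroX_eq_X).trans (PowerSeries.coeff_X j)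

/-- The Lazard ring carries the universal commutative formal group law. -/
theorem exists_lazard_hom {S : Type} [CommRing S] (G : FormalGroup S) [G.IsComm] :
    ∃ θ : Lazard →+* S, ∀ d, θ (MvPowerSeries.coeff d lazardFGL.toPowerSeries) =
      MvPowerSeries.coeff d G.toPowerSeries := by
  set θ₀ : LazardGen →+* S := MvPolynomial.eval₂Hom (Int.castRingHom S) fun p =>
    MvPowerSeries.coeff (expPair (p.1 + 1) (p.2 + 1)) G.toPowerSeries with hθ₀
  have hG := isAddLike G
  have hmap : genericSeries.map θ₀ = G.toPowerSeries := by
    ext d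
    rw [MvPowerSeries.coeff_map, coeff_genericSeries]
    split_ifs with h0 h1 h1 h2
    · rw [eq_expPair d, h0, h1, hG.right, if_pos rfl, map_one]
    · rw [eq_expPair d, h0, hG.right, if_neg h1, map_zero]
    · rw [eq_expPair d, h2, h1, hG.left, if_pos rfl, map_one]
    · rw [eq_expPair d, h1, hG.left, if_neg h2, map_zero]
    · rw [hθ₀, MvPolynomial.eval₂Hom_X']
      simp only
      rw [Nat.sub_add_cancel (by omega), Nat.sub_add_cancel (by omega), ← eq_expPair]
  have hker : ∀ a ∈ lazardIdeal, θ₀ a = 0 := by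
    intro a ha
    have hle : lazardIdeal ≤ RingHom.ker θ₀ := by
      refine Ideal.span_le.mpr ?_
      rintro _ (⟨d, rfl⟩ | ⟨d, rfl⟩)
      · rw [SetLike.mem_coe, RingHom.mem_ker, map_sub, sub_eq_zero, ← MvPowerSeries.coeff_map,
          ← MvPowerSeries.coeff_map, genericSwap, MvPowerSeries.map_subst .X_X, map_comp_vec]
        simp only [MvPowerSeries.map_X, hmap]
        rw [← FormalGroup.IsComm.comm (F := G)]
      · rw [SetLike.mem_coe, RingHom.mem_ker, map_sub, sub_eq_zero, ← MvPowerSeries.coeff_map,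
          ← MvPowerSeries.coeff_map, genericAssocLeft, genericAssocRight,
          MvPowerSeries.map_subst (MvPowerSeries.HasSubst.cons_subst_zero_left (0 : Fin 3) 1 2
            constantCoeff_genericSeries),
          MvPowerSeries.map_subst (MvPowerSeries.HasSubst.cons_subst_zero_right (0 : Fin 3) 1 2
            constantCoeff_genericSeries), map_comp_vec, map_comp_vec,
          MvPowerSeries.map_subst .X_X, MvPowerSeries.map_subst .X_X, map_comp_vec, map_comp_vec]
        simp only [MvPowerSeries.map_X, hmap]
        rw [G.assoc]
    exact hle ha
  refine ⟨Ideal.Quotient.lift lazardIdeal θ₀ hker, fun d => ?_⟩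
  rw [← hmap, MvPowerSeries.coeff_map]
  exact Ideal.Quotient.lift_mk _ _ _

/-- The coefficient `a_{i,j}` of the universal formal group law. -/
def lazA (i j : ℕ) : Lazard := MvPowerSeries.coeff (expPair i j) lazardFGL.toPowerSeries

/-- Polynomial generators map to the Lazard ring. -/
def lazGen : MvPolynomial ℕ ℤ →+* Lazard :=
  MvPolynomial.eval₂Hom (Int.castRingHom Lazard) fun n =>
    ∑ j ∈ Finset.Ioo 0 (n + 2), bez (n + 2) j • lazA j (n + 2 - j)

theorem lazGen_X (n : ℕ) : lazGen (MvPolynomial.X n) =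
    ∑ j ∈ Finset.Ioo 0 (n + 2), bez (n + 2) j • lazA j (n + 2 - j) :=
  MvPolynomial.eval₂Hom_X' _ _ _

/-- Induction on the degree N = i + j: modulo the image, which contains the coefficients of smaller
degree, the a_{i,N-i} form a cocycle. They are multiples of its Bezout combination, which is the
image of a generator and hence zero modulo the image. -/
theorem lazGen_surjective : Function.Surjective lazGen := by
  have key : ∀ N, ∀ d : Fin 2 →₀ ℕ, d.degree = N →
      MvPowerSeries.coeff d lazardFGL.toPowerSeries ∈ lazGen.range := by
    intro N
    induction N using Nat.strong_induction_on with
    | _ N ih =>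
      intro d hd
      have hL := isAddLike lazardFGL
      rw [degree_fin_two] at hd
      rw [eq_expPair d]
      rcases Nat.eq_zero_or_pos (d 0) with h0 | h0
      · rw [h0, hL.right]; split_ifs
        exacts [one_mem _, zero_mem _]
      rcases Nat.eq_zero_or_pos (d 1) with h1 | h1
      · rw [h1, hL.left]; split_ifs
        exacts [one_mem _, zero_mem _]
      obtain ⟨n, rfl⟩ : ∃ n, N = n + 2 := ⟨N - 2, by omega⟩
      have hc := isCocycle_coeff lazardFGL hL (B := lazGen.range) (N := n + 2)
        fun d hd => ih _ hd d rfl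
      obtain ⟨c, hc⟩ := hc.mem_zmultiples (by omega)
        (Finset.mem_Ioo.mpr ⟨h0, show d 0 < n + 2 by omega⟩)
      have hgen := lazGen_X n
      have hmem : lazGen (MvPolynomial.X n) ∈ lazGen.range.toAddSubgroup := ⟨_, rfl⟩
      have h2 : (∑ j ∈ Finset.Ioo 0 (n + 2), bez (n + 2) j •
          QuotientAddGroup.mk' lazGen.range.toAddSubgroup (MvPowerSeries.coeff
            (expPair j (n + 2 - j)) lazardFGL.toPowerSeries)) = 0 := by
        simp only [← map_zsmul (QuotientAddGroup.mk' lazGen.range.toAddSubgroup)]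
        rw [← map_sum (QuotientAddGroup.mk' lazGen.range.toAddSubgroup)]
        refine (QuotientAddGroup.eq_zero_iff _).mpr ?_
        rw [hgen] at hmem
        exact hmem
      simp only [h2, smul_zero] at hc
      have h3 := (QuotientAddGroup.eq_zero_iff _).mp hc.symm
      rw [show n + 2 - d 0 = d 1 by omega] at h3
      exact h3
  rw [← RingHom.range_eq_top, eq_top_iff]
  rintro y -
  obtain ⟨q, rfl⟩ := Ideal.Quotient.mk_surjective (I := lazardIdeal) y
  induction q using MvPolynomial.induction_on with
  | C a => exact intCast_mem _ a
  | add p q hp hq => exact add_mem hp hq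
  | mul_X p i hp =>
    rw [map_mul]
    refine mul_mem hp ?_
    have h1 := key _ (expPair (i.1 + 1) (i.2 + 1)) rfl
    have h2 : MvPowerSeries.coeff (expPair (i.1 + 1) (i.2 + 1)) lazardFGL.toPowerSeries =
        Ideal.Quotient.mk lazardIdeal (MvPolynomial.X i) := by
      change MvPowerSeries.coeff _ (genericSeries.map lazardMk) = _
      rw [MvPowerSeries.coeff_map, coeff_genericSeries]
      simp; rfl
    rw [h2] at h1
    exact h1

/-! ### Formal group laws given by an exponential series, and injectivity of `lazGen` -/

section Exponential

variable {R : Type} [CommRing R]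

theorem constantCoeff_psubst {σ : Type} {a : MvPowerSeries σ R}
    (ha : MvPowerSeries.constantCoeff a = 0) {f : PowerSeries R}
    (hf : PowerSeries.constantCoeff f = 0) :
    MvPowerSeries.constantCoeff (f.subst a) = 0 :=
  PowerSeries.constantCoeff_subst_eq_zero ha _ hf

theorem hasSubst_vec {σ : Type} {f g : MvPowerSeries σ R} (hf : MvPowerSeries.constantCoeff f = 0)
    (hg : MvPowerSeries.constantCoeff g = 0) : MvPowerSeries.HasSubst ![f, g] :=
  MvPowerSeries.hasSubst_of_constantCoeff_zero fun i => by fin_cases i <;> assumption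

variable (E L : PowerSeries R)

/-- The series `E(L(u) + L(v))`. -/
def conjAdd : MvPowerSeries (Fin 2) R :=
  E.subst (L.subst (MvPowerSeries.X 0 : MvPowerSeries (Fin 2) R) + L.subst (MvPowerSeries.X 1))

variable {E L}

theorem conjAdd_subst (hL : PowerSeries.constantCoeff L = 0) {σ : Type} {f g : MvPowerSeries σ R}
    (hf : MvPowerSeries.constantCoeff f = 0) (hg : MvPowerSeries.constantCoeff g = 0) :
    (conjAdd E L).subst ![f, g] = E.subst (L.subst f + L.subst g) := by
  have hs := hasSubst_vec hf hg
  have h0 : ∀ s : Fin 2, MvPowerSeries.constantCoeff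
      (L.subst (MvPowerSeries.X s : MvPowerSeries (Fin 2) R)) = 0 := fun s =>
    constantCoeff_psubst (by simp) hL
  have h1 : PowerSeries.HasSubst (L.subst (MvPowerSeries.X 0 : MvPowerSeries (Fin 2) R) +
      L.subst (MvPowerSeries.X 1)) :=
    PowerSeries.HasSubst.of_constantCoeff_zero (by rw [map_add, h0, h0, add_zero])
  rw [conjAdd, PowerSeries.subst, MvPowerSeries.subst_comp_subst_apply h1.const hs,
    PowerSeries.subst]
  congr 1; ext1 _
  rw [MvPowerSeries.subst_add hs, PowerSeries.subst, PowerSeries.subst,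
    MvPowerSeries.subst_comp_subst_apply (PowerSeries.HasSubst.X (0 : Fin 2)).const hs,
    MvPowerSeries.subst_comp_subst_apply (PowerSeries.HasSubst.X (1 : Fin 2)).const hs,
    MvPowerSeries.subst_X hs, MvPowerSeries.subst_X hs]
  rfl

theorem subst_subst_cancel (hE : PowerSeries.constantCoeff E = 0) (hLE : L.subst E = PowerSeries.X)
    {σ : Type} {f : MvPowerSeries σ R} (hf : MvPowerSeries.constantCoeff f = 0) :
    L.subst (E.subst f) = f := by
  rw [← PowerSeries.subst_comp_subst_apply (PowerSeries.HasSubst.of_constantCoeff_zero' hE)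
    (PowerSeries.HasSubst.of_constantCoeff_zero hf), hLE,
    PowerSeries.subst_X (PowerSeries.HasSubst.of_constantCoeff_zero hf)]

theorem constantCoeff_conjAdd (hE : PowerSeries.constantCoeff E = 0)
    (hL : PowerSeries.constantCoeff L = 0) : MvPowerSeries.constantCoeff (conjAdd E L) = 0 :=
  constantCoeff_psubst (by
    rw [map_add, constantCoeff_psubst (by simp) hL, constantCoeff_psubst (by simp) hL, add_zero]) hE

variable (hE : PowerSeries.constantCoeff E = 0) (hL : PowerSeries.constantCoeff L = 0)
  (hLE : L.subst E = PowerSeries.X) (hEL : E.subst L = PowerSeries.X)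

theorem psubst_zero {σ : Type} (hL : PowerSeries.constantCoeff L = 0) :
    L.subst (0 : MvPowerSeries σ R) = 0 :=
  MvPowerSeries.subst_zero_of_constantCoeff_zero hL

/-- The formal group law with logarithm `L` and exponential `E`. -/
def conjFGL : FormalGroup R where
  toPowerSeries := conjAdd E L
  zero_constantCoeff := constantCoeff_conjAdd hE hL
  lin_coeff_X := by
    have h := coeff_subst_X_zero (conjAdd E L) 1
    rw [conjAdd_subst hL PowerSeries.constantCoeff_X (map_zero _), psubst_zero hL, add_zero,
      subst_subst_cancel hL hEL PowerSeries.constantCoeff_X, PowerSeries.coeff_one_X] at h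
    rw [h]; simp [expPair]
  lin_coeff_Y := by
    have h := coeff_subst_zero_X (conjAdd E L) 1
    rw [conjAdd_subst hL (map_zero _) PowerSeries.constantCoeff_X, psubst_zero hL, zero_add,
      subst_subst_cancel hL hEL PowerSeries.constantCoeff_X, PowerSeries.coeff_one_X] at h
    rw [h]; simp [expPair]
  assoc := by
    have hX : ∀ s : Fin 3, MvPowerSeries.constantCoeff
      (MvPowerSeries.X s : MvPowerSeries (Fin 3) R) = 0 := by simp
    have hF : ∀ s t : Fin 3, MvPowerSeries.constantCoeff ((conjAdd E L).subst
      ![(MvPowerSeries.X s : MvPowerSeries (Fin 3) R), MvPowerSeries.X t]) = 0 := fun s t =>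
      MvPowerSeries.constantCoeff_subst_eq_zero .X_X
        (fun i => by fin_cases i <;> simp) (constantCoeff_conjAdd hE hL)
    have hs : ∀ s t : Fin 3, MvPowerSeries.constantCoeff
        (L.subst (MvPowerSeries.X s : MvPowerSeries (Fin 3) R) + L.subst (MvPowerSeries.X t)) =
          0 := fun s t => by
      rw [map_add, constantCoeff_psubst (hX s) hL, constantCoeff_psubst (hX t) hL, add_zero]
    rw [conjAdd_subst hL (hF 0 1) (hX 2), conjAdd_subst hL (hX 0) (hF 1 2),
      conjAdd_subst hL (hX 0) (hX 1), conjAdd_subst hL (hX 1) (hX 2),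
      subst_subst_cancel hE hLE (hs 0 1), subst_subst_cancel hE hLE (hs 1 2), add_assoc]

theorem conjFGL_isComm : (conjFGL hE hL hLE hEL).IsComm where
  comm := by
    change conjAdd E L = (conjAdd E L).subst ![MvPowerSeries.X 1, MvPowerSeries.X 0]
    rw [conjAdd_subst hL (by simp) (by simp), add_comm]
    rfl

theorem coeff_subst_X_zero_mul_subst_X_one (f g : PowerSeries R) (i j : ℕ) :
    MvPowerSeries.coeff (expPair i j) (f.subst (MvPowerSeries.X 0 : MvPowerSeries (Fin 2) R) *
      g.subst (MvPowerSeries.X 1)) = PowerSeries.coeff i f * PowerSeries.coeff j g := by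
  classical
  rw [MvPowerSeries.coeff_mul, Finset.sum_eq_single (single 0 i, single 1 j)]
  · rw [PowerSeries.coeff_subst_single, PowerSeries.coeff_subst_single]
    simp
  · intro b hb hb'
    rw [PowerSeries.coeff_subst_single, PowerSeries.coeff_subst_single]
    by_contra hne
    have h0 : b.1 = single 0 (b.1 0) := by by_contra h; simp [h] at hne
    have h1 : b.2 = single 1 (b.2 1) := by by_contra h; simp [h] at hne
    rw [Finset.HasAntidiagonal.mem_antidiagonal, h0, h1] at hb
    have e0 := DFunLike.congr_fun hb 0
    have e1 := DFunLike.congr_fun hb 1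
    simp at e0 e1
    exact hb' (Prod.ext (h0.trans (by rw [e0])) (h1.trans (by rw [e1])))
  · intro h
    refine absurd ?_ h
    rw [Finset.HasAntidiagonal.mem_antidiagonal, expPair]

/-- The coefficients of the formal group law with exponential `E` are, up to terms involving only
earlier coefficients of `E`, multiples of the coefficients of `E`. -/
theorem coeff_conjAdd_sub_mem (hE : PowerSeries.constantCoeff E = 0)
    (hE1 : PowerSeries.coeff 1 E = 1) (hL : PowerSeries.constantCoeff L = 0)
    (hLE : L.subst E = PowerSeries.X) {B : Subring R} {i j : ℕ} (hi : 0 < i) (hj : 0 < j)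
    (hBE : ∀ k < i + j, PowerSeries.coeff k E ∈ B)
    (hB : ∀ p q, 0 < p → 0 < q → p + q < i + j →
      MvPowerSeries.coeff (expPair p q) (conjAdd E L) ∈ B) :
    MvPowerSeries.coeff (expPair i j) (conjAdd E L) -
      ((i + j).choose i : R) * PowerSeries.coeff (i + j) E ∈ B := by
  classical
  set E0 := E.subst (MvPowerSeries.X 0 : MvPowerSeries (Fin 2) R) with hE0
  set E1 := E.subst (MvPowerSeries.X 1 : MvPowerSeries (Fin 2) R) with hE1'
  have c0 : MvPowerSeries.constantCoeff E0 = 0 := constantCoeff_psubst (by simp) hE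
  have c1 : MvPowerSeries.constantCoeff E1 = 0 := constantCoeff_psubst (by simp) hE
  -- The identity F(E(u), E(v)) = E(u + v) for F = E(L(u) + L(v)). On the right the coefficient of
  -- u^i v^j is C(i+j, i) times a coefficient of E.
  have hsum : (conjAdd E L).subst ![E0, E1] =
      E.subst (MvPowerSeries.X 0 + MvPowerSeries.X 1 : MvPowerSeries (Fin 2) R) := by
    rw [conjAdd_subst hL c0 c1, hE0, hE1', subst_subst_cancel hE hLE (by simp),
      subst_subst_cancel hE hLE (by simp)]
  have hcoef := congrArg (MvPowerSeries.coeff (expPair i j)) hsum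
  have hs := hasSubst_vec c0 c1
  have hfin := MvPowerSeries.coeff_subst_finite hs (conjAdd E L) (expPair i j)
  rw [PowerSeries.coeff_subst_X_zero_add_X_one, MvPowerSeries.coeff_subst hs] at hcoef
  simp only [expPair_zero, expPair_one] at hcoef
  have hp : ∀ d : Fin 2 →₀ ℕ, MvPowerSeries.coeff (expPair i j)
      (d.prod fun s e => (![E0, E1] s) ^ e) =
        PowerSeries.coeff i (E ^ d 0) * PowerSeries.coeff j (E ^ d 1) := fun d => by
    rw [Finsupp.prod_fintype _ _ (fun i => pow_zero _), Fin.prod_univ_two,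
      ← coeff_subst_X_zero_mul_subst_X_one, PowerSeries.subst_pow (PowerSeries.HasSubst.X _),
      PowerSeries.subst_pow (PowerSeries.HasSubst.X _)]
    rfl
  have hEX : PowerSeries.X ∣ E := PowerSeries.X_dvd_iff.mpr hE
  have hlow : ∀ m k, k < m → PowerSeries.coeff k (E ^ m) = 0 := fun m k hk =>
    PowerSeries.X_pow_dvd_iff.mp (pow_dvd_pow_of_dvd hEX m) k hk
  have hdiag : ∀ m, PowerSeries.coeff m (E ^ m) = 1 := by
    obtain ⟨H, hH⟩ := hEX
    have hH1 : PowerSeries.constantCoeff H = 1 := by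
      rw [← hE1, hH, ← zero_add 1, PowerSeries.coeff_succ_X_mul,
        PowerSeries.coeff_zero_eq_constantCoeff_apply]
    intro m
    rw [hH, mul_pow, PowerSeries.coeff_X_pow_mul', if_pos le_rfl, Nat.sub_self,
      PowerSeries.coeff_zero_eq_constantCoeff_apply, map_pow, hH1, one_pow]
  have hEB : ∀ m k, k < i + j → PowerSeries.coeff k (E ^ m) ∈ B := by
    intro m k hk
    have h1 : E ∈ coeffSubring (σ := Unit) B (i + j) := by
      intro d hd
      have h2 : d = single () (d ()) := by ext; simp
      rw [h2] at hd ⊢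
      rw [Finsupp.degree_single] at hd
      exact hBE _ hd
    exact Subring.pow_mem _ h1 m (single () k) (by rwa [Finsupp.degree_single])
  -- Since E^m begins with T^m, only exponents d ≤ (i, j) occur on the left. The exponent (i, j)
  -- itself has factor 1, and the others involve only earlier coefficients.
  have hterm : ∀ d : Fin 2 →₀ ℕ, d ≠ expPair i j → MvPowerSeries.coeff d (conjAdd E L) •
      MvPowerSeries.coeff (expPair i j) (d.prod fun s e => (![E0, E1] s) ^ e) ∈ B := by
    intro d hd
    rw [hp, smul_eq_mul]
    rcases Nat.eq_zero_or_pos (d 0) with h0 | h0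
    · rw [h0, pow_zero, PowerSeries.coeff_one, if_neg (by omega), zero_mul, mul_zero]
      exact B.zero_mem
    rcases Nat.eq_zero_or_pos (d 1) with h1 | h1
    · rw [h1, pow_zero, PowerSeries.coeff_one, if_neg (by omega), mul_zero, mul_zero]
      exact B.zero_mem
    rcases lt_or_ge i (d 0) with h2 | h2
    · rw [hlow _ _ h2, zero_mul, mul_zero]; exact B.zero_mem
    rcases lt_or_ge j (d 1) with h3 | h3
    · rw [hlow _ _ h3, mul_zero, mul_zero]; exact B.zero_mem
    refine B.mul_mem ?_ (B.mul_mem (hEB _ _ (by omega)) (hEB _ _ (by omega)))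
    rw [eq_expPair d]
    refine hB _ _ h0 h1 ?_
    by_contra hlt
    exact hd (by rw [eq_expPair d, show d 0 = i by omega, show d 1 = j by omega])
  rw [finsum_eq_sum_of_support_subset (s := insert (expPair i j) hfin.toFinset) _ (by
    intro x hx; simp only [Finset.coe_insert]; exact Or.inr (by simpa using hx)),
    ← Finset.add_sum_erase _ _ (Finset.mem_insert_self _ _), hp, expPair_zero, expPair_one,
    hdiag, hdiag, mul_one, smul_eq_mul, mul_one] at hcoef
  rw [← hcoef, sub_add_cancel_left]
  exact B.neg_mem (B.sum_mem fun d hd => hterm d (Finset.ne_of_mem_erase hd))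

end Exponential

/-- The generic exponential series `T + e_0 T ^ 2 + e_1 T ^ 3 + ⋯`. -/
def genExp : PowerSeries (MvPolynomial ℕ ℚ) :=
  PowerSeries.mk fun | 0 => 0 | 1 => 1 | n + 2 => MvPolynomial.X n

theorem constantCoeff_genExp : PowerSeries.constantCoeff genExp = 0 := by
  rw [← PowerSeries.coeff_zero_eq_constantCoeff_apply, genExp, PowerSeries.coeff_mk]

theorem coeff_one_genExp : PowerSeries.coeff 1 genExp = 1 := by
  rw [genExp, PowerSeries.coeff_mk]

theorem coeff_genExp (n : ℕ) : PowerSeries.coeff (n + 2) genExp = MvPolynomial.X n := by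
  rw [genExp, PowerSeries.coeff_mk]

/-- The logarithm series inverse to `genExp`. -/
def genLog : PowerSeries (MvPolynomial ℕ ℚ) :=
  genExp.substInvOfIsUnit (by rw [coeff_one_genExp]; exact isUnit_one)

/-- The formal group law with exponential `genExp`. -/
abbrev genFGL : FormalGroup (MvPolynomial ℕ ℚ) :=
  conjFGL (E := genExp) (L := genLog) constantCoeff_genExp
    (PowerSeries.constantCoeff_substInvOfIsUnit _ _)
    (PowerSeries.subst_substInvOfIsUnit_left _ constantCoeff_genExp _)
    (PowerSeries.subst_substInvOfIsUnit_right _ constantCoeff_genExp _)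

instance : genFGL.IsComm := conjFGL_isComm _ _ _ _

/-- `X N` is the coefficient of the exponential in degree N + 2. By strong induction the
coefficients of the group law in lower degrees are polynomials in the earlier variables, so
`coeff_conjAdd_sub_mem` applies with these as subring. -/
theorem coeff_genFGL_sub_mem (N : ℕ) : ∀ i j, 0 < i → 0 < j → i + j = N + 2 →
    MvPowerSeries.coeff (expPair i j) genFGL.toPowerSeries -
      ((i + j).choose i : MvPolynomial ℕ ℚ) * MvPolynomial.X N ∈
        MvPolynomial.supported ℚ {k | k < N} := by
  induction N using Nat.strong_induction_on with
  | _ N ih =>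
    intro i j hi hj hN
    have := coeff_conjAdd_sub_mem (B := (MvPolynomial.supported ℚ {k | k < N}).toSubring)
      constantCoeff_genExp coeff_one_genExp (PowerSeries.constantCoeff_substInvOfIsUnit _ _)
      (PowerSeries.subst_substInvOfIsUnit_left _ constantCoeff_genExp
        (by rw [coeff_one_genExp]; exact isUnit_one)) hi hj ?_ ?_
    · rw [hN, coeff_genExp] at this
      rw [hN]
      exact this
    · intro k hk
      match k with
      | 0 =>
        rw [PowerSeries.coeff_zero_eq_constantCoeff_apply, constantCoeff_genExp]
        exact zero_mem _
      | 1 => rw [coeff_one_genExp]; exact one_mem _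
      | k + 2 =>
        rw [coeff_genExp]
        exact MvPolynomial.X_mem_supported.mpr (show k < N by omega)
    · intro p q hp hq hpq
      have h1 := ih (p + q - 2) (by omega) p q hp hq (by omega)
      have h2 : (MvPolynomial.X (p + q - 2) : MvPolynomial ℕ ℚ) ∈
          MvPolynomial.supported ℚ {k | k < N} :=
        MvPolynomial.X_mem_supported.mpr (show p + q - 2 < N by omega)
      have h3 := add_mem (MvPolynomial.supported_mono (R := ℚ)
        (fun k (hk : k < p + q - 2) => show k < N by omega) h1)
        (mul_mem (natCast_mem _ ((p + q).choose p)) h2)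
      rwa [sub_add_cancel] at h3

/-- A polynomial map that is triangular with nonzero diagonal coefficients is injective. -/
theorem injective_of_triangular (ψ : MvPolynomial ℕ ℤ →+* MvPolynomial ℕ ℚ) {c : ℕ → ℚ}
    (hc : ∀ n, c n ≠ 0) (h : ∀ n, ψ (MvPolynomial.X n) - MvPolynomial.C (c n) * MvPolynomial.X n ∈
      MvPolynomial.supported ℚ {k | k < n}) : Function.Injective ψ := by
  set P : ℕ → MvPolynomial ℕ ℚ := fun n =>
    ψ (MvPolynomial.X n) - MvPolynomial.C (c n) * MvPolynomial.X n with hP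
  -- The triangular system ρ(ψ(X n)) = X n is solved for ρ(X n) = `r n` one n at a time; the value 0
  -- for k ≥ n is harmless because `P n` does not involve those variables.
  obtain ⟨r, hr, -⟩ := existsUnique_forall_eq_of_wellFounded (wellFounded_lt (α := ℕ))
    (C := fun _ => MvPolynomial ℕ ℚ) fun n r => MvPolynomial.C (c n)⁻¹ *
      (MvPolynomial.X n - MvPolynomial.aeval (fun k => if h : k < n then r k h else 0) (P n))
  set ρ : MvPolynomial ℕ ℚ →ₐ[ℚ] MvPolynomial ℕ ℚ := MvPolynomial.aeval r with hρ
  have hX : ∀ n, ρ (ψ (MvPolynomial.X n)) = MvPolynomial.X n := by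
    intro n
    have h1 : ψ (MvPolynomial.X n) = MvPolynomial.C (c n) * MvPolynomial.X n + P n := by
      rw [hP]; ring
    have h2 : MvPolynomial.aeval (fun k => if k < n then r k else 0) (P n) = ρ (P n) := by
      refine MvPolynomial.eval₂Hom_congr' rfl (fun i hi _ => ?_) rfl
      have := (MvPolynomial.mem_supported.mp (h n)) hi
      exact if_pos this
    have h3 := hr n
    simp only [dite_eq_ite] at h3
    rw [h2] at h3
    rw [h1, map_add, map_mul, hρ, MvPolynomial.aeval_X, MvPolynomial.algHom_C, ← hρ, h3,
      MvPolynomial.algebraMap_eq, ← mul_assoc, ← map_mul, mul_inv_cancel₀ (hc n), map_one, one_mul,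
      sub_add_cancel]
  have hcomp : (ρ : MvPolynomial ℕ ℚ →+* MvPolynomial ℕ ℚ).comp ψ =
      MvPolynomial.map (Int.castRingHom ℚ) := by
    refine MvPolynomial.ringHom_ext (fun a => ?_) (fun n => ?_)
    · simp
    · simpa using hX n
  have hinj : Function.Injective ((ρ : MvPolynomial ℕ ℚ →+* MvPolynomial ℕ ℚ).comp ψ) := by
    rw [hcomp]; exact MvPolynomial.map_injective _ (RingHom.injective_int _)
  exact Function.Injective.of_comp (f := ρ) hinj

/-- Under the map to ℚ[e_0, e_1, …] classifying the law with generic exponential, the n-th generator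
goes to `bezGcd (n + 2)` times e_n plus a polynomial in earlier variables: the Bezout combination
turns the binomial coefficients into their gcd. -/
theorem lazGen_injective : Function.Injective lazGen := by
  obtain ⟨θ, hθ⟩ := exists_lazard_hom genFGL
  suffices h : Function.Injective (θ.comp lazGen) from Function.Injective.of_comp (f := θ) h
  refine injective_of_triangular (c := fun n => (bezGcd (n + 2) : ℚ)) _
    (fun n => by exact_mod_cast bezGcd_ne_zero (by omega)) fun n => ?_
  have h1 : θ.comp lazGen (MvPolynomial.X n) = ∑ j ∈ Finset.Ioo 0 (n + 2), bez (n + 2) j •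
      MvPowerSeries.coeff (expPair j (n + 2 - j)) genFGL.toPowerSeries := by
    rw [RingHom.comp_apply, lazGen_X, map_sum]
    refine Finset.sum_congr rfl fun j _ => ?_
    rw [map_zsmul, lazA, hθ]
  have h2 : (MvPolynomial.C (bezGcd (n + 2) : ℚ) * MvPolynomial.X n : MvPolynomial ℕ ℚ) =
      ∑ j ∈ Finset.Ioo 0 (n + 2), bez (n + 2) j •
        (((n + 2).choose j : MvPolynomial ℕ ℚ) * MvPolynomial.X n) := by
    rw [← sum_bez]
    push_cast
    rw [map_sum, Finset.sum_mul]
    refine Finset.sum_congr rfl fun j _ => ?_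
    rw [zsmul_eq_mul, ← mul_assoc]
    congr 1
    rw [map_mul]; simp
  rw [h1, h2, ← Finset.sum_sub_distrib]
  refine sum_mem fun j hj => ?_
  rw [← smul_sub]
  have hj' := Finset.mem_Ioo.mp hj
  have := coeff_genFGL_sub_mem n j (n + 2 - j) hj'.1 (by omega) (by omega)
  rw [show j + (n + 2 - j) = n + 2 by omega] at this
  exact zsmul_mem this _

/-- Lazard's theorem: the Lazard ring is a polynomial ring over `ℤ`. -/
def lazardEquiv : MvPolynomial ℕ ℤ ≃+* Lazard :=
  RingEquiv.ofBijective lazGen ⟨lazGen_injective, lazGen_surjective⟩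

instance : IsDomain Lazard := MulEquiv.isDomain (MvPolynomial ℕ ℤ) lazardEquiv.symm.toMulEquiv

instance : CharZero Lazard :=
  charZero_of_injective_ringHom (f := (lazardEquiv : MvPolynomial ℕ ℤ →+* Lazard))
    lazardEquiv.injective

theorem prime_two_lazard : Prime (2 : Lazard) := by
  have h : Prime (MvPolynomial.C 2 : MvPolynomial ℕ ℤ) :=
    (MvPolynomial.prime_C_iff ℕ).mpr Int.prime_two
  have h1 := (MulEquiv.prime_iff lazardEquiv.toMulEquiv).mpr h
  have h2 : lazardEquiv.toMulEquiv (MvPolynomial.C 2) = 2 := by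
    change lazardEquiv (MvPolynomial.C 2) = 2
    rw [map_ofNat MvPolynomial.C 2, map_ofNat]
  rwa [h2] at h1

/-- The multiplicative law u + v + uv over 𝔽_2 has a_{1,1} = 1. -/
theorem not_two_dvd_lazA : ¬ (2 : Lazard) ∣ lazA 1 1 := by
  rintro ⟨y, hy⟩
  obtain ⟨θ, hθ⟩ := exists_lazard_hom (FormalGroup.𝔾ₘ (R := ZMod 2))
  have h1 := congrArg θ hy
  rw [lazA, hθ, map_mul, map_ofNat, show (2 : ZMod 2) = 0 from rfl, zero_mul] at h1
  have h2 : MvPowerSeries.coeff (expPair 1 1) (FormalGroup.𝔾ₘ (R := ZMod 2)).toPowerSeries = 1 := by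
    classical
    have n0 : expPair 1 1 ≠ single 0 1 := fun h => by
      have := DFunLike.congr_fun h 1; simp at this
    have n1 : expPair 1 1 ≠ single 1 1 := fun h => by
      have := DFunLike.congr_fun h 0; simp at this
    rw [FormalGroup.𝔾ₘ_toPowerSeries, map_add, map_add, MvPowerSeries.coeff_X,
      MvPowerSeries.coeff_X, if_neg n0, if_neg n1, MvPowerSeries.X, MvPowerSeries.X,
      MvPowerSeries.monomial_mul_monomial, mul_one, ← expPair, MvPowerSeries.coeff_monomial_same,
      zero_add, zero_add]
  rw [h2] at h1
  exact one_ne_zero h1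

open MvPowerSeries (constantCoeff coeff X HasSubst rename killCompl)

/-! ### Algebra homomorphisms given by selecting coefficients -/

/-- A homomorphism each of whose coefficients is a coefficient of the same degree of its argument,
or zero. -/
def IsCoeffMap {σ τ : Type} (h : MvPowerSeries σ Lazard →ₐ[Lazard] MvPowerSeries τ Lazard) : Prop :=
  ∀ e, (∃ e', e'.degree = e.degree ∧ ∀ g, coeff e (h g) = coeff e' g) ∨ ∀ g, coeff e (h g) = 0

section CoeffMap

variable {σ τ υ : Type} {h : MvPowerSeries σ Lazard →ₐ[Lazard] MvPowerSeries τ Lazard}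

theorem degree_embDomain (e : σ ↪ τ) (d : σ →₀ ℕ) : (Finsupp.embDomain e d).degree = d.degree := by
  rw [Finsupp.degree_apply, Finsupp.degree_apply, Finsupp.support_embDomain, Finset.sum_map]
  exact Finset.sum_congr rfl fun i _ => Finsupp.embDomain_apply_self e d i

theorem isCoeffMap_rename (e : σ ↪ τ) : IsCoeffMap (rename (R := Lazard) e) := by
  intro d
  by_cases hd : d ∈ Set.range (Finsupp.embDomain e)
  · obtain ⟨d', rfl⟩ := hd
    exact Or.inl ⟨d', (degree_embDomain e d').symm, fun g =>
      MvPowerSeries.coeff_embDomain_rename e g d'⟩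
  · refine Or.inr fun g => MvPowerSeries.coeff_rename_eq_zero _ _ ?_
    rintro ⟨d', hd'⟩
    exact hd ⟨d', by rw [Finsupp.embDomain_eq_mapDomain]; exact hd'⟩

theorem isCoeffMap_killCompl (e : τ ↪ σ) : IsCoeffMap (killCompl (R := Lazard) e) := fun d =>
  Or.inl ⟨Finsupp.embDomain e d, degree_embDomain _ _, fun g =>
    MvPowerSeries.coeff_killCompl g d⟩

theorem IsCoeffMap.comp {k : MvPowerSeries τ Lazard →ₐ[Lazard] MvPowerSeries υ Lazard}
    (hk : IsCoeffMap k) (hh : IsCoeffMap h) : IsCoeffMap (k.comp h) := by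
  intro d
  rcases hk d with ⟨d', hd', h1⟩ | h1
  · rcases hh d' with ⟨d'', hd'', h2⟩ | h2
    · exact Or.inl ⟨d'', hd''.trans hd', fun g => (h1 _).trans (h2 g)⟩
    · exact Or.inr fun g => (h1 _).trans (h2 g)
  · exact Or.inr fun g => h1 _

theorem IsCoeffMap.le_order (hh : IsCoeffMap h) (g : MvPowerSeries σ Lazard) :
    g.order ≤ (h g).order := by
  refine MvPowerSeries.le_order fun d hd => ?_
  rcases hh d with ⟨d', hd', h1⟩ | h1
  · rw [h1]
    exact MvPowerSeries.coeff_of_lt_order (by rwa [hd'])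
  · exact h1 g

theorem IsCoeffMap.constantCoeff (hh : IsCoeffMap h) {g : MvPowerSeries σ Lazard}
    (hg : constantCoeff g = 0) : constantCoeff (h g) = 0 := by
  rw [← MvPowerSeries.one_le_order_iff_constCoeff_eq_zero] at hg ⊢
  exact hg.trans (hh.le_order g)

theorem IsCoeffMap.continuous (hh : IsCoeffMap h) : Continuous h := by
  refine continuous_pi fun d => ?_
  rcases hh d with ⟨d', hd', h1⟩ | h1
  · exact (MvPowerSeries.WithPiTopology.continuous_coeff Lazard d').congr fun g => (h1 g).symm
  · exact (continuous_const (y := (0 : Lazard))).congr fun g => (h1 g).symm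

/-- Each coefficient of a substitution is a finite sum, and `h` only selects coefficients, so the
two sides agree coefficient by coefficient. -/
theorem IsCoeffMap.map_subst (hh : IsCoeffMap h) {a : υ → MvPowerSeries σ Lazard} (ha : HasSubst a)
    (ha' : HasSubst fun s => h (a s)) (f : MvPowerSeries υ Lazard) :
    h (f.subst a) = f.subst fun s => h (a s) := by
  ext d
  have hprod : ∀ m : υ →₀ ℕ, (m.prod fun s e => h (a s) ^ e) = h (m.prod fun s e => a s ^ e) := by
    intro m
    rw [map_finsuppProd]
    simp
  rw [MvPowerSeries.coeff_subst ha']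
  rcases hh d with ⟨d', hd', h1⟩ | h1
  · rw [h1, MvPowerSeries.coeff_subst ha]
    refine finsum_congr fun m => ?_
    rw [hprod, h1]
  · rw [h1, finsum_eq_zero_of_forall_eq_zero]
    intro m
    rw [hprod, h1, smul_zero]

theorem IsCoeffMap.map_fadd (hh : IsCoeffMap h) {f g : MvPowerSeries σ Lazard}
    (hf : MvPowerSeries.constantCoeff f = 0) (hg : MvPowerSeries.constantCoeff g = 0) :
    h (fadd f g) = fadd (h f) (h g) := by
  have e : (fun s => h ((![f, g] : Fin 2 → _) s)) = ![h f, h g] := by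
    ext1 s; fin_cases s <;> rfl
  rw [fadd, hh.map_subst (hasSubst_vec hf hg), e, fadd]
  rw [e]
  exact hasSubst_vec (hh.constantCoeff hf) (hh.constantCoeff hg)

theorem IsCoeffMap.map_fneg (hh : IsCoeffMap h) {f : MvPowerSeries σ Lazard}
    (hf : MvPowerSeries.constantCoeff f = 0) : h (fneg f) = fneg (h f) :=
  hh.map_subst (PowerSeries.HasSubst.of_constantCoeff_zero hf).const
    (PowerSeries.HasSubst.of_constantCoeff_zero (hh.constantCoeff hf)).const invSeries

/-- Setting the variables in `s` to zero. -/
def zeroOut (s : Set σ) : MvPowerSeries σ Lazard →ₐ[Lazard] MvPowerSeries σ Lazard :=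
  (rename (Function.Embedding.subtype (· ∉ s))).comp
    (killCompl (Function.Embedding.subtype (· ∉ s)))

theorem isCoeffMap_zeroOut (s : Set σ) : IsCoeffMap (zeroOut s) :=
  (isCoeffMap_rename _).comp (isCoeffMap_killCompl _)

theorem zeroOut_X_of_mem {s : Set σ} {k : σ} (hk : k ∈ s) : zeroOut s (X k) = 0 := by
  rw [zeroOut, AlgHom.comp_apply, MvPowerSeries.killCompl_X_eq_zero, map_zero]
  rintro ⟨⟨k', hk'⟩, rfl⟩
  exact hk' hk

theorem zeroOut_X_of_notMem {s : Set σ} {k : σ} (hk : k ∉ s) : zeroOut s (X k) = X k := by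
  have := MvPowerSeries.killCompl_X (R := Lazard) (e := Function.Embedding.subtype (· ∉ s)) ⟨k, hk⟩
  rw [zeroOut, AlgHom.comp_apply]
  erw [this]
  rw [MvPowerSeries.rename_X]
  rfl

open Classical in
theorem coeff_zeroOut (s : Set σ) (d : σ →₀ ℕ) (f : MvPowerSeries σ Lazard) :
    coeff d (zeroOut s f) = if ∀ k ∈ s, d k = 0 then coeff d f else 0 := by
  rw [zeroOut, AlgHom.comp_apply]
  split_ifs with hd
  · obtain ⟨d', rfl⟩ : d ∈ Set.range (Finsupp.embDomain (Function.Embedding.subtype (· ∉ s))) := by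
      rw [Finsupp.mem_range_embDomain_iff]
      intro k hk
      exact ⟨⟨k, fun hks => (Finsupp.mem_support_iff.mp hk) (hd k hks)⟩, rfl⟩
    rw [MvPowerSeries.coeff_embDomain_rename, MvPowerSeries.coeff_killCompl]
  · refine MvPowerSeries.coeff_rename_eq_zero _ _ ?_
    rintro ⟨d', rfl⟩
    apply hd
    intro k hk
    rw [Finsupp.mapDomain_of_notMem_range]
    rintro ⟨⟨k', hk'⟩, rfl⟩
    exact hk' hk

theorem X_dvd_iff_zeroOut {s : σ} {f : MvPowerSeries σ Lazard} :
    X s ∣ f ↔ zeroOut {s} f = 0 := by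
  classical
  rw [MvPowerSeries.X_dvd_iff, MvPowerSeries.ext_iff]
  simp only [coeff_zeroOut, Set.mem_singleton_iff, forall_eq, map_zero, ite_eq_right_iff]

theorem X_dvd_sub_zeroOut (s : σ) (f : MvPowerSeries σ Lazard) : X s ∣ f - zeroOut {s} f := by
  classical
  rw [MvPowerSeries.X_dvd_iff]
  intro d hd
  rw [map_sub, coeff_zeroOut, if_pos (by simpa using hd), sub_self]

instance : IsDomain (MvPowerSeries σ Lazard) := NoZeroDivisors.to_isDomain _

/-- `X s` generates the kernel of `zeroOut {s}`, a ring endomorphism of a domain. -/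
theorem prime_X (s : σ) : Prime (X s : MvPowerSeries σ Lazard) := by
  refine ⟨fun h => ?_, fun h => ?_, fun f g hfg => ?_⟩
  · classical
    have := congrArg (coeff (single s 1)) h
    rw [MvPowerSeries.coeff_index_single_self_X, map_zero] at this
    exact one_ne_zero this
  · have := h.map (constantCoeff (σ := σ) (R := Lazard))
    rw [MvPowerSeries.constantCoeff_X] at this
    exact not_isUnit_zero this
  · simp only [X_dvd_iff_zeroOut, map_mul, mul_eq_zero] at hfg ⊢
    exact hfg

end CoeffMap

/-! ### Calculus of formal sums -/

section Fadd

variable {σ : Type} {f g k : MvPowerSeries σ Lazard}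

theorem constantCoeff_fadd (hf : constantCoeff f = 0) (hg : constantCoeff g = 0) :
    constantCoeff (fadd f g) = 0 :=
  MvPowerSeries.constantCoeff_subst_eq_zero (hasSubst_vec hf hg)
    (fun i => by fin_cases i <;> assumption) lazardFGL.zero_constantCoeff

theorem constantCoeff_fneg (hf : constantCoeff f = 0) : constantCoeff (fneg f) = 0 :=
  constantCoeff_psubst hf constantCoeff_invSeries

theorem fadd_comm (hf : constantCoeff f = 0) (hg : constantCoeff g = 0) : fadd f g = fadd g f :=
  lazardFGL.comm' (PowerSeries.HasSubst.of_constantCoeff_zero hf)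
    (PowerSeries.HasSubst.of_constantCoeff_zero hg)

theorem fadd_assoc (hf : constantCoeff f = 0) (hg : constantCoeff g = 0)
    (hk : constantCoeff k = 0) : fadd (fadd f g) k = fadd f (fadd g k) :=
  lazardFGL.assoc' (PowerSeries.HasSubst.of_constantCoeff_zero hf)
    (PowerSeries.HasSubst.of_constantCoeff_zero hg) (PowerSeries.HasSubst.of_constantCoeff_zero hk)

theorem fadd_zero (hf : constantCoeff f = 0) : fadd f 0 = f :=
  lazardFGL.add_zero (PowerSeries.HasSubst.of_constantCoeff_zero hf)

theorem zero_fadd (hf : constantCoeff f = 0) : fadd 0 f = f :=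
  lazardFGL.zero_add (PowerSeries.HasSubst.of_constantCoeff_zero hf)

theorem fneg_zero : fneg (0 : MvPowerSeries σ Lazard) = 0 := psubst_zero constantCoeff_invSeries

theorem subst_fadd {τ : Type} {a : σ → MvPowerSeries τ Lazard} (ha : HasSubst a)
    (hf : constantCoeff f = 0) (hg : constantCoeff g = 0) :
    (fadd f g).subst a = fadd (f.subst a) (g.subst a) := by
  rw [fadd, MvPowerSeries.subst_comp_subst_apply (hasSubst_vec hf hg) ha, fadd]
  congr 1; ext1 s; fin_cases s <;> rfl

theorem subst_fneg {τ : Type} {a : σ → MvPowerSeries τ Lazard} (ha : HasSubst a)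
    (hf : constantCoeff f = 0) : (fneg f).subst a = fneg (f.subst a) := by
  rw [fneg, PowerSeries.subst, MvPowerSeries.subst_comp_subst_apply
    (PowerSeries.HasSubst.of_constantCoeff_zero hf).const ha]
  rfl

theorem fadd_fneg (hf : constantCoeff f = 0) : fadd f (fneg f) = 0 := by
  have h := congrArg (PowerSeries.subst f) subst_invSeries
  have hs := (PowerSeries.HasSubst.of_constantCoeff_zero hf)
  rw [PowerSeries.subst_def, MvPowerSeries.subst_comp_subst_apply _ hs.const] at h
  · rw [fadd]
    refine Eq.trans ?_ (h.trans ?_)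
    · congr 1; ext1 s
      fin_cases s
      · exact (PowerSeries.subst_X hs).symm
      · rfl
    · rw [← PowerSeries.coe_substAlgHom hs, map_zero]
  · exact hasSubst_vec (σ := Unit) PowerSeries.constantCoeff_X constantCoeff_invSeries

theorem fneg_fneg (hf : constantCoeff f = 0) : fneg (fneg f) = f := by
  have h1 := constantCoeff_fneg hf
  have h2 := constantCoeff_fneg h1
  rw [← zero_fadd h2, ← fadd_fneg hf, fadd_assoc hf h1 h2, fadd_fneg h1, fadd_zero hf]

end Fadd

/-! ### Division by `X s - a` -/

section Shift

variable {σ : Type} [DecidableEq σ]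

theorem hasSubst_update (s : σ) {a : MvPowerSeries σ Lazard} (ha : constantCoeff a = 0) :
    HasSubst (Function.update (X : σ → MvPowerSeries σ Lazard) s a) where
  const_coeff k := by
    by_cases hk : k = s
    · subst hk; simp [ha]
    · simp [hk]
  coeff_zero d := by
    refine ((HasSubst.X (σ := σ) (S := Lazard)).coeff_zero d |>.insert s).subset fun k hk => ?_
    by_cases hks : k = s
    · exact Or.inl hks
    · right; simpa [hks] using hk

theorem subst_update_zero (s : σ) (f : MvPowerSeries σ Lazard) :
    f.subst (Function.update (X : σ → MvPowerSeries σ Lazard) s 0) = zeroOut {s} f := by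
  have e : (fun k => zeroOut {s} (X k : MvPowerSeries σ Lazard)) =
      Function.update (X : σ → MvPowerSeries σ Lazard) s 0 := by
    ext1 k
    by_cases hk : k = s
    · subst hk; rw [Function.update_self, zeroOut_X_of_mem (Set.mem_singleton k)]
    · rw [Function.update_of_ne hk, zeroOut_X_of_notMem (by simpa using hk)]
  have h := (isCoeffMap_zeroOut {s}).map_subst HasSubst.X
    (by rw [e]; exact hasSubst_update s (map_zero _)) f
  rw [MvPowerSeries.subst_self] at h
  rw [← e]
  exact h.symm

theorem subst_update_subst_update (s : σ) {a b c : MvPowerSeries σ Lazard}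
    (ha : constantCoeff a = 0) (hb : constantCoeff b = 0)
    (hc : a.subst (Function.update (X : σ → MvPowerSeries σ Lazard) s b) = c)
    (f : MvPowerSeries σ Lazard) :
    (f.subst (Function.update X s a)).subst (Function.update X s b) =
      f.subst (Function.update X s c) := by
  rw [MvPowerSeries.subst_comp_subst_apply (hasSubst_update s ha) (hasSubst_update s hb)]
  congr 1; ext1 k
  by_cases hk : k = s
  · subst hk; rw [Function.update_self, Function.update_self, hc]
  · rw [Function.update_of_ne hk, Function.update_of_ne hk,
      MvPowerSeries.subst_X (hasSubst_update s hb), Function.update_of_ne hk]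

/-- A series is free of the variable `X s`: it is invariant under substitution for `X s`. -/
def FreeOf (s : σ) (a : MvPowerSeries σ Lazard) : Prop :=
  constantCoeff a = 0 ∧ ∀ b, constantCoeff b = 0 → a.subst (Function.update X s b) = a

theorem freeOf_X {s j : σ} (h : j ≠ s) : FreeOf s (X j) :=
  ⟨by simp, fun b hb => by rw [MvPowerSeries.subst_X (hasSubst_update s hb),
    Function.update_of_ne h]⟩

theorem FreeOf.fneg {s : σ} {a : MvPowerSeries σ Lazard} (h : FreeOf s a) : FreeOf s (fneg a) :=
  ⟨constantCoeff_fneg h.1, fun b hb => by rw [subst_fneg (hasSubst_update s hb) h.1, h.2 b hb]⟩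

/-- The automorphism `X s ↦ X s + a`. -/
def shiftEquiv {s : σ} {a : MvPowerSeries σ Lazard} (h : FreeOf s a) :
    MvPowerSeries σ Lazard ≃+* MvPowerSeries σ Lazard := by
  have ha : constantCoeff (X s + a) = 0 := by rw [map_add, h.1]; simp
  have ha' : constantCoeff (X s - a) = 0 := by rw [map_sub, h.1]; simp
  refine RingEquiv.ofRingHom
    (MvPowerSeries.substAlgHom (R := Lazard) (hasSubst_update s ha)).toRingHom
    (MvPowerSeries.substAlgHom (R := Lazard) (hasSubst_update s ha')).toRingHom ?_ ?_
  · ext1 f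
    simp only [AlgHom.toRingHom_eq_coe, RingHom.comp_apply, RingHom.coe_coe,
      MvPowerSeries.substAlgHom_apply, RingHom.id_apply]
    rw [subst_update_subst_update s (c := X s) ha' ha]
    · rw [Function.update_eq_self, MvPowerSeries.subst_self]; rfl
    · rw [MvPowerSeries.subst_sub (hasSubst_update s ha), h.2 _ ha,
        MvPowerSeries.subst_X (hasSubst_update s ha), Function.update_self, add_sub_cancel_right]
  · ext1 f
    simp only [AlgHom.toRingHom_eq_coe, RingHom.comp_apply, RingHom.coe_coe,
      MvPowerSeries.substAlgHom_apply, RingHom.id_apply]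
    rw [subst_update_subst_update s (c := X s) ha ha']
    · rw [Function.update_eq_self, MvPowerSeries.subst_self]; rfl
    · rw [MvPowerSeries.subst_add (hasSubst_update s ha'), h.2 _ ha',
        MvPowerSeries.subst_X (hasSubst_update s ha'), Function.update_self, sub_add_cancel]

theorem shiftEquiv_apply {s : σ} {a : MvPowerSeries σ Lazard} (h : FreeOf s a)
    (f : MvPowerSeries σ Lazard) :
    shiftEquiv h f = f.subst (Function.update X s (X s + a)) :=
  MvPowerSeries.substAlgHom_apply (hasSubst_update s (by rw [map_add, h.1]; simp)) _

theorem shiftEquiv_symm_apply {s : σ} {a : MvPowerSeries σ Lazard} (h : FreeOf s a)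
    (f : MvPowerSeries σ Lazard) :
    (shiftEquiv h).symm f = f.subst (Function.update X s (X s - a)) :=
  MvPowerSeries.substAlgHom_apply (hasSubst_update s (by rw [map_sub, h.1]; simp)) _

theorem shiftEquiv_X_sub {s : σ} {a : MvPowerSeries σ Lazard} (h : FreeOf s a) :
    shiftEquiv h (X s - a) = X s := by
  have ha : constantCoeff (X s + a) = 0 := by rw [map_add, h.1]; simp
  rw [shiftEquiv_apply, MvPowerSeries.subst_sub (hasSubst_update s ha), h.2 _ ha,
    MvPowerSeries.subst_X (hasSubst_update s ha), Function.update_self, add_sub_cancel_right]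

/-- The automorphism X s ↦ X s + a carries X s - a to the prime X s. -/
theorem prime_X_sub {s : σ} {a : MvPowerSeries σ Lazard} (h : FreeOf s a) :
    Prime (X s - a) := by
  have := MulEquiv.prime_iff (shiftEquiv h).toMulEquiv (p := X s - a)
  rw [← this]
  change Prime (shiftEquiv h (X s - a))
  rw [shiftEquiv_X_sub]
  exact prime_X s

/-- The factor theorem: `X_dvd_sub_zeroOut` transported by the automorphism X s ↦ X s + a. -/
theorem X_sub_dvd_sub_subst {s : σ} {a : MvPowerSeries σ Lazard} (h : FreeOf s a)
    (f : MvPowerSeries σ Lazard) : X s - a ∣ f - f.subst (Function.update X s a) := by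
  have ha : constantCoeff (X s + a) = 0 := by rw [map_add, h.1]; simp
  have ha' : constantCoeff (X s - a) = 0 := by rw [map_sub, h.1]; simp
  have h1 := map_dvd (shiftEquiv h).symm (X_dvd_sub_zeroOut s (shiftEquiv h f))
  rw [← shiftEquiv_X_sub h, RingEquiv.symm_apply_apply, map_sub, RingEquiv.symm_apply_apply] at h1
  convert h1 using 2
  rw [shiftEquiv_symm_apply, shiftEquiv_apply, ← subst_update_zero,
    subst_update_subst_update s (c := a) ha (map_zero _),
    subst_update_subst_update s (c := a) h.1 ha' (h.2 _ ha')]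
  rw [MvPowerSeries.subst_add (hasSubst_update s (map_zero _)), h.2 _ (map_zero _),
    MvPowerSeries.subst_X (hasSubst_update s (map_zero _)), Function.update_self, zero_add]

end Shift

/-! ### Divisibility of formal sums and differences -/

section Dvd

variable {σ : Type} {f g k : MvPowerSeries σ Lazard}

/-- The factor theorem for three independent variables, specialised to f, g, k. -/
theorem sub_dvd_fadd_sub_fadd (hf : constantCoeff f = 0) (hg : constantCoeff g = 0)
    (hk : constantCoeff k = 0) : g - k ∣ fadd f g - fadd f k := by
  have c : ∀ i : Fin 3, constantCoeff (X i : MvPowerSeries (Fin 3) Lazard) = 0 := by simp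
  have h1 := X_sub_dvd_sub_subst (s := (1 : Fin 3)) (freeOf_X (j := 2) (by decide))
    (fadd (X 0) (X 1) - fadd (X 0) (X 2))
  have hu := hasSubst_update (1 : Fin 3) (c 2)
  rw [MvPowerSeries.subst_sub hu, subst_fadd hu (c 0) (c 1), subst_fadd hu (c 0) (c 2),
    MvPowerSeries.subst_X hu, MvPowerSeries.subst_X hu, MvPowerSeries.subst_X hu,
    Function.update_self, Function.update_of_ne (by decide), Function.update_of_ne (by decide),
    sub_self, sub_zero] at h1
  have hs : HasSubst ![f, g, k] :=
    MvPowerSeries.hasSubst_of_constantCoeff_zero fun i => by fin_cases i <;> assumption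
  have h2 := map_dvd (MvPowerSeries.substAlgHom (R := Lazard) hs) h1
  simp only [MvPowerSeries.substAlgHom_apply] at h2
  rw [MvPowerSeries.subst_sub hs, MvPowerSeries.subst_sub hs, subst_fadd hs (c 0) (c 1),
    subst_fadd hs (c 0) (c 2), MvPowerSeries.subst_X hs, MvPowerSeries.subst_X hs,
    MvPowerSeries.subst_X hs] at h2
  exact h2

/-- The coefficient of the linear monomial `X i`. -/
abbrev lin (i : σ) (f : MvPowerSeries σ Lazard) : Lazard := coeff (single i 1) f

theorem two_le_order_fadd_sub (hf : constantCoeff f = 0) (hg : constantCoeff g = 0) :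
    2 ≤ (fadd f g - (f + g)).order := by
  have hs := hasSubst_vec hf hg
  have e : fadd f g - (f + g) = (lazardFGL.toPowerSeries - (X 0 + X 1)).subst ![f, g] := by
    rw [MvPowerSeries.subst_sub hs, MvPowerSeries.subst_add hs, MvPowerSeries.subst_X hs,
      MvPowerSeries.subst_X hs]
    rfl
  rw [e]
  refine le_trans ?_ (MvPowerSeries.le_order_subst hs _)
  refine le_trans (isAddLike lazardFGL).two_le_order_sub ?_
  refine le_mul_of_one_le_left' (le_iInf fun i => ?_)
  rw [MvPowerSeries.one_le_order_iff_constCoeff_eq_zero]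
  fin_cases i <;> assumption

theorem lin_eq_of_two_le_order {i : σ} (h : 2 ≤ (f - g).order) : lin i f = lin i g := by
  rw [← sub_eq_zero, ← map_sub]
  refine MvPowerSeries.coeff_of_lt_order (lt_of_lt_of_le ?_ h)
  rw [Finsupp.degree_single]
  norm_num

theorem lin_fadd (i : σ) (hf : constantCoeff f = 0) (hg : constantCoeff g = 0) :
    lin i (fadd f g) = lin i f + lin i g := by
  rw [lin_eq_of_two_le_order (two_le_order_fadd_sub hf hg), lin, map_add]

theorem lin_fneg (i : σ) (hf : constantCoeff f = 0) : lin i (fneg f) = -lin i f := by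
  have := lin_fadd i hf (constantCoeff_fneg hf)
  rw [fadd_fneg hf, lin, map_zero] at this
  exact (neg_eq_of_add_eq_zero_right this.symm).symm

theorem lin_mul (i : σ) (hf : constantCoeff f = 0) :
    lin i (f * g) = lin i f * constantCoeff g := by
  have h : 2 ≤ (f * g - f * MvPowerSeries.C (constantCoeff g)).order := by
    rw [← mul_sub, MvPowerSeries.order_mul, show (2 : ℕ∞) = 1 + 1 by norm_num]
    refine add_le_add (MvPowerSeries.one_le_order_iff_constCoeff_eq_zero.mpr hf)
      (MvPowerSeries.one_le_order_iff_constCoeff_eq_zero.mpr ?_)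
    rw [map_sub, MvPowerSeries.constantCoeff_C, sub_self]
  rw [lin_eq_of_two_le_order h, lin, MvPowerSeries.coeff_mul_C]

theorem lin_X [DecidableEq σ] (i j : σ) : lin i (X j) = if i = j then 1 else 0 := by
  rw [lin, MvPowerSeries.coeff_X]
  simp [Finsupp.single_left_inj]

/-- Comparing linear parts is how nondivisibility between the various linear-like factors is shown
below. -/
theorem exists_lin_eq_of_dvd (hf : constantCoeff f = 0) (h : f ∣ g) :
    ∃ c, ∀ i, lin i g = lin i f * c := by
  obtain ⟨k, rfl⟩ := h
  exact ⟨constantCoeff k, fun i => lin_mul i hf⟩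

theorem not_dvd_of_lin {i : σ} (hf : constantCoeff f = 0) (h : lin i f = 0) (h' : lin i g ≠ 0) :
    ¬ f ∣ g := fun hd => by
  obtain ⟨c, hc⟩ := exists_lin_eq_of_dvd hf hd
  exact h' (by rw [hc, h, zero_mul])

/-- A formal difference is the difference up to a unit. -/
theorem exists_fadd_fneg_eq (hf : constantCoeff f = 0) (hg : constantCoeff g = 0) :
    ∃ u, constantCoeff u = 1 ∧ fadd f (fneg g) = (f - g) * u := by
  have c : ∀ i : Fin 2, constantCoeff (X i : MvPowerSeries (Fin 2) Lazard) = 0 := by simp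
  have cn := constantCoeff_fneg (c 1)
  obtain ⟨u, hu⟩ : (X 0 - X 1 : MvPowerSeries (Fin 2) Lazard) ∣ fadd (X 0) (fneg (X 1)) := by
    have h1 := X_sub_dvd_sub_subst (s := (0 : Fin 2)) (freeOf_X (j := 1) (by decide))
      (fadd (X 0) (fneg (X 1)))
    have hu := hasSubst_update (0 : Fin 2) (c 1)
    rw [subst_fadd hu (c 0) cn, subst_fneg hu (c 1),
      MvPowerSeries.subst_X hu, MvPowerSeries.subst_X hu,
      Function.update_self, Function.update_of_ne (by decide), fadd_fneg (c 1), sub_zero] at h1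
    exact h1
  have hc : constantCoeff u = 1 := by
    have h1 := congrArg (lin 0) hu
    have h2 : lin (0 : Fin 2) (X 0 - X 1) = lin (0 : Fin 2) (X 0) - lin (0 : Fin 2) (X 1) :=
      map_sub (coeff (single (0 : Fin 2) 1)) (X 0) (X 1)
    rw [lin_fadd 0 (c 0) cn, lin_fneg 0 (c 1), lin_mul 0 (by rw [map_sub, c, c, sub_zero]), h2,
      lin_X, lin_X] at h1
    simpa using h1.symm
  have hs := hasSubst_vec hf hg
  refine ⟨u.subst ![f, g], ?_, ?_⟩
  · have : constantCoeff ((u - 1).subst ![f, g]) = 0 :=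
      MvPowerSeries.constantCoeff_subst_eq_zero hs (fun i => by fin_cases i <;> assumption)
        (by rw [map_sub, hc, map_one, sub_self])
    rw [MvPowerSeries.subst_sub hs, map_sub, sub_eq_zero] at this
    rw [this, ← MvPowerSeries.coe_substAlgHom hs, map_one, map_one]
  · have h1 := congrArg (MvPowerSeries.subst ![f, g]) hu
    rw [MvPowerSeries.subst_mul hs, MvPowerSeries.subst_sub hs, subst_fadd hs (c 0) cn,
      subst_fneg hs (c 1), MvPowerSeries.subst_X hs, MvPowerSeries.subst_X hs] at h1
    exact h1

theorem isUnit_of_constantCoeff_eq_one (h : constantCoeff f = 1) : IsUnit f :=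
  MvPowerSeries.isUnit_iff_constantCoeff.mpr (by rw [h]; exact isUnit_one)

theorem associated_fadd_fneg (hf : constantCoeff f = 0) (hg : constantCoeff g = 0) :
    Associated (f - g) (fadd f (fneg g)) := by
  obtain ⟨u, hu, h⟩ := exists_fadd_fneg_eq hf hg
  exact ⟨(isUnit_of_constantCoeff_eq_one hu).unit, h.symm⟩

theorem associated_fadd (hf : constantCoeff f = 0) (hg : constantCoeff g = 0) :
    Associated (f - fneg g) (fadd f g) := by
  have := associated_fadd_fneg hf (constantCoeff_fneg hg)
  rwa [fneg_fneg hg] at this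

/-- Modulo `g ⊕ k`, the series `f ⊖ k` and `f ⊕ g` agree. -/
theorem fadd_dvd_fadd_fneg_sub (hf : constantCoeff f = 0) (hg : constantCoeff g = 0)
    (hk : constantCoeff k = 0) : fadd g k ∣ fadd f g - fadd f (fneg k) :=
  (associated_fadd hg hk).symm.dvd.trans (sub_dvd_fadd_sub_fadd hf hg (constantCoeff_fneg hk))

theorem prime_fadd_fneg_X {i j : σ} (h : i ≠ j) :
    Prime (fadd (X i) (fneg (X j)) : MvPowerSeries σ Lazard) := by
  classical
  exact (associated_fadd_fneg (by simp) (by simp)).prime (prime_X_sub (freeOf_X h.symm))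

theorem prime_fadd_X {i j : σ} (h : i ≠ j) :
    Prime (fadd (X i) (X j) : MvPowerSeries σ Lazard) := by
  classical
  exact (associated_fadd (by simp) (by simp)).prime (prime_X_sub (freeOf_X h.symm).fneg)

/-- On linear parts, x_k - x_l would be a(x_i + x_j). The coefficients s, t of x_i + x_j at x_k and
x_l lie in {0, 1, 2} and satisfy sa = 1, ta = -1. Hence s + t = 0 with s ≠ 0, which is impossible in
characteristic zero. The case i = j is included. -/
theorem fadd_X_not_dvd_fadd_fneg_X {i j k l : σ} (hkl : k ≠ l) :
    ¬ (fadd (X i) (X j) : MvPowerSeries σ Lazard) ∣ fadd (X k) (fneg (X l)) := by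
  classical
  intro h
  have c : ∀ i : σ, constantCoeff (X i : MvPowerSeries σ Lazard) = 0 := by simp
  obtain ⟨a, ha⟩ := exists_lin_eq_of_dvd (constantCoeff_fadd (c i) (c j)) h
  have h1 := ha k
  have h2 := ha l
  simp only [lin_fadd _ (c _) (c _), lin_fadd _ (c _) (constantCoeff_fneg (c _)),
    lin_fneg _ (c _), lin_X, hkl, hkl.symm, if_true, if_false] at h1 h2
  have n2 : (2 : Lazard) ≠ 0 := prime_two_lazard.ne_zero
  have key : ∀ s t : Lazard, (s = 0 ∨ s = 1 ∨ s = 2) → (t = 0 ∨ t = 1 ∨ t = 2) →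
      1 + -0 = s * a → 0 + -1 = t * a → False := by
    intro s t hs ht h1 h2
    have e : s + t = 0 ∨ a = 0 := by
      rw [← mul_eq_zero, add_mul, ← h1, ← h2]; ring
    have ha0 : a ≠ 0 := by rintro rfl; simp at h1
    have e := e.resolve_right ha0
    have n3 : (3 : Lazard) ≠ 0 := by exact_mod_cast (by norm_num : (3 : ℕ) ≠ 0)
    have n4 : (4 : Lazard) ≠ 0 := by exact_mod_cast (by norm_num : (4 : ℕ) ≠ 0)
    have n1 : (1 : Lazard) ≠ 0 := one_ne_zero
    rcases hs with rfl | rfl | rfl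
    · simp at h1
    · rcases ht with rfl | rfl | rfl
      · exact n1 (by linear_combination e)
      · exact n2 (by linear_combination e)
      · exact n3 (by linear_combination e)
    · rcases ht with rfl | rfl | rfl
      · exact n2 (by linear_combination e)
      · exact n3 (by linear_combination e)
      · exact n4 (by linear_combination e)
  refine key _ _ ?_ ?_ h1 h2
  · split_ifs <;> norm_num
  · split_ifs <;> norm_num

end Dvd

/-! ### Closedness of principal ideals -/

section Closed

variable {σ : Type}

theorem eq_zero_of_forall_le_order {f : MvPowerSeries σ Lazard} (h : ∀ k : ℕ, (k : ℕ∞) ≤ f.order) :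
    f = 0 := by
  rw [← MvPowerSeries.order_eq_top_iff]
  exact ENat.eq_top_iff_forall_ge.mpr h

theorem le_order_add {n : ℕ∞} {f g : MvPowerSeries σ Lazard} (hf : n ≤ f.order)
    (hg : n ≤ g.order) : n ≤ (f + g).order :=
  (le_min hf hg).trans MvPowerSeries.min_order_le_add

theorem le_order_sub {n : ℕ∞} {f g : MvPowerSeries σ Lazard} (hf : n ≤ f.order)
    (hg : n ≤ g.order) : n ≤ (f - g).order := by
  rw [sub_eq_add_neg]
  exact le_order_add hf (by rwa [MvPowerSeries.order_neg])

/-- A series that is divisible by `p ≠ 0` up to terms of arbitrarily high order is divisible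
by `p`. -/
theorem dvd_of_forall_le_order {p f : MvPowerSeries σ Lazard} (hp : p ≠ 0)
    (h : ∀ k : ℕ, ∃ g, (k : ℕ∞) ≤ (f - p * g).order) : p ∣ f := by
  choose g hg using h
  obtain ⟨o, ho⟩ : ∃ o : ℕ, p.order = o :=
    ⟨_, (MvPowerSeries.ne_zero_iff_order_finite.mp hp).symm⟩
  have hdiff : ∀ (k m : ℕ), k ≤ m → (k : ℕ∞) ≤ o + (g k - g m).order := by
    intro k m hkm
    rw [← ho, ← MvPowerSeries.order_mul,
      show p * (g k - g m) = (f - p * g m) - (f - p * g k) by ring]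
    exact le_order_sub ((Nat.cast_le.mpr hkm).trans (hg m)) (hg k)
  have hcoeff : ∀ (k m : ℕ) (d : σ →₀ ℕ), o + d.degree < k → o + d.degree < m →
      coeff d (g k) = coeff d (g m) := by
    have aux : ∀ (k m : ℕ) (d : σ →₀ ℕ), o + d.degree < k → k ≤ m →
        coeff d (g k) = coeff d (g m) := by
      intro k m d hd hkm
      rw [← sub_eq_zero, ← map_sub]
      refine MvPowerSeries.coeff_of_lt_order ?_
      by_contra hlt
      have h1 : (k : ℕ∞) ≤ o + d.degree := (hdiff k m hkm).trans (by gcongr; exact not_lt.mp hlt)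
      have h2 : k ≤ o + d.degree := by exact_mod_cast h1
      omega
    intro k m d hk hm
    rcases le_total k m with hkm | hkm
    · exact aux k m d hk hkm
    · exact (aux m k d hm hkm).symm
  refine ⟨fun d => coeff d (g (o + d.degree + 1)), ?_⟩
  set G : MvPowerSeries σ Lazard := fun d => coeff d (g (o + d.degree + 1)) with hG
  rw [← sub_eq_zero]
  refine eq_zero_of_forall_le_order fun k => ?_
  have h1 : (k : ℕ∞) ≤ o + (g k - G).order := by
    have h2 : ((k - o : ℕ) : ℕ∞) ≤ (g k - G).order := by
      refine MvPowerSeries.nat_le_order fun d hd => ?_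
      have h3 : coeff d G = coeff d (g (o + d.degree + 1)) := rfl
      rw [map_sub, h3, hcoeff k (o + d.degree + 1) d (by omega) (by omega), sub_self]
    refine le_trans ?_ (add_le_add_right h2 (o : ℕ∞))
    exact_mod_cast (by omega : k ≤ o + (k - o))
  rw [show f - p * G = (f - p * g k) + p * (g k - G) by ring]
  refine le_order_add (hg k) ?_
  rwa [MvPowerSeries.order_mul, ho]

end Closed

/-! ### Coprimality -/

section Coprime

variable {A : Type} [CommRing A]

/-- Multiplication by `b` is injective modulo `a`. -/
def RegularMod (a b : A) : Prop := ∀ g, a ∣ b * g → a ∣ g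

theorem RegularMod.mul {a b c : A} (hb : RegularMod a b) (hc : RegularMod a c) :
    RegularMod a (b * c) := fun g hg => hc g (hb _ (by rwa [← mul_assoc]))

theorem RegularMod.one (a : A) : RegularMod a 1 := fun g hg => by rwa [one_mul] at hg

theorem RegularMod.prod {ι : Type*} {a : A} {s : Finset ι} {b : ι → A}
    (h : ∀ i ∈ s, RegularMod a (b i)) : RegularMod a (∏ i ∈ s, b i) :=
  Finset.prod_induction b (RegularMod a) (fun _ _ => RegularMod.mul) (RegularMod.one a) h

theorem RegularMod.pow {a b : A} (h : RegularMod a b) (n : ℕ) : RegularMod a (b ^ n) := by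
  induction n with
  | zero => rw [pow_zero]; exact RegularMod.one a
  | succ n ih => rw [pow_succ]; exact ih.mul h

theorem RegularMod.of_prime_left {p a : A} (hp : Prime p) (h : ¬ p ∣ a) : RegularMod p a :=
  fun _ hg => (hp.dvd_or_dvd hg).resolve_left h

/-- From pg = ak and p ∤ a follows p ∣ k, and p cancels. Thus `a` itself need not be prime, as is
needed for a = t ⊕ t. -/
theorem RegularMod.of_prime_right [IsDomain A] {p a : A} (hp : Prime p) (h : ¬ p ∣ a) : RegularMod a p := by
  rintro g ⟨k, hk⟩
  obtain ⟨k', rfl⟩ := (hp.dvd_or_dvd (Dvd.intro _ hk)).resolve_left h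
  exact ⟨k', mul_left_cancel₀ hp.ne_zero (by rw [hk]; ring)⟩

theorem RegularMod.of_prime_pow [IsDomain A] {p a : A} (hp : Prime p) (h : ¬ p ∣ a) (n : ℕ) :
    RegularMod (p ^ n) a :=
  fun _ hg => hp.pow_dvd_of_dvd_mul_left n h hg

theorem prod_dvd_of_regularMod {ι : Type*} {a : ι → A} {f : A} (s : Finset ι)
    (hr : ∀ i ∈ s, ∀ j ∈ s, i ≠ j → RegularMod (a i) (a j)) (hd : ∀ i ∈ s, a i ∣ f) :
    ∏ i ∈ s, a i ∣ f := by
  classical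
  induction s using Finset.induction_on with
  | empty => simp
  | insert i s hi ih =>
    obtain ⟨g, hg⟩ := ih
      (fun j hj k hk => hr j (Finset.mem_insert_of_mem hj) k (Finset.mem_insert_of_mem hk))
      (fun j hj => hd j (Finset.mem_insert_of_mem hj))
    have h1 : RegularMod (a i) (∏ j ∈ s, a j) := RegularMod.prod fun j hj =>
      hr i (Finset.mem_insert_self i s) j (Finset.mem_insert_of_mem hj) (by rintro rfl; exact hi hj)
    obtain ⟨k, rfl⟩ := h1 g (hg ▸ hd i (Finset.mem_insert_self i s))
    rw [Finset.prod_insert hi, hg]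
    exact ⟨k, by ring⟩

end Coprime

/-! ### The series `t ⊕ t` -/

section Double

variable {σ : Type}

theorem two_ne_zero_mvPowerSeries : (2 : MvPowerSeries σ Lazard) ≠ 0 := fun h => by
  have := congrArg (constantCoeff (σ := σ) (R := Lazard)) h
  rw [map_ofNat, map_zero] at this
  exact prime_two_lazard.ne_zero this

/-- 2 generates the kernel of the reduction of coefficients modulo 2, and power series over the
domain 𝕃/2 form a domain. -/
theorem prime_two_mvPowerSeries : Prime (2 : MvPowerSeries σ Lazard) := by
  have key : ∀ f : MvPowerSeries σ Lazard, 2 ∣ f ↔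
      MvPowerSeries.map (Ideal.Quotient.mk (Ideal.span {(2 : Lazard)})) f = 0 := by
    intro f
    constructor
    · rintro ⟨g, rfl⟩
      have : Ideal.Quotient.mk (Ideal.span {(2 : Lazard)}) 2 = 0 :=
        Ideal.Quotient.eq_zero_iff_mem.mpr (Ideal.mem_span_singleton_self _)
      rw [map_mul, map_ofNat]
      have h2 : (2 : MvPowerSeries σ (Lazard ⧸ Ideal.span {(2 : Lazard)})) = 0 := by
        rw [← map_ofNat (MvPowerSeries.C (σ := σ) (R := Lazard ⧸ Ideal.span {(2 : Lazard)})) 2,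
          ← map_ofNat (Ideal.Quotient.mk (Ideal.span {(2 : Lazard)})) 2, this, map_zero]
      rw [h2, zero_mul]
    · intro h
      have h1 : ∀ d, ∃ c, coeff d f = 2 * c := fun d => by
        have := congrArg (coeff d) h
        rw [MvPowerSeries.coeff_map, map_zero, Ideal.Quotient.eq_zero_iff_mem,
          Ideal.mem_span_singleton] at this
        exact this
      choose c hc using h1
      let g : MvPowerSeries σ Lazard := fun d => c d
      refine ⟨g, MvPowerSeries.ext fun d => ?_⟩
      rw [hc, ← map_ofNat (MvPowerSeries.C (σ := σ) (R := Lazard)) 2, MvPowerSeries.coeff_C_mul]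
      rfl
  have : (Ideal.span {(2 : Lazard)}).IsPrime :=
    (Ideal.span_singleton_prime prime_two_lazard.ne_zero).mpr prime_two_lazard
  refine ⟨two_ne_zero_mvPowerSeries, fun h => ?_, fun f g hfg => ?_⟩
  · have := h.map (constantCoeff (σ := σ) (R := Lazard))
    rw [map_ofNat] at this
    exact prime_two_lazard.not_isUnit this
  · rw [key, map_mul, mul_eq_zero] at hfg
    rwa [key, key]

theorem coeff_fadd_X_self (i : σ) :
    coeff (single i 2) (fadd (X i) (X i) : MvPowerSeries σ Lazard) = lazA 1 1 := by
  classical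
  have hL := isAddLike lazardFGL
  rw [fadd, MvPowerSeries.coeff_subst (hasSubst_vec (by simp) (by simp)),
    finsum_eq_single _ (expPair 1 1)]
  · rw [Finsupp.prod_fintype _ _ (fun i => pow_zero _), Fin.prod_univ_two]
    simp only [expPair_zero, expPair_one, Matrix.cons_val_zero, Matrix.cons_val_one, pow_one]
    rw [← sq, MvPowerSeries.coeff_X_pow, if_pos rfl, smul_eq_mul, mul_one]
    rfl
  · intro d hd
    rw [Finsupp.prod_fintype _ _ (fun i => pow_zero _), Fin.prod_univ_two]
    simp only [Matrix.cons_val_zero, Matrix.cons_val_one]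
    rw [← pow_add, MvPowerSeries.coeff_X_pow]
    split_ifs with h
    · have h2 : 2 = d 0 + d 1 := by simpa using DFunLike.congr_fun h i
      have h3 : d 0 = 0 ∨ d 1 = 0 := by
        by_contra! hne
        exact hd (by rw [eq_expPair d, show d 0 = 1 by omega, show d 1 = 1 by omega])
      rw [eq_expPair d]
      rcases h3 with h3 | h3
      · rw [h3, hL.right, if_neg (by omega), zero_smul]
      · rw [h3, hL.left, if_neg (by omega), zero_smul]
    · rw [smul_zero]

theorem not_two_dvd_fadd_X_self (i : σ) :
    ¬ (2 : MvPowerSeries σ Lazard) ∣ fadd (X i) (X i) := by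
  rintro ⟨g, hg⟩
  have h := congrArg (coeff (single i 2)) hg
  rw [coeff_fadd_X_self, ← map_ofNat (MvPowerSeries.C (σ := σ) (R := Lazard)) 2,
    MvPowerSeries.coeff_C_mul] at h
  exact not_two_dvd_lazA ⟨_, h⟩

/-- `t ⊕ t = t (2 + ⋯)`. -/
theorem exists_fadd_X_self_eq (i : σ) : ∃ v w : MvPowerSeries σ Lazard,
    fadd (X i) (X i) = X i * v ∧ v = 2 + X i * w := by
  have c : constantCoeff (X i : MvPowerSeries σ Lazard) = 0 := by simp
  obtain ⟨v, hv⟩ : (X () : MvPowerSeries Unit Lazard) ∣ fadd (X ()) (X ()) := by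
    rw [X_dvd_iff_zeroOut, (isCoeffMap_zeroOut _).map_fadd (by simp) (by simp),
      zeroOut_X_of_mem (Set.mem_singleton _), fadd_zero (map_zero _)]
  have hv0 : constantCoeff v = 2 := by
    have h1 := congrArg (lin ()) hv
    rw [lin_fadd _ (by simp) (by simp), lin_mul _ (by simp), lin_X, if_pos rfl, one_mul] at h1
    rw [← h1]; norm_num
  obtain ⟨w, hw⟩ : (X () : MvPowerSeries Unit Lazard) ∣ v - 2 := by
    rw [MvPowerSeries.X_dvd_iff]
    intro d hd
    have : d = 0 := by ext; simpa using hd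
    rw [this, MvPowerSeries.coeff_zero_eq_constantCoeff_apply, map_sub, hv0, map_ofNat, sub_self]
  have hs := (PowerSeries.HasSubst.of_constantCoeff_zero c).const
  refine ⟨v.subst fun _ => X i, w.subst fun _ => X i, ?_, ?_⟩
  · have h1 := congrArg (MvPowerSeries.subst fun _ => (X i : MvPowerSeries σ Lazard)) hv
    rw [MvPowerSeries.subst_mul hs, subst_fadd hs (by simp) (by simp),
      MvPowerSeries.subst_X hs] at h1
    exact h1
  · have h1 := congrArg (MvPowerSeries.subst fun _ => (X i : MvPowerSeries σ Lazard))
      (eq_add_of_sub_eq' hw)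
    rw [MvPowerSeries.subst_add hs, MvPowerSeries.subst_mul hs, MvPowerSeries.subst_X hs,
      ← MvPowerSeries.coe_substAlgHom hs, map_ofNat, MvPowerSeries.coe_substAlgHom] at h1
    exact h1

/-- Write x_i ⊕ x_i = x_i v with v = 2 + x_i w, and φ = x_j ⊕ x_j. The prime x_i does not divide φ
and can be cancelled, so let φ ∣ v r. At x_i = 0 this says φ ∣ 2 r_0, where r_0 is r at x_i = 0; as
2 is a prime not dividing φ, even φ ∣ r_0. So r = φ h + x_i r' with again φ ∣ v r'. Iteration
exhibits g as a multiple of φ up to terms of arbitrarily high order, which suffices by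
`dvd_of_forall_le_order`. -/
theorem regularMod_fadd_X_self {i j : σ} (hij : i ≠ j) :
    RegularMod (fadd (X j) (X j) : MvPowerSeries σ Lazard) (fadd (X i) (X i)) := by
  classical
  intro g hg
  have c : ∀ i : σ, constantCoeff (X i : MvPowerSeries σ Lazard) = 0 := by simp
  obtain ⟨v, w, hv, hw⟩ := exists_fadd_X_self_eq i
  set φ : MvPowerSeries σ Lazard := fadd (X j) (X j) with hφ
  have h2φ : ¬ (2 : MvPowerSeries σ Lazard) ∣ φ := not_two_dvd_fadd_X_self j
  have hφ0 : φ ≠ 0 := fun h => h2φ (h ▸ dvd_zero _)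
  have hXφ : RegularMod φ (X i) := by
    refine RegularMod.of_prime_right (prime_X i) (not_dvd_of_lin (i := j) (c i) ?_ ?_)
    · rw [lin_X, if_neg hij.symm]
    · rw [hφ, lin_fadd _ (c j) (c j), lin_X, if_pos rfl]; norm_num
  rw [hv, mul_assoc] at hg
  have hz : zeroOut {i} φ = φ := by
    rw [hφ, (isCoeffMap_zeroOut _).map_fadd (c j) (c j), zeroOut_X_of_notMem (by simpa using hij.symm)]
  have hzv : zeroOut {i} v = 2 := by
    rw [hw, map_add, map_mul, zeroOut_X_of_mem (Set.mem_singleton i), zero_mul, add_zero, map_ofNat]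
  have step : ∀ r, φ ∣ v * r → ∃ h r', r = φ * h + X i * r' ∧ φ ∣ v * r' := by
    rintro r ⟨s, hs⟩
    have h1 := congrArg (zeroOut {i}) hs
    rw [map_mul, map_mul, hz, hzv] at h1
    obtain ⟨s', hs'⟩ := (prime_two_mvPowerSeries.dvd_or_dvd (Dvd.intro _ h1)).resolve_left h2φ
    have h2 : zeroOut {i} r = φ * s' := by
      refine mul_left_cancel₀ two_ne_zero_mvPowerSeries ?_
      rw [h1, hs']; ring
    obtain ⟨r', hr'⟩ := X_dvd_sub_zeroOut i r
    refine ⟨s', r', by rw [← h2, ← hr']; ring, hXφ _ ⟨s - v * s', ?_⟩⟩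
    rw [show X i * (v * r') = v * (X i * r') by ring, ← hr', h2, mul_sub, hs]; ring
  refine dvd_of_forall_le_order hφ0 fun k => ?_
  have : ∃ h r, g = φ * h + X i ^ k * r ∧ φ ∣ v * r := by
    induction k with
    | zero => exact ⟨0, g, by ring, hXφ _ hg⟩
    | succ k ih =>
      obtain ⟨h, r, e, hr⟩ := ih
      obtain ⟨h', r', e', hr'⟩ := step r hr
      exact ⟨h + X i ^ k * h', r', by rw [e, e']; ring, hr'⟩
  obtain ⟨h, r, e, -⟩ := this
  refine ⟨h, ?_⟩
  rw [e, add_sub_cancel_left, MvPowerSeries.order_mul]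
  exact le_add_right (MvPowerSeries.le_order_pow_of_constantCoeff_eq_zero k (c i))

/-- The series `t ⊕ t` (relevant for `Q`-functions) or `t` (relevant for `P`-functions). -/
def psi (q : Bool) (t : MvPowerSeries σ Lazard) : MvPowerSeries σ Lazard :=
  if q then fadd t t else t

variable {q : Bool}

theorem psi_zero : psi q (0 : MvPowerSeries σ Lazard) = 0 := by
  cases q
  · rfl
  · exact fadd_zero (map_zero _)

theorem IsCoeffMap.map_psi {τ : Type}
    {h : MvPowerSeries σ Lazard →ₐ[Lazard] MvPowerSeries τ Lazard} (hh : IsCoeffMap h)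
    {t : MvPowerSeries σ Lazard} (ht : MvPowerSeries.constantCoeff t = 0) :
    h (psi q t) = psi q (h t) := by
  cases q
  · rfl
  · exact hh.map_fadd ht ht

theorem lin_psi_X [DecidableEq σ] (i j : σ) :
    lin i (psi q (X j)) = if i = j then (if q then 2 else 1) else 0 := by
  cases q
  · exact lin_X i j
  · have : lin i (psi true (X j)) = lin i (X j) + lin i (X j) := lin_fadd i (by simp) (by simp)
    rw [this, lin_X]
    split_ifs <;> simp_all [one_add_one_eq_two]

theorem lin_psi_X_self (i : σ) : lin i (psi q (X i)) ≠ 0 := by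
  classical
  rw [lin_psi_X, if_pos rfl]
  cases q
  · simp
  · simp

theorem psi_X_ne_zero (i : σ) : psi q (X i : MvPowerSeries σ Lazard) ≠ 0 := fun h =>
  lin_psi_X_self (q := q) i (by rw [h, lin, map_zero])

theorem regularMod_psi_X {i j : σ} (hij : i ≠ j) :
    RegularMod (psi q (X j) : MvPowerSeries σ Lazard) (psi q (X i)) := by
  classical
  cases q
  · change RegularMod (X j) (X i)
    refine RegularMod.of_prime_left (prime_X j) (not_dvd_of_lin (i := i) (by simp) ?_ ?_)
    · rw [lin_X, if_neg hij]
    · rw [lin_X, if_pos rfl]; exact one_ne_zero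
  · exact regularMod_fadd_X_self hij

/-- Modulo ψ(x_i) the variable x_i equals its own formal inverse: both are zero for P, and x_i ⊕ x_i
= 0 for Q. -/
theorem psi_X_dvd_fadd_sub {i : σ} {f : MvPowerSeries σ Lazard} (hf : constantCoeff f = 0) :
    psi q (X i) ∣ fadd f (X i) - fadd f (fneg (X i)) := by
  have c : ∀ i : σ, constantCoeff (X i : MvPowerSeries σ Lazard) = 0 := by simp
  cases q
  · refine dvd_trans ?_ (sub_dvd_fadd_sub_fadd hf (c i) (constantCoeff_fneg (c i)))
    change X i ∣ _
    rw [X_dvd_iff_zeroOut, map_sub, (isCoeffMap_zeroOut _).map_fneg (c i),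
      zeroOut_X_of_mem (Set.mem_singleton i), fneg_zero, sub_zero]
  · exact fadd_dvd_fadd_fneg_sub hf (c i) (c i)

end Double

set_option linter.unusedSectionVars false

/-! ### Hall–Littlewood sums without denominators -/

section OffDiag

variable {κ κ' T T' : Type} [DecidableEq κ] [DecidableEq κ'] [CommRing T] [CommRing T']

/-- The product of `f k l` over the pairs of distinct elements of `A`. -/
def offDiagProd (f : κ → κ → T) (A : Finset κ) : T := ∏ p ∈ A.offDiag, f p.1 p.2

/-- The quotient of `offDiagProd f (insert i B)` by `offDiagProd f B`. -/
def crossProd (f : κ → κ → T) (i : κ) (B : Finset κ) : T := ∏ k ∈ B, f k i * f i k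

theorem offDiagProd_insert (f : κ → κ → T) {i : κ} {B : Finset κ} (h : i ∉ B) :
    offDiagProd f (insert i B) = crossProd f i B * offDiagProd f B := by
  rw [offDiagProd, Finset.offDiag_insert h, Finset.prod_union, Finset.prod_union,
    Finset.prod_product, Finset.prod_product_right, Finset.prod_singleton, Finset.prod_singleton,
    crossProd, Finset.prod_mul_distrib, offDiagProd]
  · ring
  · rw [Finset.disjoint_left]
    rintro ⟨a, b⟩ h1 h2
    simp only [Finset.mem_offDiag, Finset.mem_product, Finset.mem_singleton] at h1 h2
    exact h (h2.1 ▸ h1.1)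
  · rw [Finset.disjoint_left]
    rintro ⟨a, b⟩ h1 h2
    simp only [Finset.mem_union, Finset.mem_offDiag, Finset.mem_product,
      Finset.mem_singleton] at h1 h2
    rcases h1 with h1 | h1
    · exact h (h2.2 ▸ h1.2.1)
    · exact h (h2.2 ▸ h1.2)

theorem offDiagProd_map (f : κ → κ → T) (j : κ' ↪ κ) (A : Finset κ') :
    offDiagProd f (A.map j) = offDiagProd (fun k l => f (j k) (j l)) A := by
  have : (A.map j).offDiag = A.offDiag.map (j.prodMap j) := by
    ext ⟨a, b⟩
    simp only [Finset.mem_offDiag, Finset.mem_map, Prod.exists, Function.Embedding.coe_prodMap,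
      Prod.map_apply, Prod.mk.injEq]
    constructor
    · rintro ⟨⟨a, ha, rfl⟩, ⟨b, hb, rfl⟩, hab⟩
      exact ⟨a, b, ⟨ha, hb, fun h => hab (congrArg _ h)⟩, rfl, rfl⟩
    · rintro ⟨a, b, ⟨ha, hb, hab⟩, rfl, rfl⟩
      exact ⟨⟨a, ha, rfl⟩, ⟨b, hb, rfl⟩, fun h => hab (j.injective h)⟩
  rw [offDiagProd, offDiagProd, this, Finset.prod_map]
  rfl

theorem offDiagProd_congr {f g : κ → κ → T} {A : Finset κ}
    (h : ∀ k ∈ A, ∀ l ∈ A, k ≠ l → f k l = g k l) : offDiagProd f A = offDiagProd g A :=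
  Finset.prod_congr rfl fun p hp => by
    obtain ⟨h1, h2, h3⟩ := Finset.mem_offDiag.mp hp
    exact h _ h1 _ h2 h3

theorem map_offDiagProd (φ : T →+* T') (f : κ → κ → T) (A : Finset κ) :
    φ (offDiagProd f A) = offDiagProd (fun k l => φ (f k l)) A := map_prod _ _ _

end OffDiag

section HLSum

variable {κ κ' T T' : Type} [Fintype κ] [DecidableEq κ] [Fintype κ'] [DecidableEq κ'] [CommRing T]
  [CommRing T'] {r : ℕ}

/-- The factor for the pair `(k, l)` in the summand with `x_{e 1}, …, x_{e r}` in the places of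
`x_1, …, x_r`. -/
def hlFactor (pl mi : κ → κ → T) (e : Fin r ↪ κ) (k l : κ) : T :=
  if ∃ i, e i = k ∧ ∀ j, e j = l → i < j then pl k l else mi k l

/-- The Hall–Littlewood sum in the variables with index in `A`, multiplied by the product of
all `x_k ⊖ x_l`. -/
def hlSum (pl mi : κ → κ → T) (M : Fin r → κ → T) (A : Finset κ) : T :=
  ∑ e : Fin r ↪ κ with ∀ i, e i ∈ A, (∏ i, M i (e i)) * offDiagProd (hlFactor pl mi e) A

theorem hlFactor_of_notMem_left (pl mi : κ → κ → T) (e : Fin r ↪ κ) {k : κ} (l : κ)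
    (hk : ∀ i, e i ≠ k) : hlFactor pl mi e k l = mi k l :=
  if_neg fun ⟨i, hi, _⟩ => hk i hi

theorem hlFactor_of_notMem_right (pl mi : κ → κ → T) (e : Fin r ↪ κ) (k : κ) {l : κ}
    (hl : ∀ i, e i ≠ l) :
    hlFactor pl mi e k l = if ∃ i, e i = k then pl k l else mi k l := by
  refine if_congr ⟨fun ⟨i, hi, _⟩ => ⟨i, hi⟩, fun ⟨i, hi⟩ => ⟨i, hi, fun j hj => ?_⟩⟩ rfl rfl
  exact (hl j hj).elim

/-- Of two distinct indices, the one that comes first gives a factor `x_k ⊕ x_l`, if one of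
them occurs at all. -/
theorem hlFactor_eq_or (pl mi : κ → κ → T) (e : Fin r ↪ κ) {k l : κ} (hkl : k ≠ l)
    (h : ∃ i, e i = k ∨ e i = l) :
    hlFactor pl mi e k l = pl k l ∨ hlFactor pl mi e l k = pl l k := by
  have key : ∀ (i : Fin r) (k l : κ), k ≠ l → e i = k → (∃ i, e i = k ∧ ∀ j, e j = l → i < j) ∨
      (∃ i, e i = l ∧ ∀ j, e j = k → i < j) := by
    intro i k l hkl hi
    by_cases hl : ∃ j, e j = l
    · obtain ⟨j, hj⟩ := hl
      have hij : i ≠ j := by rintro rfl; exact hkl (hi.symm.trans hj)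
      rcases lt_or_gt_of_ne hij with h | h
      · exact Or.inl ⟨i, hi, fun j' hj' => by rwa [e.injective (hj'.trans hj.symm)]⟩
      · exact Or.inr ⟨j, hj, fun j' hj' => by rwa [e.injective (hj'.trans hi.symm)]⟩
    · exact Or.inl ⟨i, hi, fun j hj => (hl ⟨j, hj⟩).elim⟩
  obtain ⟨i, hi | hi⟩ := h
  · exact (key i k l hkl hi).imp (fun h => if_pos h) fun h => if_pos h
  · exact (key i l k hkl.symm hi).symm.imp (fun h => if_pos h) fun h => if_pos h

/-- The plus sign goes to the index that comes first, hence not to both (k, l) and (l, k). This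
makes every summand divisible by x_k - x_l in `exists_isHL`. -/
theorem hlFactor_eq_or' (pl mi : κ → κ → T) (e : Fin r ↪ κ) (k l : κ) :
    hlFactor pl mi e k l = mi k l ∨ hlFactor pl mi e l k = mi l k := by
  by_cases h : ∃ i, e i = k ∧ ∀ j, e j = l → i < j
  · right
    refine if_neg fun ⟨i', hi', h'⟩ => ?_
    obtain ⟨i, hi, h⟩ := h
    exact lt_asymm (h i' hi') (h' i hi)
  · exact Or.inl (if_neg h)

theorem map_hlSum (φ : T →+* T') (pl mi : κ → κ → T) (M : Fin r → κ → T) (A : Finset κ) :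
    φ (hlSum pl mi M A) = hlSum (fun k l => φ (pl k l)) (fun k l => φ (mi k l))
      (fun i k => φ (M i k)) A := by
  have : ∀ e : Fin r ↪ κ, (fun k l => φ (hlFactor pl mi e k l)) =
      hlFactor (fun k l => φ (pl k l)) (fun k l => φ (mi k l)) e := fun e => by
    funext k l
    rw [hlFactor, hlFactor, apply_ite φ]
  simp only [hlSum, map_sum, map_mul, map_prod, map_offDiagProd, this]

theorem hlSum_congr {pl mi pl' mi' : κ → κ → T} {M M' : Fin r → κ → T} {A : Finset κ}
    (h1 : ∀ k ∈ A, ∀ l ∈ A, k ≠ l → pl k l = pl' k l)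
    (h2 : ∀ k ∈ A, ∀ l ∈ A, k ≠ l → mi k l = mi' k l)
    (h3 : ∀ i, ∀ k ∈ A, M i k = M' i k) : hlSum pl mi M A = hlSum pl' mi' M' A := by
  refine Finset.sum_congr rfl fun e he => ?_
  rw [Finset.mem_filter] at he
  congr 1
  · exact Finset.prod_congr rfl fun i _ => h3 i _ (he.2 i)
  · refine offDiagProd_congr fun k hk l hl hkl => ?_
    rw [hlFactor, hlFactor, h1 k hk l hl hkl, h2 k hk l hl hkl]

theorem hlSum_map (pl mi : κ → κ → T) (M : Fin r → κ → T) (j : κ' ↪ κ) (A : Finset κ') :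
    hlSum pl mi M (A.map j) = hlSum (fun k l => pl (j k) (j l)) (fun k l => mi (j k) (j l))
      (fun i k => M i (j k)) A := by
  symm
  refine Finset.sum_bij (fun e _ => e.trans j) ?_ ?_ ?_ ?_
  · intro e he
    simp only [Finset.mem_filter, Finset.mem_univ, true_and] at he ⊢
    exact fun i => Finset.mem_map_of_mem j (he i)
  · intro e _ e' _ h
    ext i
    have := DFunLike.congr_fun h i
    exact j.injective this
  · intro e he
    simp only [Finset.mem_filter, Finset.mem_univ, true_and, Finset.mem_map] at he
    choose f hf hf' using he
    refine ⟨⟨f, fun a b hab => e.injective ?_⟩, ?_, ?_⟩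
    · rw [← hf', ← hf', hab]
    · rw [Finset.mem_filter]
      exact ⟨Finset.mem_univ _, hf⟩
    · ext i; exact hf' i
  · intro e he
    rw [offDiagProd_map]
    congr 1
    refine offDiagProd_congr fun k _ l _ _ => ?_
    simp [hlFactor]

theorem hlSum_eq_zero_of_card_lt (pl mi : κ → κ → T) (M : Fin r → κ → T) {A : Finset κ}
    (h : A.card < r) : hlSum pl mi M A = 0 := by
  refine Finset.sum_eq_zero fun e he => ?_
  rw [Finset.mem_filter] at he
  have : (Finset.univ.map e).card ≤ A.card := Finset.card_le_card fun k hk => by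
    obtain ⟨i, -, rfl⟩ := Finset.mem_map.mp hk
    exact he.2 i
  rw [Finset.card_map, Finset.card_univ, Fintype.card_fin] at this
  omega

theorem hlSum_eq_sum_of_subset {pl mi : κ → κ → T} {M : Fin r → κ → T} {A B : Finset κ}
    (hBA : B ⊆ A) (h : ∀ e : Fin r ↪ κ, (∀ i, e i ∈ A) → ¬ (∀ i, e i ∈ B) →
      (∏ i, M i (e i)) * offDiagProd (hlFactor pl mi e) A = 0) :
    hlSum pl mi M A =
      ∑ e : Fin r ↪ κ with ∀ i, e i ∈ B, (∏ i, M i (e i)) * offDiagProd (hlFactor pl mi e) A := by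
  symm
  refine Finset.sum_subset (fun e he => ?_) fun e he he' => ?_
  · rw [Finset.mem_filter] at he ⊢
    exact ⟨he.1, fun i => hBA (he.2 i)⟩
  · simp only [Finset.mem_filter, Finset.mem_univ, true_and] at he he'
    exact h e he he'

/-- Two opposite variables can be left out of a Hall–Littlewood sum. -/
theorem hlSum_insert_insert {pl mi : κ → κ → T} {M : Fin r → κ → T} {i j : κ} {B : Finset κ}
    (hij : i ≠ j) (hi : i ∉ B) (hj : j ∉ B) (h0 : pl i j = 0) (h0' : pl j i = 0)
    (h1 : ∀ k ∈ B, pl k i = mi k j) (h2 : ∀ k ∈ B, pl k j = mi k i) :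
    hlSum pl mi M (insert i (insert j B)) =
      crossProd mi i (insert j B) * crossProd mi j B * hlSum pl mi M B := by
  have hi' : i ∉ insert j B := by simp [hij, hi]
  have hjA : j ∈ insert i (insert j B) := by simp
  have hiA : i ∈ insert i (insert j B) := by simp
  rw [hlSum_eq_sum_of_subset (B := B), hlSum, Finset.mul_sum]
  · refine Finset.sum_congr rfl fun e he => ?_
    simp only [Finset.mem_filter, Finset.mem_univ, true_and] at he
    have hei : ∀ a, e a ≠ i := fun a h => hi (h ▸ he a)
    have hej : ∀ a, e a ≠ j := fun a h => hj (h ▸ he a)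
    rw [offDiagProd_insert _ hi', offDiagProd_insert _ hj, crossProd, crossProd, crossProd,
      crossProd, Finset.prod_insert hj, Finset.prod_insert hj,
      hlFactor_of_notMem_left _ _ _ _ hei, hlFactor_of_notMem_left _ _ _ _ hej]
    -- If k occurs in e, its factors against i and j are `pl k i` and `pl k j`; these are `mi k j`
    -- and `mi k i`, so only the product over both i and j is independent of e.
    have key : (∏ k ∈ B, hlFactor pl mi e k i * hlFactor pl mi e i k) *
        (∏ k ∈ B, hlFactor pl mi e k j * hlFactor pl mi e j k) =
        (∏ k ∈ B, mi k i * mi i k) * ∏ k ∈ B, mi k j * mi j k := by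
      rw [← Finset.prod_mul_distrib, ← Finset.prod_mul_distrib]
      refine Finset.prod_congr rfl fun k hk => ?_
      rw [hlFactor_of_notMem_left _ _ _ _ hei, hlFactor_of_notMem_left _ _ _ _ hej,
        hlFactor_of_notMem_right _ _ _ _ hei, hlFactor_of_notMem_right _ _ _ _ hej]
      split_ifs
      · rw [h1 k hk, h2 k hk]; ring
      · rfl
    linear_combination (mi j i * mi i j * (∏ a, M a (e a)) * offDiagProd (hlFactor pl mi e) B) * key
  · intro k hk
    simp [hk]
  -- An injection that hits i or j puts a plus factor on (i, j) or on (j, i), and both plus factors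
  -- are zero.
  · intro e he he'
    obtain ⟨a, ha⟩ := not_forall.mp he'
    have h3 : ∃ a, e a = i ∨ e a = j := by
      have := he a
      simp only [Finset.mem_insert] at this
      exact ⟨a, by tauto⟩
    refine mul_eq_zero_of_right _ ?_
    rcases hlFactor_eq_or pl mi e hij h3 with h | h
    · exact Finset.prod_eq_zero (i := (i, j)) (Finset.mem_offDiag.mpr ⟨hiA, hjA, hij⟩) (h.trans h0)
    · exact Finset.prod_eq_zero (i := (j, i)) (Finset.mem_offDiag.mpr ⟨hjA, hiA, hij.symm⟩) (h.trans h0')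

/-- A variable equal to its opposite can be left out of a Hall–Littlewood sum, if the
monomials vanish there. -/
theorem hlSum_insert {pl mi : κ → κ → T} {M : Fin r → κ → T} {i : κ} {B : Finset κ}
    (hi : i ∉ B) (h0 : ∀ a, M a i = 0) (h1 : ∀ k ∈ B, pl k i = mi k i) :
    hlSum pl mi M (insert i B) = crossProd mi i B * hlSum pl mi M B := by
  rw [hlSum_eq_sum_of_subset (B := B), hlSum, Finset.mul_sum]
  · refine Finset.sum_congr rfl fun e he => ?_
    simp only [Finset.mem_filter, Finset.mem_univ, true_and] at he
    have hei : ∀ a, e a ≠ i := fun a h => hi (h ▸ he a)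
    rw [offDiagProd_insert _ hi]
    have key : crossProd (hlFactor pl mi e) i B = crossProd mi i B := by
      refine Finset.prod_congr rfl fun k hk => ?_
      rw [hlFactor_of_notMem_left _ _ _ _ hei, hlFactor_of_notMem_right _ _ _ _ hei, h1 k hk,
        ite_self]
    rw [key]; ring
  · exact Finset.subset_insert i B
  · intro e he he'
    obtain ⟨a, ha⟩ := not_forall.mp he'
    have h3 : e a = i := by
      have := he a
      simp only [Finset.mem_insert] at this
      tauto
    exact mul_eq_zero_of_left (Finset.prod_eq_zero (Finset.mem_univ a) (by rw [h3, h0])) _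

end HLSum

/-- Passing from `Δ f = G` to a smaller number of variables modulo `p`. -/
theorem mul_map_eq_and_dvd_sub {S : Type} [CommRing S] {p f G K D G' : S} {z : S →+* S}
    (h : K * D * f = G) (hG : p ∣ G - K * G') (hK : RegularMod p K) (hD : RegularMod p D)
    (hp : z p = 0) (hzD : z D = D) (hzG : z G' = G') : D * z f = G' ∧ p ∣ f - z f := by
  -- `K` is cancelled modulo p. Then z, which kills p, turns the congruence into the equation D z(f)
  -- = G', and cancelling `D` modulo p compares f with z(f).
  have h1 : p ∣ D * f - G' := hK _ (by rwa [mul_sub, ← mul_assoc, h])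
  have h2 : D * z f = G' := by
    have := map_dvd z h1
    rw [hp, zero_dvd_iff, map_sub, map_mul, hzD, hzG, sub_eq_zero] at this
    exact this
  exact ⟨h2, hD _ (by rwa [mul_sub, h2])⟩

open MvPowerSeries (renameEquiv)

/-! ### Symmetric and antisymmetric series -/

theorem renameEquiv_eq_rename {σ τ : Type} (e : σ ≃ τ) (f : MvPowerSeries σ Lazard) :
    renameEquiv Lazard e f = rename e f := rfl

theorem renameEquiv_X {σ τ : Type} (e : σ ≃ τ) (i : σ) :
    renameEquiv Lazard e (X i) = X (e i) := MvPowerSeries.rename_X e i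

section Swap

variable {σ : Type} [DecidableEq σ]

/-- A series and its transpose agree on x_a = x_b, so the factor theorem applies. -/
theorem X_sub_X_dvd_sub_rename_swap {a b : σ} (h : a ≠ b) (f : MvPowerSeries σ Lazard) :
    (X a - X b) ∣ f - renameEquiv Lazard (Equiv.swap a b) f := by
  have hf := freeOf_X (s := a) (j := b) h.symm
  have hu := hasSubst_update a hf.1
  have h1 := X_sub_dvd_sub_subst hf f
  have h2 := X_sub_dvd_sub_subst hf (renameEquiv Lazard (Equiv.swap a b) f)
  have hs : HasSubst (X ∘ Equiv.swap a b : σ → MvPowerSeries σ Lazard) := HasSubst.X_comp _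
  have e : (renameEquiv Lazard (Equiv.swap a b) f).subst
      (Function.update X a (X b : MvPowerSeries σ Lazard)) =
      f.subst (Function.update X a (X b)) := by
    rw [renameEquiv_eq_rename, MvPowerSeries.rename_eq_subst,
      MvPowerSeries.subst_comp_subst_apply hs hu]
    congr 1; ext1 k
    rw [Function.comp_apply, MvPowerSeries.subst_X hu]
    by_cases hka : k = a
    · subst hka
      rw [Equiv.swap_apply_left, Function.update_of_ne h.symm, Function.update_self]
    · by_cases hkb : k = b
      · subst hkb
        rw [Equiv.swap_apply_right, Function.update_self, Function.update_of_ne h.symm]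
      · rw [Equiv.swap_apply_of_ne_of_ne hka hkb]
  rw [e] at h2
  have := dvd_sub h1 h2
  rwa [sub_sub_sub_cancel_right] at this

theorem prime_X_sub_X {a b : σ} (h : a ≠ b) : Prime (X a - X b : MvPowerSeries σ Lazard) :=
  prime_X_sub (freeOf_X h.symm)

/-- Here f minus its transpose is 2f, and the prime x_a - x_b does not divide 2, as the constant
terms show. -/
theorem X_sub_X_dvd_of_rename_swap_eq_neg {a b : σ} (h : a ≠ b) {f : MvPowerSeries σ Lazard}
    (hf : renameEquiv Lazard (Equiv.swap a b) f = -f) : (X a - X b) ∣ f := by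
  have h1 := X_sub_X_dvd_sub_rename_swap h f
  rw [hf, sub_neg_eq_add, ← two_mul] at h1
  refine ((prime_X_sub_X h).dvd_or_dvd h1).resolve_left fun h2 => ?_
  have h3 := map_dvd (constantCoeff (σ := σ) (R := Lazard)) h2
  rw [map_sub, MvPowerSeries.constantCoeff_X, MvPowerSeries.constantCoeff_X, sub_zero,
    zero_dvd_iff, map_ofNat] at h3
  exact prime_two_lazard.ne_zero h3

/-- The quotient of a symmetric series by x_a - x_b changes sign under the transposition, so it is
divisible once more. -/
theorem sq_dvd_of_rename_swap_eq {a b : σ} (h : a ≠ b) {f : MvPowerSeries σ Lazard}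
    (hf : renameEquiv Lazard (Equiv.swap a b) f = f) (hd : (X a - X b) ∣ f) :
    (X a - X b) ^ 2 ∣ f := by
  obtain ⟨g, rfl⟩ := hd
  rw [sq]
  refine mul_dvd_mul_left _ (X_sub_X_dvd_of_rename_swap_eq_neg h ?_)
  rw [map_mul, map_sub] at hf
  simp only [renameEquiv_X, Equiv.swap_apply_left, Equiv.swap_apply_right] at hf
  refine mul_left_cancel₀ (prime_X_sub_X h).ne_zero ?_
  linear_combination -hf

theorem lin_X_sub_X (i a b : σ) :
    lin i (X a - X b) = (if i = a then 1 else 0) - if i = b then 1 else 0 := by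
  rw [← lin_X, ← lin_X]
  exact map_sub (coeff (single i 1)) (X a) (X b)

theorem X_sub_X_not_dvd {a b c d : σ} (hcd : c ≠ d)
    (h : ¬ ((c = a ∨ c = b) ∧ (d = a ∨ d = b))) :
    ¬ (X a - X b : MvPowerSeries σ Lazard) ∣ X c - X d := by
  have hc : constantCoeff (X a - X b : MvPowerSeries σ Lazard) = 0 := by simp
  by_cases h1 : c = a ∨ c = b
  · have h2 : ¬ (d = a ∨ d = b) := fun h2 => h ⟨h1, h2⟩
    push Not at h2
    refine not_dvd_of_lin (i := d) hc ?_ ?_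
    · rw [lin_X_sub_X, if_neg h2.1, if_neg h2.2, sub_zero]
    · rw [lin_X_sub_X, if_neg hcd.symm, if_pos rfl]; simp
  · push Not at h1
    refine not_dvd_of_lin (i := c) hc ?_ ?_
    · rw [lin_X_sub_X, if_neg h1.1, if_neg h1.2, sub_zero]
    · rw [lin_X_sub_X, if_neg hcd, if_pos rfl]; simp

end Swap

theorem offDiagProd_univ_eq {T : Type} [CommRing T] {n : ℕ} (f : Fin n → Fin n → T) :
    offDiagProd f Finset.univ =
      ∏ p : Fin n × Fin n with p.1 < p.2, f p.1 p.2 * f p.2 p.1 := by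
  have h1 : ∏ p : Fin n × Fin n with p.1 < p.2, f p.2 p.1 =
      ∏ p : Fin n × Fin n with p.2 < p.1, f p.1 p.2 :=
    Finset.prod_bij (fun p _ => p.swap) (by simp) (fun p _ q _ h => Prod.swap_injective h)
      (fun p hp => ⟨p.swap, by simpa using hp, p.swap_swap⟩) (fun p _ => rfl)
  rw [Finset.prod_mul_distrib, h1, ← Finset.prod_union]
  · refine Finset.prod_congr ?_ fun _ _ => rfl
    ext ⟨a, b⟩
    simp [lt_or_lt_iff_ne]
  · rw [Finset.disjoint_left]
    rintro ⟨a, b⟩ h h'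
    simp only [Finset.mem_filter, Finset.mem_univ, true_and] at h h'
    exact lt_asymm h h'

/-! ### Hall–Littlewood sums of power series -/

section HLSeries

variable {σ τ : Type} {n r : ℕ} (ι : Fin n ↪ σ)

/-- `x_k ⊕ x_l` -/
def plX (k l : Fin n) : MvPowerSeries σ Lazard := fadd (X (ι k)) (X (ι l))

/-- `x_k ⊖ x_l` -/
def miX (k l : Fin n) : MvPowerSeries σ Lazard := fadd (X (ι k)) (fneg (X (ι l)))

variable {ι}

theorem constantCoeff_X' (i : σ) : constantCoeff (X i : MvPowerSeries σ Lazard) = 0 := by simp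

theorem constantCoeff_plX (k l : Fin n) : constantCoeff (plX ι k l) = 0 :=
  constantCoeff_fadd (constantCoeff_X' _) (constantCoeff_X' _)

theorem constantCoeff_miX (k l : Fin n) : constantCoeff (miX ι k l) = 0 :=
  constantCoeff_fadd (constantCoeff_X' _) (constantCoeff_fneg_X _)

theorem prime_miX {k l : Fin n} (h : k ≠ l) : Prime (miX ι k l) :=
  prime_fadd_fneg_X (ι.injective.ne h)

theorem associated_miX (k l : Fin n) : Associated (X (ι k) - X (ι l)) (miX ι k l) :=
  associated_fadd_fneg (constantCoeff_X' _) (constantCoeff_X' _)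

theorem offDiagProd_miX_ne_zero (A : Finset (Fin n)) : offDiagProd (miX ι) A ≠ 0 :=
  Finset.prod_ne_zero_iff.mpr fun _ hp => (prime_miX (Finset.mem_offDiag.mp hp).2.2).ne_zero

/-- Up to a unit, x_a ⊖ x_b is x_a - x_b, so the product over ordered pairs is ∏_{a<b} (x_a - x_b)²,
whose factors are regular modulo each other. -/
theorem offDiagProd_miX_dvd {f : MvPowerSeries σ Lazard}
    (h : ∀ a b : Fin n, a ≠ b → (X (ι a) - X (ι b)) ^ 2 ∣ f) :
    offDiagProd (miX ι) Finset.univ ∣ f := by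
  classical
  have h1 : Associated (∏ p : Fin n × Fin n with p.1 < p.2, (X (ι p.1) - X (ι p.2)) ^ 2)
      (offDiagProd (miX ι) Finset.univ) := by
    rw [offDiagProd_univ_eq]
    refine Associated.prod _ _ _ fun p _ => ?_
    rw [sq]
    refine (associated_miX p.1 p.2).mul_mul ?_
    have := (associated_miX (ι := ι) p.2 p.1).neg_left
    rwa [neg_sub] at this
  refine h1.symm.dvd.trans (prod_dvd_of_regularMod _ ?_ ?_)
  · rintro ⟨a, b⟩ hp ⟨c, d⟩ hq hne
    simp only [Finset.mem_filter, Finset.mem_univ, true_and] at hp hq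
    refine (RegularMod.of_prime_pow (prime_X_sub_X (ι.injective.ne hp.ne))
      (X_sub_X_not_dvd (ι.injective.ne hq.ne) ?_) 2).pow 2
    simp only [ι.injective.eq_iff]
    rintro ⟨rfl | rfl, rfl | rfl⟩
    · exact lt_irrefl _ hq
    · exact hne rfl
    · exact lt_asymm hp hq
    · exact lt_irrefl _ hq
  · rintro ⟨a, b⟩ hp
    exact h a b (Finset.mem_filter.mp hp).2.ne

/-- The series `f` is the Hall–Littlewood sum in the variables with index in `A` for the
monomials `M`. -/
def IsHL (ι : Fin n ↪ σ) (M : Fin r → Fin n → MvPowerSeries σ Lazard) (A : Finset (Fin n))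
    (f : MvPowerSeries σ Lazard) : Prop :=
  offDiagProd (miX ι) A * f = hlSum (plX ι) (miX ι) M A

variable {M : Fin r → Fin n → MvPowerSeries σ Lazard} {A : Finset (Fin n)}
  {f g : MvPowerSeries σ Lazard}

theorem IsHL.unique (hf : IsHL ι M A f) (hg : IsHL ι M A g) : f = g :=
  mul_left_cancel₀ (offDiagProd_miX_ne_zero A) (hf.trans hg.symm)

theorem isHL_zero_of_card_lt (h : A.card < r) : IsHL ι M A 0 := by
  rw [IsHL, hlSum_eq_zero_of_card_lt _ _ _ h, mul_zero]

/-- Hall–Littlewood sums are compatible with homomorphisms that map the variables to variables. -/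
theorem IsHL.map {m : ℕ} (hf : IsHL ι M A f) {j : Fin m ↪ Fin n} {B : Finset (Fin m)}
    (hB : B.map j = A) {ι' : Fin m ↪ τ}
    {h : MvPowerSeries σ Lazard →ₐ[Lazard] MvPowerSeries τ Lazard} (hh : IsCoeffMap h)
    (hX : ∀ k, h (X (ι (j k))) = X (ι' k)) :
    IsHL ι' (fun i k => h (M i (j k))) B (h f) := by
  subst hB
  have hmi : ∀ k l, h (miX ι (j k) (j l)) = miX ι' k l := fun k l => by
    rw [miX, hh.map_fadd (constantCoeff_X' _) (constantCoeff_fneg_X _),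
      hh.map_fneg (constantCoeff_X' _), hX, hX, miX]
  have hpl : ∀ k l, h (plX ι (j k) (j l)) = plX ι' k l := fun k l => by
    rw [plX, hh.map_fadd (constantCoeff_X' _) (constantCoeff_X' _), hX, hX, plX]
  have h1 := congrArg (h : MvPowerSeries σ Lazard →+* MvPowerSeries τ Lazard) hf
  rw [map_mul, offDiagProd_map, hlSum_map, map_offDiagProd, map_hlSum] at h1
  simp only [RingHom.coe_coe, hmi, hpl] at h1
  exact h1

/-- The monomials are permuted along with the variables. -/
def IsEquivariant (ι : Fin n ↪ σ) (M : Fin r → Fin n → MvPowerSeries σ Lazard) : Prop :=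
  ∀ (w : Equiv.Perm (Fin n)) i k, renameEquiv Lazard (w.viaEmbedding ι) (M i k) = M i (w k)

theorem isCoeffMap_renameEquiv (e : σ ≃ σ) :
    IsCoeffMap (renameEquiv Lazard e : MvPowerSeries σ Lazard →ₐ[Lazard] MvPowerSeries σ Lazard) :=
  isCoeffMap_rename e.toEmbedding

theorem renameEquiv_plX (w : Equiv.Perm (Fin n)) (k l : Fin n) :
    renameEquiv Lazard (w.viaEmbedding ι) (plX ι k l) = plX ι (w k) (w l) := by
  have := (isCoeffMap_renameEquiv (w.viaEmbedding ι)).map_fadd (constantCoeff_X' (ι k))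
    (constantCoeff_X' (ι l))
  refine this.trans ?_
  simp [plX, Equiv.Perm.viaEmbedding_apply]

theorem renameEquiv_miX (w : Equiv.Perm (Fin n)) (k l : Fin n) :
    renameEquiv Lazard (w.viaEmbedding ι) (miX ι k l) = miX ι (w k) (w l) := by
  have := (isCoeffMap_renameEquiv (w.viaEmbedding ι)).map_fadd (constantCoeff_X' (ι k))
    (constantCoeff_fneg_X (ι l))
  rw [(isCoeffMap_renameEquiv (w.viaEmbedding ι)).map_fneg (constantCoeff_X' (ι l))] at this
  refine this.trans ?_
  simp [miX, Equiv.Perm.viaEmbedding_apply]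

theorem renameEquiv_hlSum (hM : IsEquivariant ι M) (w : Equiv.Perm (Fin n)) :
    renameEquiv Lazard (w.viaEmbedding ι) (hlSum (plX ι) (miX ι) M Finset.univ) =
      hlSum (plX ι) (miX ι) M Finset.univ := by
  have h1 := map_hlSum (renameEquiv Lazard (w.viaEmbedding ι) :
    MvPowerSeries σ Lazard →+* MvPowerSeries σ Lazard) (plX ι) (miX ι) M Finset.univ
  simp only [RingHom.coe_coe, renameEquiv_plX, renameEquiv_miX, hM w] at h1
  have h2 := hlSum_map (plX ι) (miX ι) M w.toEmbedding Finset.univ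
  rw [Finset.map_univ_equiv] at h2
  exact h1.trans h2.symm

theorem renameEquiv_offDiagProd (w : Equiv.Perm (Fin n)) :
    renameEquiv Lazard (w.viaEmbedding ι) (offDiagProd (miX ι) Finset.univ) =
      offDiagProd (miX ι) Finset.univ := by
  have h1 := map_offDiagProd (renameEquiv Lazard (w.viaEmbedding ι) :
    MvPowerSeries σ Lazard →+* MvPowerSeries σ Lazard) (miX ι) Finset.univ
  simp only [RingHom.coe_coe, renameEquiv_miX] at h1
  have h2 := offDiagProd_map (miX ι) w.toEmbedding Finset.univ
  rw [Finset.map_univ_equiv] at h2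
  exact h1.trans h2.symm

theorem IsHL.renameEquiv_eq (hf : IsHL ι M Finset.univ f) (hM : IsEquivariant ι M)
    (w : Equiv.Perm (Fin n)) : renameEquiv Lazard (w.viaEmbedding ι) f = f := by
  refine IsHL.unique (ι := ι) (M := M) (A := Finset.univ) ?_ hf
  have h1 := congrArg (renameEquiv Lazard (w.viaEmbedding ι)) hf
  rwa [map_mul, renameEquiv_offDiagProd, renameEquiv_hlSum hM] at h1

theorem viaEmbedding_swap [DecidableEq σ] (a b : Fin n) :
    (Equiv.swap a b).viaEmbedding ι = Equiv.swap (ι a) (ι b) := by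
  ext k
  by_cases hk : k ∈ Set.range ι
  · obtain ⟨k, rfl⟩ := hk
    rw [Equiv.Perm.viaEmbedding_apply, ι.injective.swap_apply]
  · rw [Equiv.Perm.viaEmbedding_apply_of_notMem _ _ _ hk, Equiv.swap_apply_of_ne_of_ne]
    · rintro rfl; exact hk ⟨a, rfl⟩
    · rintro rfl; exact hk ⟨b, rfl⟩

/-- The sums of fractions are power series: each summand of the cleared sum is divisible by x_a -
x_b, and by symmetry the whole sum is divisible by its square. -/
theorem exists_isHL (hM : IsEquivariant ι M) : ∃ f, IsHL ι M Finset.univ f := by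
  classical
  suffices h : offDiagProd (miX ι) Finset.univ ∣ hlSum (plX ι) (miX ι) M Finset.univ by
    obtain ⟨f, hf⟩ := h
    exact ⟨f, hf.symm⟩
  refine offDiagProd_miX_dvd ?_
  intro a b hab
  refine sq_dvd_of_rename_swap_eq (ι.injective.ne hab) ?_ ?_
  · rw [← viaEmbedding_swap]
    exact renameEquiv_hlSum hM _
  · refine Finset.dvd_sum fun e _ => Dvd.dvd.mul_left ?_ _
    rcases hlFactor_eq_or' (plX ι) (miX ι) e a b with h | h
    · refine (associated_miX a b).dvd.trans ?_
      rw [← h]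
      exact Finset.dvd_prod_of_mem (fun p : Fin n × Fin n => hlFactor (plX ι) (miX ι) e p.1 p.2)
        (a := (a, b)) (by simpa using hab)
    · have h1 : (X (ι a) - X (ι b)) ∣ hlFactor (plX ι) (miX ι) e b a := by
        rw [h, ← neg_sub, neg_dvd]
        exact (associated_miX b a).dvd
      exact h1.trans (Finset.dvd_prod_of_mem
        (fun p : Fin n × Fin n => hlFactor (plX ι) (miX ι) e p.1 p.2)
        (a := (b, a)) (by simpa using hab.symm))

end HLSeries

/-! ### Order of Hall–Littlewood sums, and their behaviour at opposite or vanishing variables -/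

section HLSeries

variable {σ : Type} {n r : ℕ} {ι : Fin n ↪ σ} {M : Fin r → Fin n → MvPowerSeries σ Lazard}
  {f : MvPowerSeries σ Lazard}

theorem one_le_order_miX (k l : Fin n) : 1 ≤ (miX ι k l).order :=
  MvPowerSeries.one_le_order_iff_constCoeff_eq_zero.mpr (constantCoeff_miX k l)

theorem order_miX {k l : Fin n} (h : k ≠ l) : (miX ι k l).order = 1 := by
  classical
  refine le_antisymm ?_ (one_le_order_miX k l)
  have h1 : lin (ι k) (miX ι k l) = 1 := by
    rw [miX, lin_fadd _ (constantCoeff_X' _) (constantCoeff_fneg_X _),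
      lin_fneg _ (constantCoeff_X' _), lin_X, lin_X, if_pos rfl, if_neg (ι.injective.ne h),
      neg_zero, add_zero]
  have h2 := MvPowerSeries.order_le (f := miX ι k l) (d := single (ι k) 1)
    (h1.trans_ne one_ne_zero)
  rwa [Finsupp.degree_single] at h2

theorem order_offDiagProd_miX (A : Finset (Fin n)) :
    (offDiagProd (miX ι) A).order = A.offDiag.card := by
  rw [offDiagProd, MvPowerSeries.order_prod, Finset.sum_congr rfl fun p hp =>
    order_miX (Finset.mem_offDiag.mp hp).2.2]
  simp

/-- Order is additive over a domain. Every summand of `hlSum` has one factor of order at least 1 for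
each ordered pair, and the denominator has order exactly the number of these pairs. -/
theorem IsHL.le_order {A : Finset (Fin n)} (hf : IsHL ι M A f) {μ : Fin r → ℕ}
    (hM : ∀ i k, (μ i : ℕ∞) ≤ (M i k).order) : ((∑ i, μ i : ℕ) : ℕ∞) ≤ f.order := by
  have h1 : ((∑ i, μ i : ℕ) : ℕ∞) + A.offDiag.card ≤
      (hlSum (plX ι) (miX ι) M A).order := by
    refine Finset.sum_induction _ (fun g : MvPowerSeries σ Lazard => _ ≤ g.order)
      (fun _ _ => le_order_add) (by simp) fun e _ => ?_
    rw [MvPowerSeries.order_mul, MvPowerSeries.order_prod, offDiagProd, MvPowerSeries.order_prod]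
    refine add_le_add ?_ ?_
    · rw [Nat.cast_sum]
      exact Finset.sum_le_sum fun i _ => hM i _
    · rw [Finset.card_eq_sum_ones, Nat.cast_sum]
      refine Finset.sum_le_sum fun p _ => ?_
      rw [Nat.cast_one, MvPowerSeries.one_le_order_iff_constCoeff_eq_zero, hlFactor]
      split_ifs
      · exact constantCoeff_plX _ _
      · exact constantCoeff_miX _ _
  rw [← hf, MvPowerSeries.order_mul, order_offDiagProd_miX, add_comm] at h1
  exact (ENat.add_le_add_iff_left (ENat.natCast_ne_top _)).mp h1

theorem zeroOut_offDiagProd_miX {s : Set σ} {B : Finset (Fin n)} (hs : ∀ k ∈ B, ι k ∉ s) :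
    zeroOut s (offDiagProd (miX ι) B) = offDiagProd (miX ι) B := by
  refine (map_offDiagProd (zeroOut s : MvPowerSeries σ Lazard →+* MvPowerSeries σ Lazard)
    (miX ι) B).trans (offDiagProd_congr fun k hk l hl _ => ?_)
  rw [RingHom.coe_coe, miX, (isCoeffMap_zeroOut s).map_fadd (constantCoeff_X' _)
    (constantCoeff_fneg_X _), (isCoeffMap_zeroOut s).map_fneg (constantCoeff_X' _),
    zeroOut_X_of_notMem (hs k hk), zeroOut_X_of_notMem (hs l hl)]

theorem zeroOut_hlSum {s : Set σ} {B : Finset (Fin n)} (hs : ∀ k ∈ B, ι k ∉ s)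
    (hM : ∀ a, ∀ k ∈ B, zeroOut s (M a k) = M a k) :
    zeroOut s (hlSum (plX ι) (miX ι) M B) = hlSum (plX ι) (miX ι) M B := by
  refine (map_hlSum (zeroOut s : MvPowerSeries σ Lazard →+* MvPowerSeries σ Lazard)
    (plX ι) (miX ι) M B).trans (hlSum_congr (fun k hk l hl _ => ?_) (fun k hk l hl _ => ?_) hM)
  · rw [RingHom.coe_coe, plX, (isCoeffMap_zeroOut s).map_fadd (constantCoeff_X' _)
      (constantCoeff_X' _), zeroOut_X_of_notMem (hs k hk), zeroOut_X_of_notMem (hs l hl)]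
  · rw [RingHom.coe_coe, miX, (isCoeffMap_zeroOut s).map_fadd (constantCoeff_X' _)
      (constantCoeff_fneg_X _), (isCoeffMap_zeroOut s).map_fneg (constantCoeff_X' _),
      zeroOut_X_of_notMem (hs k hk), zeroOut_X_of_notMem (hs l hl)]

theorem dvd_sub_iff_mk_eq {S : Type} [CommRing S] {p f g : S} :
    p ∣ f - g ↔ Ideal.Quotient.mk (Ideal.span {p}) f = Ideal.Quotient.mk (Ideal.span {p}) g := by
  rw [Ideal.Quotient.eq, Ideal.mem_span_singleton]

/-- In the quotient by x_i ⊕ x_j the two variables are opposite, which is the situation of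
`hlSum_insert_insert`. -/
theorem fadd_dvd_hlSum_sub {i j : Fin n} {B : Finset (Fin n)} (hij : i ≠ j) (hi : i ∉ B)
    (hj : j ∉ B) : fadd (X (ι i)) (X (ι j)) ∣
      hlSum (plX ι) (miX ι) M (insert i (insert j B)) - crossProd (miX ι) i (insert j B) *
        crossProd (miX ι) j B * hlSum (plX ι) (miX ι) M B := by
  have c := constantCoeff_X' (σ := σ)
  rw [dvd_sub_iff_mk_eq, map_mul, map_mul, map_hlSum, hlSum_insert_insert hij hi hj]
  · rw [map_hlSum, crossProd, crossProd, crossProd, crossProd, map_prod, map_prod]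
    simp only [map_mul]
  · rw [Ideal.Quotient.eq_zero_iff_mem, Ideal.mem_span_singleton, plX]
  · rw [Ideal.Quotient.eq_zero_iff_mem, Ideal.mem_span_singleton, plX, fadd_comm (c _) (c _)]
  · intro k _
    exact dvd_sub_iff_mk_eq.mp (fadd_dvd_fadd_fneg_sub (c _) (c _) (c _))
  · intro k _
    rw [← dvd_sub_iff_mk_eq, fadd_comm (c (ι i)) (c (ι j))]
    exact fadd_dvd_fadd_fneg_sub (c _) (c _) (c _)

theorem regularMod_crossProd_miX {p : MvPowerSeries σ Lazard}
    (hmi : ∀ k l : Fin n, k ≠ l → RegularMod p (miX ι k l)) {k : Fin n} {C : Finset (Fin n)}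
    (hk : k ∉ C) : RegularMod p (crossProd (miX ι) k C) :=
  RegularMod.prod fun l hl => (hmi l k (fun h => hk (h ▸ hl))).mul
      (hmi k l (fun h => hk (h ▸ hl)))

theorem regularMod_offDiagProd_miX {p : MvPowerSeries σ Lazard}
    (hmi : ∀ k l : Fin n, k ≠ l → RegularMod p (miX ι k l)) (C : Finset (Fin n)) :
    RegularMod p (offDiagProd (miX ι) C) :=
  RegularMod.prod fun _ hp => hmi _ _ (Finset.mem_offDiag.mp hp).2.2

/-- The basic property of Hall–Littlewood sums: setting two variables opposite to each other is
the same as setting both to zero, and leaves the Hall–Littlewood sum in the other variables. -/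
theorem IsHL.pair {i j : Fin n} {B : Finset (Fin n)} (hij : i ≠ j) (hi : i ∉ B) (hj : j ∉ B)
    (hf : IsHL ι M (insert i (insert j B)) f)
    (hM : ∀ a, ∀ k ∈ B, zeroOut {ι i, ι j} (M a k) = M a k) :
    IsHL ι M B (zeroOut {ι i, ι j} f) ∧
      fadd (X (ι i)) (X (ι j)) ∣ f - zeroOut {ι i, ι j} f := by
  have hi' : i ∉ insert j B := by simp [hij, hi]
  have c := constantCoeff_X' (σ := σ)
  have hs : ∀ k ∈ B, ι k ∉ ({ι i, ι j} : Set σ) := fun k hk => by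
    simp only [Set.mem_insert_iff, Set.mem_singleton_iff, ι.injective.eq_iff]
    rintro (rfl | rfl)
    · exact hi hk
    · exact hj hk
  have hp := prime_fadd_X (ι.injective.ne hij)
  have hmi : ∀ k l : Fin n, k ≠ l → RegularMod (fadd (X (ι i)) (X (ι j))) (miX ι k l) :=
    fun k l hkl => RegularMod.of_prime_left hp (fadd_X_not_dvd_fadd_fneg_X (ι.injective.ne hkl))
  have hz : zeroOut {ι i, ι j} (fadd (X (ι i)) (X (ι j))) = 0 := by
    rw [(isCoeffMap_zeroOut _).map_fadd (c _) (c _),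
      zeroOut_X_of_mem (s := {ι i, ι j}) (k := ι i) (by simp),
      zeroOut_X_of_mem (s := {ι i, ι j}) (k := ι j) (by simp), fadd_zero (map_zero _)]
  rw [IsHL, offDiagProd_insert _ hi', offDiagProd_insert _ hj, ← mul_assoc] at hf
  exact mul_map_eq_and_dvd_sub (z := (zeroOut {ι i, ι j} :
    MvPowerSeries σ Lazard →+* MvPowerSeries σ Lazard)) hf (fadd_dvd_hlSum_sub hij hi hj)
    ((regularMod_crossProd_miX hmi hi').mul (regularMod_crossProd_miX hmi hj))
    (regularMod_offDiagProd_miX hmi B) hz (zeroOut_offDiagProd_miX hs) (zeroOut_hlSum hs hM)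

theorem not_miX_dvd_psi {q : Bool} {i k l : Fin n} (hkl : k ≠ l) :
    ¬ miX ι k l ∣ psi q (X (ι i)) := by
  classical
  intro h
  obtain ⟨c, hc⟩ := exists_lin_eq_of_dvd (by simp) ((associated_miX k l).dvd.trans h)
  have hι := ι.injective.eq_iff (a := k) (b := l)
  have h0 := hc (ι i)
  have hk := hc (ι k)
  have hl := hc (ι l)
  rw [lin_X_sub_X, if_pos rfl, if_neg (ι.injective.ne hkl), sub_zero, one_mul] at hk
  rw [lin_X_sub_X, if_pos rfl, if_neg (ι.injective.ne hkl.symm), zero_sub, neg_one_mul] at hl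
  have hc0 : c = 0 := by
    by_cases hki : k = i
    · have : l ≠ i := fun h => hkl (hki.trans h.symm)
      rw [lin_psi_X, if_neg (ι.injective.ne this)] at hl
      exact neg_eq_zero.mp hl.symm
    · rw [lin_psi_X, if_neg (ι.injective.ne hki)] at hk
      exact hk.symm
  rw [hc0, mul_zero] at h0
  exact lin_psi_X_self _ h0

/-- The argument of `IsHL.pair` with modulus ψ(x_i) and `hlSum_insert`. As x_i ⊕ x_i = x_i(2 + ⋯) is
not prime, regularity is taken from the primes x_k ⊖ x_l, which do not divide ψ(x_i). -/
theorem IsHL.single {q : Bool} {i : Fin n} {B : Finset (Fin n)} (hi : i ∉ B)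
    (hf : IsHL ι M (insert i B) f) (hMi : ∀ a, psi q (X (ι i)) ∣ M a i)
    (hM : ∀ a, ∀ k ∈ B, zeroOut {ι i} (M a k) = M a k) :
    IsHL ι M B (zeroOut {ι i} f) ∧ psi q (X (ι i)) ∣ f - zeroOut {ι i} f := by
  have c := constantCoeff_X' (σ := σ)
  have hs : ∀ k ∈ B, ι k ∉ ({ι i} : Set σ) := fun k hk => by
    rw [Set.mem_singleton_iff, ι.injective.eq_iff]
    rintro rfl
    exact hi hk
  have hmi : ∀ k l : Fin n, k ≠ l → RegularMod (psi q (X (ι i))) (miX ι k l) :=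
    fun k l hkl => RegularMod.of_prime_right (prime_miX hkl) (not_miX_dvd_psi hkl)
  have hz : zeroOut {ι i} (psi q (X (ι i))) = 0 := by
    rw [(isCoeffMap_zeroOut _).map_psi (c _), zeroOut_X_of_mem (Set.mem_singleton _), psi_zero]
  have hG : psi q (X (ι i)) ∣ hlSum (plX ι) (miX ι) M (insert i B) - crossProd (miX ι) i B *
      hlSum (plX ι) (miX ι) M B := by
    rw [dvd_sub_iff_mk_eq, map_mul, map_hlSum, hlSum_insert hi]
    · rw [map_hlSum, crossProd, crossProd, map_prod]
      simp only [map_mul]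
    · intro a
      rw [Ideal.Quotient.eq_zero_iff_mem, Ideal.mem_span_singleton]
      exact hMi a
    · intro k _
      exact dvd_sub_iff_mk_eq.mp (psi_X_dvd_fadd_sub (c _))
  rw [IsHL, offDiagProd_insert _ hi] at hf
  exact mul_map_eq_and_dvd_sub (z := (zeroOut {ι i} :
    MvPowerSeries σ Lazard →+* MvPowerSeries σ Lazard)) hf hG
    (regularMod_crossProd_miX hmi hi) (regularMod_offDiagProd_miX hmi B) hz
    (zeroOut_offDiagProd_miX hs) (zeroOut_hlSum hs hM)

end HLSeries

/-! ### The symmetrised sum of fractions -/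

section Fractions

variable {n r : ℕ}

/-- A permutation of `Fin n` gives an injection of `Fin r`. -/
def permToEmb (h : r ≤ n) (w : Equiv.Perm (Fin n)) : Fin r ↪ Fin n :=
  (Fin.castLEEmb h).trans w.toEmbedding

/-- The permutations extending a given injection correspond to the bijections between the two
complements, each of n - r elements. This accounts for the factor 1/(n-r)!. -/
theorem card_permToEmb_fiber (h : r ≤ n) (e : Fin r ↪ Fin n) :
    (Finset.univ.filter fun w : Equiv.Perm (Fin n) => permToEmb h w = e).card =
      (n - r).factorial := by
  classical
  let c := Fin.castLEEmb h
  let e₀ : Set.range c ≃ Set.range e :=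
    (Equiv.ofInjective c c.injective).symm.trans (Equiv.ofInjective e e.injective)
  have he₀ : ∀ a, e₀ ⟨c a, a, rfl⟩ = ⟨e a, a, rfl⟩ := fun a => by
    have : (Equiv.ofInjective c c.injective).symm ⟨c a, a, rfl⟩ = a :=
      Equiv.ofInjective_symm_apply c.injective a
    rw [Equiv.trans_apply, this]
    rfl
  have hcard : ∀ g : Fin r ↪ Fin n, Fintype.card ↥(Set.range g)ᶜ = n - r := fun g => by
    rw [Fintype.card_compl_set, Fintype.card_fin, Set.card_range_of_injective g.injective,
      Fintype.card_fin]
  have h1 : ∀ w : Equiv.Perm (Fin n), permToEmb h w = e ↔ ∀ x : Set.range c, w x = e₀ x := by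
    intro w
    constructor
    · rintro hw ⟨_, a, rfl⟩
      rw [he₀]
      exact DFunLike.congr_fun hw a
    · intro hw
      ext1 a
      have := hw ⟨c a, a, rfl⟩
      rw [he₀] at this
      exact this
  rw [← Fintype.card_subtype,
    Fintype.card_congr ((Equiv.subtypeEquivRight h1).trans (Equiv.Set.compl e₀)),
    Fintype.card_equiv (Fintype.equivOfCardEq ((hcard c).trans (hcard e).symm)), hcard]

theorem sum_permToEmb {K : Type} [CommRing K] (h : r ≤ n) (F : (Fin r ↪ Fin n) → K) :
    ∑ w, F (permToEmb h w) = ((n - r).factorial : K) * ∑ e, F e := by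
  classical
  rw [← Finset.sum_fiberwise (s := Finset.univ) (g := permToEmb h), Finset.mul_sum]
  refine Finset.sum_congr rfl fun e _ => ?_
  rw [Finset.sum_congr rfl fun w hw => congrArg F (Finset.mem_filter.mp hw).2, Finset.sum_const,
    card_permToEmb_fiber, nsmul_eq_mul]

theorem hlFactor_permToEmb {T : Type} [CommRing T] (pl mi : Fin n → Fin n → T) (h : r ≤ n)
    (w : Equiv.Perm (Fin n)) (i j : Fin n) :
    hlFactor pl mi (permToEmb h w) (w i) (w j) =
      if i.val < r ∧ i < j then pl (w i) (w j) else mi (w i) (w j) := by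
  have key : ∀ (a : Fin r) (k : Fin n), permToEmb h w a = w k ↔ a.val = k.val := fun a k => by
    rw [permToEmb, Function.Embedding.trans_apply, Equiv.coe_toEmbedding, w.injective.eq_iff,
      Fin.ext_iff]
    rfl
  refine if_congr ?_ rfl rfl
  simp only [key]
  constructor
  · rintro ⟨a, ha, h1⟩
    refine ⟨ha ▸ a.2, ?_⟩
    by_cases hj : j.val < r
    · have := h1 ⟨j, hj⟩ rfl
      rw [Fin.lt_def] at this ⊢
      simpa [← ha] using this
    · rw [Fin.lt_def, ← ha]
      omega
  · rintro ⟨hi, hij⟩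
    exact ⟨⟨i, hi⟩, rfl, fun b hb => by rw [Fin.lt_def] at hij ⊢; simpa [hb] using hij⟩

/-- Each fraction replaces one factor x ⊖ y of the common denominator by x ⊕ y, namely for the pairs
(w i, w j) with i < r and i < j; this is the rule defining `hlFactor`. -/
theorem offDiagProd_mul_prod_ratio {K : Type} [Field K] (pl mi : Fin n → Fin n → K)
    (hmi : ∀ k l, k ≠ l → mi k l ≠ 0) (h : r ≤ n) (w : Equiv.Perm (Fin n)) :
    offDiagProd mi Finset.univ * (∏ i : Fin n with i.val < r, ∏ j ∈ Finset.Ioi i,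
      pl (w i) (w j) * (mi (w i) (w j))⁻¹) =
    offDiagProd (hlFactor pl mi (permToEmb h w)) Finset.univ := by
  have e1 := offDiagProd_map mi w.toEmbedding Finset.univ
  have e2 := offDiagProd_map (hlFactor pl mi (permToEmb h w)) w.toEmbedding Finset.univ
  rw [Finset.map_univ_equiv] at e1 e2
  have e3 : (∏ i : Fin n with i.val < r, ∏ j ∈ Finset.Ioi i,
      pl (w i) (w j) * (mi (w i) (w j))⁻¹) =
      ∏ p ∈ (Finset.univ : Finset (Fin n)).offDiag, if p.1.val < r ∧ p.1 < p.2 then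
        pl (w p.1) (w p.2) * (mi (w p.1) (w p.2))⁻¹ else 1 := by
    rw [Finset.prod_sigma', ← Finset.prod_filter]
    refine Finset.prod_bij (fun p _ => (p.1, p.2)) ?_ ?_ ?_ ?_
    · rintro ⟨a, b⟩ hp
      simp only [Finset.mem_sigma, Finset.mem_filter, Finset.mem_univ, true_and,
        Finset.mem_Ioi] at hp
      simp [hp.1, hp.2, hp.2.ne]
    · rintro ⟨a, b⟩ _ ⟨c, d⟩ _ h
      simp only [Prod.mk.injEq] at h
      obtain ⟨rfl, rfl⟩ := h
      rfl
    · rintro ⟨a, b⟩ hp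
      simp only [Finset.mem_filter] at hp
      exact ⟨⟨a, b⟩, by simp [hp.2.1, hp.2.2], rfl⟩
    · intro p _; rfl
  rw [e1, e2, e3, offDiagProd, offDiagProd, ← Finset.prod_mul_distrib]
  refine Finset.prod_congr rfl fun p hp => ?_
  have hne := hmi (w p.1) (w p.2) (w.injective.ne (Finset.mem_offDiag.mp hp).2.2)
  simp only [Equiv.coe_toEmbedding, hlFactor_permToEmb]
  split_ifs
  · rw [mul_comm, mul_assoc, inv_mul_cancel₀ hne, mul_one]
  · rw [mul_one]

end Fractions

/-! ### Homomorphisms determined by the variables -/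

section Ext

variable {σ τ υ : Type} {h k : MvPowerSeries σ Lazard →ₐ[Lazard] MvPowerSeries τ Lazard}

theorem IsCoeffMap.hasSubst (hh : IsCoeffMap h) {a : υ → MvPowerSeries σ Lazard}
    (ha : HasSubst a) (ha' : ∀ s, MvPowerSeries.constantCoeff (a s) = 0) : HasSubst fun s => h (a s) where
  const_coeff s := by
    rw [hh.constantCoeff (ha' s)]
    exact IsNilpotent.zero
  coeff_zero d := by
    rcases hh d with ⟨d', -, hd⟩ | hd
    · simpa only [hd] using ha.coeff_zero d'
    · simp only [hd, ne_eq, not_true_eq_false, Set.ofPred_false, Set.finite_empty]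

theorem IsCoeffMap.ext (hh : IsCoeffMap h) (hk : IsCoeffMap k) (hX : ∀ i, h (X i) = k (X i)) :
    h = k := by
  ext1 f
  have h1 := hh.map_subst HasSubst.X (hh.hasSubst HasSubst.X constantCoeff_X') f
  have h2 := hk.map_subst HasSubst.X (hk.hasSubst HasSubst.X constantCoeff_X') f
  rw [MvPowerSeries.subst_self] at h1 h2
  simp only [id] at h1 h2
  rw [h1, h2]
  simp only [hX]

theorem killCompl_zeroOut {e : τ ↪ σ} {s : Set σ} (hs : ∀ k, e k ∉ s)
    (f : MvPowerSeries σ Lazard) : killCompl (R := Lazard) e (zeroOut s f) = killCompl e f := by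
  have := ((isCoeffMap_killCompl e).comp (isCoeffMap_zeroOut s)).ext (isCoeffMap_killCompl e)
    fun i => by
      rw [AlgHom.comp_apply]
      by_cases hi : i ∈ s
      · rw [zeroOut_X_of_mem hi, map_zero, MvPowerSeries.killCompl_X_eq_zero]
        rintro ⟨k, rfl⟩
        exact hs k hi
      · rw [zeroOut_X_of_notMem hi]
  exact DFunLike.congr_fun this f

end Ext

/-! ### The monomials -/

section Monomials

variable {n m : ℕ}

/-- The factorial powers `[[t|b]]^k` or `[t|b]^k`. -/
def factMon (q : Bool) (t : XBSeries n) (k : ℕ) : XBSeries n :=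
  if q then factPowQ t k else factPow t k

theorem factMon_zero (q : Bool) (t : XBSeries n) : factMon q t 0 = 1 := by
  cases q
  · simp [factMon, factPow]
  · rfl

theorem constantCoeff_bVar (l : ℕ) : constantCoeff (bVar n l) = 0 := constantCoeff_X' _

theorem le_order_factPow {t : XBSeries n} (ht : constantCoeff t = 0) (k : ℕ) :
    (k : ℕ∞) ≤ (factPow t k).order := by
  rw [factPow, MvPowerSeries.order_prod]
  calc (k : ℕ∞) = ∑ _l ∈ Finset.range k, 1 := by simp
    _ ≤ _ := Finset.sum_le_sum fun l _ => MvPowerSeries.one_le_order_iff_constCoeff_eq_zero.mpr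
      (constantCoeff_fadd ht (constantCoeff_bVar l))

theorem le_order_factMon {q : Bool} {t : XBSeries n} (ht : constantCoeff t = 0) (k : ℕ) :
    (k : ℕ∞) ≤ (factMon q t k).order := by
  cases q
  · exact le_order_factPow ht k
  · cases k with
    | zero => simp
    | succ k =>
      change _ ≤ (fadd t t * factPow t k).order
      rw [MvPowerSeries.order_mul, add_comm, Nat.cast_add, Nat.cast_one]
      exact add_le_add (MvPowerSeries.one_le_order_iff_constCoeff_eq_zero.mpr
        (constantCoeff_fadd ht ht)) (le_order_factPow ht k)

theorem psi_dvd_factMon (t : XBSeries n) {k : ℕ} (hk : 0 < k) :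
    psi true t ∣ factMon true t k := by
  obtain ⟨k, rfl⟩ := Nat.exists_eq_succ_of_ne_zero hk.ne'
  exact Dvd.intro _ rfl

theorem IsCoeffMap.map_factMon {h : XBSeries n →ₐ[Lazard] XBSeries m} (hh : IsCoeffMap h)
    (hb : ∀ l, h (bVar n l) = bVar m l) (q : Bool) {t : XBSeries n} (ht : MvPowerSeries.constantCoeff t = 0)
    (k : ℕ) : h (factMon q t k) = factMon q (h t) k := by
  have h1 : ∀ k, h (factPow t k) = factPow (h t) k := fun k => by
    rw [factPow, map_prod, factPow]
    refine Finset.prod_congr rfl fun l _ => ?_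
    rw [hh.map_fadd ht (constantCoeff_bVar l), hb]
  cases q
  · exact h1 k
  · cases k with
    | zero => exact map_one h
    | succ k =>
      change h (fadd t t * factPow t k) = fadd (h t) (h t) * factPow (h t) k
      rw [map_mul, hh.map_fadd ht ht, h1]

/-- At b = 0 one of the k factors is t or t ⊕ t, and the remaining k - 1 are t; only for k > 0 is
there such a factor. -/
theorem IsCoeffMap.map_factMon_zero {h : XBSeries n →ₐ[Lazard] XSeries m} (hh : IsCoeffMap h)
    (hb : ∀ l, h (bVar n l) = 0) (q : Bool) {t : XBSeries n} (ht : MvPowerSeries.constantCoeff t = 0)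
    {k : ℕ} (hk : 0 < k) : h (factMon q t k) = psi q (h t) * h t ^ (k - 1) := by
  have h1 : ∀ k, h (factPow t k) = h t ^ k := fun k => by
    rw [factPow, map_prod, ← Finset.card_range k, ← Finset.prod_const, Finset.card_range]
    refine Finset.prod_congr rfl fun l _ => ?_
    rw [hh.map_fadd ht (constantCoeff_bVar l), hb, fadd_zero (hh.constantCoeff ht)]
  obtain ⟨k, rfl⟩ := Nat.exists_eq_succ_of_ne_zero hk.ne'
  cases q
  · change h (factPow t (k + 1)) = h t * h t ^ k
    rw [h1, pow_succ']
  · change h (fadd t t * factPow t k) = fadd (h t) (h t) * h t ^ k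
    rw [map_mul, hh.map_fadd ht ht, h1]

end Monomials

/-! ### Strict partitions -/

section Partitions

/-- The size `|λ|`. -/
def StrictPartition.size (lam : StrictPartition) : ℕ := lam.parts.sum

theorem StrictPartition.part_eq (lam : StrictPartition) (i : Fin lam.length) :
    lam.part i = lam.parts.get i := by
  rw [part, List.getD_eq_getElem _ _ i.2]
  rfl

theorem StrictPartition.part_pos (lam : StrictPartition) (i : Fin lam.length) : 0 < lam.part i := by
  rw [part_eq]
  exact lam.pos _ (List.get_mem _ _)

theorem StrictPartition.part_eq_zero (lam : StrictPartition) {i : ℕ} (h : lam.length ≤ i) :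
    lam.part i = 0 := List.getD_eq_default _ _ h

theorem StrictPartition.sum_part (lam : StrictPartition) :
    ∑ i : Fin lam.length, lam.part i = lam.size := by
  rw [Finset.sum_congr rfl fun i _ => lam.part_eq i]
  exact Fin.sum_univ_getElem lam.parts

theorem StrictPartition.ext_parts {lam mu : StrictPartition} (h : lam.parts = mu.parts) :
    lam = mu := by
  cases lam; cases mu; cases h; rfl

/-- A strict partition is determined by its set of parts, here a subset of {0, …, d}. With the bound
of the order by |λ| this yields convergence of all sums. -/
theorem StrictPartition.finite_size_le (d : ℕ) : {lam : StrictPartition | lam.size ≤ d}.Finite := by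
  refine Set.Finite.of_finite_image (f := fun lam => lam.parts.toFinset)
    ((Finset.range (d + 1)).powerset.finite_toSet.subset ?_) ?_
  · rintro _ ⟨lam, hlam, rfl⟩
    rw [Finset.mem_coe, Finset.mem_powerset]
    intro p hp
    rw [Finset.mem_range]
    exact Nat.lt_succ_of_le ((List.single_le_sum (by simp) p (List.mem_toFinset.mp hp)).trans hlam)
  · intro lam _ mu _ h
    refine StrictPartition.ext_parts (List.Perm.eq_of_pairwise (le := (· > ·)) ?_ lam.strict
      mu.strict ?_)
    · intro a b _ _ h h'
      exact (lt_asymm h h').elim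
    · exact List.perm_of_nodup_nodup_toFinset_eq lam.strict.nodup mu.strict.nodup h

end Partitions

/-! ### The universal factorial functions as Hall–Littlewood sums -/

section Schur

variable {n : ℕ}

/-- `Q_λ(x_n|b)` or `P_λ(x_n|b)`. -/
def schur (q : Bool) (n : ℕ) (lam : StrictPartition) : XBSeries n :=
  if q then schurQ n lam else schurP n lam

/-- The factors of the monomials in `Q_λ(x_n|b)` or `P_λ(x_n|b)`. -/
def schurMon (q : Bool) (n : ℕ) (lam : StrictPartition) (i : Fin lam.length) (k : Fin n) :
    XBSeries n := factMon q (X (Sum.inl k)) (lam.part i)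

theorem isEquivariant_schurMon (q : Bool) (lam : StrictPartition) :
    IsEquivariant Function.Embedding.inl (schurMon q n lam) := by
  intro w i k
  refine ((isCoeffMap_renameEquiv _).map_factMon (fun l => ?_) q (constantCoeff_X' _) _).trans ?_
  · refine (renameEquiv_X _ _).trans ?_
    rw [Equiv.Perm.viaEmbedding_apply_of_notMem]
    · rfl
    · rintro ⟨k, hk⟩; cases hk
  · change factMon q (renameEquiv Lazard _ (X (Function.Embedding.inl k))) _ = _
    rw [renameEquiv_X, Equiv.Perm.viaEmbedding_apply]
    rfl

/-- With denominators cleared, the summand of w depends only on the images of the first r indices,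
so grouping permutations by this injection cancels the factorial. -/
theorem algebraMap_mul_hallLittlewoodSum (q : Bool) {lam : StrictPartition} (h : lam.length ≤ n) :
    algebraMap (XBSeries n) (XBFrac n) (offDiagProd (miX Function.Embedding.inl) Finset.univ) *
      hallLittlewoodSum n (factMon q) lam =
    algebraMap (XBSeries n) (XBFrac n) (hlSum (plX Function.Embedding.inl)
      (miX Function.Embedding.inl) (schurMon q n lam) Finset.univ) := by
  set a := algebraMap (XBSeries n) (XBFrac n) with ha
  have hinj : Function.Injective a := IsFractionRing.injective _ _
  let pl : Fin n → Fin n → XBFrac n := fun k l => a (plX Function.Embedding.inl k l)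
  let mi : Fin n → Fin n → XBFrac n := fun k l => a (miX Function.Embedding.inl k l)
  have hmi : ∀ k l, k ≠ l → mi k l ≠ 0 := fun k l hkl =>
    (map_ne_zero_iff a hinj).mpr (prime_miX hkl).ne_zero
  have hfac : ((n - lam.length).factorial : XBFrac n) ≠ 0 := by
    have h1 : ((n - lam.length).factorial : XBSeries n) ≠ 0 := fun h0 => by
      have := congrArg (constantCoeff (σ := Fin n ⊕ ℕ) (R := Lazard)) h0
      rw [map_natCast, map_zero, Nat.cast_eq_zero] at this
      exact Nat.factorial_ne_zero _ this
    rw [← map_natCast a]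
    exact (map_ne_zero_iff a hinj).mpr h1
  have hterm : ∀ w : Equiv.Perm (Fin n),
      offDiagProd mi Finset.univ * (a (∏ i : Fin n, factMon q (xVar (w i)) (lam.part i)) *
        ∏ i : Fin n with i.val < lam.length, ∏ j ∈ Finset.Ioi i,
          fgRatio (xVar (w i)) (xVar (w j))) =
      (∏ i, a (schurMon q n lam i (permToEmb h w i))) *
        offDiagProd (hlFactor pl mi (permToEmb h w)) Finset.univ := by
    intro w
    rw [mul_left_comm]
    congr 1
    -- The factors with index i ≥ r are powers with exponent 0, that is 1.
    · rw [map_prod]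
      symm
      refine Finset.prod_of_injOn (Fin.castLE h) ((Fin.castLE_injective h).injOn)
        (by simp [Set.MapsTo]) ?_ fun i _ => rfl
      intro i _ hi
      have : lam.length ≤ i.val := by
        by_contra! hlt
        exact hi ⟨⟨i, hlt⟩, by simp, rfl⟩
      rw [lam.part_eq_zero this, factMon_zero, map_one]
    · rw [← offDiagProd_mul_prod_ratio pl mi hmi h w]
      congr 1
      refine Finset.prod_congr rfl fun i _ => Finset.prod_congr rfl fun j _ => ?_
      rw [fgRatio, Ring.inverse_eq_inv']
      rfl
  rw [hallLittlewoodSum, map_offDiagProd, mul_left_comm, Finset.mul_sum,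
    Finset.sum_congr rfl fun w _ => hterm w,
    sum_permToEmb h fun e => (∏ i, a (schurMon q n lam i (e i))) *
      offDiagProd (hlFactor pl mi e) Finset.univ,
    ← mul_assoc, Ring.inverse_mul_cancel _ hfac.isUnit, one_mul, map_hlSum, hlSum]
  simp only [Finset.mem_univ, implies_true, Finset.filter_true]
  rfl

theorem schur_eq (q : Bool) {lam : StrictPartition} (h : lam.length ≤ n) :
    schur q n lam = toSeries (hallLittlewoodSum n (factMon q) lam) := by
  cases q
  · exact if_pos h
  · exact if_pos h

theorem algebraMap_schur_and_isHL (q : Bool) {lam : StrictPartition} (h : lam.length ≤ n) :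
    algebraMap (XBSeries n) (XBFrac n) (schur q n lam) = hallLittlewoodSum n (factMon q) lam ∧
      IsHL Function.Embedding.inl (schurMon q n lam) Finset.univ (schur q n lam) := by
  have hinj : Function.Injective (algebraMap (XBSeries n) (XBFrac n)) :=
    IsFractionRing.injective _ _
  obtain ⟨f, hf⟩ := exists_isHL (isEquivariant_schurMon (n := n) q lam)
  have h1 : hallLittlewoodSum n (factMon q) lam = algebraMap (XBSeries n) (XBFrac n) f := by
    have h2 := algebraMap_mul_hallLittlewoodSum (n := n) q h
    rw [← hf, map_mul] at h2
    exact mul_left_cancel₀ ((map_ne_zero_iff _ hinj).mpr (offDiagProd_miX_ne_zero _)) h2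
  have h2 : schur q n lam = f := by
    rw [schur_eq q h, h1]
    exact Function.leftInverse_invFun hinj f
  rw [h1, h2]
  exact ⟨rfl, hf⟩

theorem isHL_schur (q : Bool) (n : ℕ) (lam : StrictPartition) :
    IsHL Function.Embedding.inl (schurMon q n lam) Finset.univ (schur q n lam) := by
  by_cases h : lam.length ≤ n
  · exact (algebraMap_schur_and_isHL q h).2
  · have : schur q n lam = 0 := by
      cases q
      · exact if_neg h
      · exact if_neg h
    rw [this]
    exact isHL_zero_of_card_lt (by simpa using h)

theorem size_le_order_schur (q : Bool) (n : ℕ) (lam : StrictPartition) :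
    (lam.size : ℕ∞) ≤ (schur q n lam).order := by
  rw [← lam.sum_part]
  exact (isHL_schur q n lam).le_order fun i k => le_order_factMon (constantCoeff_X' _) _

end Schur

/-! ### Specialisation of the last variables -/

section Spec

variable {n : ℕ}

theorem isCoeffMap_specLast (n : ℕ) : IsCoeffMap (specLast n) := isCoeffMap_killCompl _

theorem specLast_X_castSucc (k : Fin n) :
    specLast n (X (Sum.inl k.castSucc)) = X (Sum.inl k) :=
  MvPowerSeries.killCompl_X (R := Lazard)
    (e := Function.Embedding.sumMap Fin.castSuccEmb (Function.Embedding.refl ℕ)) (Sum.inl k)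

theorem specLast_bVar (l : ℕ) : specLast n (bVar (n + 1) l) = bVar n l :=
  MvPowerSeries.killCompl_X (R := Lazard)
    (e := Function.Embedding.sumMap Fin.castSuccEmb (Function.Embedding.refl ℕ)) (Sum.inr l)

theorem specLast_zeroOut {s : Set (Fin (n + 1) ⊕ ℕ)}
    (hs : s ⊆ {Sum.inl (Fin.last n)}) (f : XBSeries (n + 1)) :
    specLast n (zeroOut s f) = specLast n f := by
  refine killCompl_zeroOut (fun k hk => ?_) f
  have := hs hk
  rcases k with k | k
  · exact (Fin.castSucc_lt_last k).ne (Sum.inl_injective this)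
  · cases this

/-- [[x|b]]^k with k > 0 is divisible by x ⊕ x, so `IsHL.single` removes the last variable. -/
theorem specLast_schurQ (n : ℕ) (lam : StrictPartition) :
    specLast n (schurQ (n + 1) lam) = schurQ n lam := by
  have hB : insert (Fin.last n) (Finset.univ.map Fin.castSuccEmb) = Finset.univ := by
    rw [Fin.univ_castSuccEmb n, Finset.cons_eq_insert]
  have hlast : Fin.last n ∉ Finset.univ.map Fin.castSuccEmb := by simp [Fin.castSucc_ne_last]
  have h := isHL_schur true (n + 1) lam
  rw [← hB] at h
  have hM : ∀ a, ∀ k ∈ Finset.univ.map Fin.castSuccEmb, zeroOut {Function.Embedding.inl (Fin.last n)} (schurMon true (n + 1) lam a k) =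
      schurMon true (n + 1) lam a k := by
    intro a k hk
    refine ((isCoeffMap_zeroOut _).map_factMon (fun l => ?_) true (constantCoeff_X' _) _).trans ?_
    · exact zeroOut_X_of_notMem (by simp)
    · rw [zeroOut_X_of_notMem]
      · rfl
      · intro hk'
        exact hlast (by rwa [← Sum.inl_injective (Set.mem_singleton_iff.mp hk')])
  obtain ⟨h1, -⟩ := h.single (q := true) hlast (fun a => psi_dvd_factMon _ (lam.part_pos a)) hM
  have h2 := h1.map (ι' := Function.Embedding.inl) rfl (isCoeffMap_specLast n)
    specLast_X_castSucc
  rw [specLast_zeroOut (by rfl)] at h2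
  refine h2.unique (g := schur true n lam) ?_
  convert isHL_schur true n lam using 1
  funext i k
  refine ((isCoeffMap_specLast n).map_factMon specLast_bVar true (constantCoeff_X' _) _).trans ?_
  change factMon true (specLast n (X (Sum.inl k.castSucc))) _ = _
  rw [specLast_X_castSucc]
  rfl

/-- [x|b]^k does not vanish at x = 0, so one variable alone cannot be dropped. Two variables equal
to zero are opposite, and `IsHL.pair` drops both; hence the role of parity in P⁺. -/
theorem specLast_specLast_schurP (n : ℕ) (lam : StrictPartition) :
    specLast n (specLast (n + 1) (schurP (n + 2) lam)) = schurP n lam := by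
  let i : Fin (n + 2) := (Fin.last n).castSucc
  let j : Fin (n + 2) := Fin.last (n + 1)
  let c : Fin n ↪ Fin (n + 2) := Fin.castSuccEmb.trans Fin.castSuccEmb
  have hci : ∀ k, c k ≠ i := fun k h =>
    (Fin.castSucc_lt_last k).ne (Fin.castSucc_injective _ h)
  have hcj : ∀ k, c k ≠ j := fun k => (Fin.castSucc_lt_last _).ne
  have hB : insert i (insert j (Finset.univ.map c)) = Finset.univ := by
    ext k
    simp only [Finset.mem_insert, Finset.mem_map, Finset.mem_univ, true_and, iff_true]
    refine Fin.lastCases (Or.inr (Or.inl rfl)) (fun k => ?_) k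
    refine Fin.lastCases (Or.inl rfl) (fun k => Or.inr (Or.inr ⟨k, rfl⟩)) k
  have hi : i ∉ Finset.univ.map c := by simpa using hci
  have hj : j ∉ Finset.univ.map c := by simpa using hcj
  have hij : i ≠ j := (Fin.castSucc_lt_last _).ne
  have hh : IsCoeffMap ((specLast n).comp (specLast (n + 1))) :=
    (isCoeffMap_specLast n).comp (isCoeffMap_specLast (n + 1))
  have hX : ∀ k, ((specLast n).comp (specLast (n + 1))) (X (Sum.inl (c k))) = X (Sum.inl k) :=
    fun k => by
      rw [AlgHom.comp_apply]
      change specLast n (specLast (n + 1) (X (Sum.inl k.castSucc.castSucc))) = _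
      rw [specLast_X_castSucc, specLast_X_castSucc]
  have h := isHL_schur false (n + 2) lam
  rw [← hB] at h
  have hM : ∀ a, ∀ k ∈ Finset.univ.map c, zeroOut {Function.Embedding.inl i, Function.Embedding.inl j} (schurMon false (n + 2) lam a k) =
      schurMon false (n + 2) lam a k := by
    intro a k hk
    refine ((isCoeffMap_zeroOut _).map_factMon (fun l => ?_) false (constantCoeff_X' _) _).trans ?_
    · exact zeroOut_X_of_notMem (by simp)
    · rw [zeroOut_X_of_notMem]
      · rfl
      · rintro (hk' | hk')
        · exact hi (by rwa [← Sum.inl_injective hk'])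
        · exact hj (by rwa [← Sum.inl_injective hk'])
  obtain ⟨h1, -⟩ := h.pair hij hi hj hM
  have h2 := h1.map (ι' := Function.Embedding.inl) rfl hh hX
  have h3 : ((specLast n).comp (specLast (n + 1))) (zeroOut {Function.Embedding.inl i,
      Function.Embedding.inl j} (schur false (n + 2) lam)) =
      specLast n (specLast (n + 1) (schurP (n + 2) lam)) := by
    -- Both specialisations together kill exactly x_i and x_j, so it makes no difference to put
    -- these variables to zero beforehand.
    have e : (specLast n).comp (specLast (n + 1)) = killCompl (R := Lazard)
        (Function.Embedding.sumMap c (Function.Embedding.refl ℕ)) := by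
      refine hh.ext (isCoeffMap_killCompl _) ?_
      rintro (k | k)
      · by_cases hk : k ∈ Finset.univ.map c
        · obtain ⟨k, -, rfl⟩ := Finset.mem_map.mp hk
          rw [hX]
          exact (MvPowerSeries.killCompl_X (R := Lazard)
            (e := Function.Embedding.sumMap c (Function.Embedding.refl ℕ)) (Sum.inl k)).symm
        · rw [MvPowerSeries.killCompl_X_eq_zero]
          · have hk' : k = j ∨ k = i := by
              have := hB ▸ Finset.mem_univ k
              simp only [Finset.mem_insert, hk, or_false] at this
              exact this.symm
            rw [AlgHom.comp_apply]
            have hlast : ∀ m, specLast m (X (Sum.inl (Fin.last m))) = 0 := fun m =>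
              MvPowerSeries.killCompl_X_eq_zero (by
                rintro ⟨k | k, hk⟩
                · exact (Fin.castSucc_lt_last k).ne (Sum.inl_injective hk)
                · cases hk)
            rcases hk' with rfl | rfl
            · rw [hlast, map_zero]
            · rw [specLast_X_castSucc, hlast]
          · rintro ⟨l | l, hl⟩
            · exact hk (Finset.mem_map.mpr ⟨l, Finset.mem_univ _, Sum.inl_injective hl⟩)
            · cases hl
      · rw [AlgHom.comp_apply]
        refine (congrArg (specLast n) (specLast_bVar k)).trans ((specLast_bVar k).trans ?_)
        exact (MvPowerSeries.killCompl_X (R := Lazard)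
            (e := Function.Embedding.sumMap c (Function.Embedding.refl ℕ)) (Sum.inr k)).symm
    rw [e, killCompl_zeroOut, ← e]
    · rfl
    · rintro (k | k) (hk | hk)
      · exact hci k (Sum.inl_injective hk)
      · exact hcj k (Sum.inl_injective hk)
      · cases hk
      · cases hk
  rw [h3] at h2
  refine h2.unique (g := schur false n lam) ?_
  convert isHL_schur false n lam using 1
  funext a k
  refine (hh.map_factMon (fun l => ?_) false (constantCoeff_X' _) _).trans ?_
  · rw [AlgHom.comp_apply, specLast_bVar, specLast_bVar]
  · rw [hX]
    rfl

end Spec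

/-! ### The nonequivariant functions -/

section NonEquivariant

variable {n : ℕ}

/-- Setting all `b_k` to zero. -/
def killB (n : ℕ) : XBSeries n →ₐ[Lazard] XSeries n := killCompl (R := Lazard) Function.Embedding.inl

theorem isCoeffMap_killB (n : ℕ) : IsCoeffMap (killB n) := isCoeffMap_killCompl _

theorem killB_X (k : Fin n) : killB n (X (Sum.inl k)) = X k :=
  MvPowerSeries.killCompl_X (R := Lazard) (e := Function.Embedding.inl) k

theorem killB_bVar (l : ℕ) : killB n (bVar n l) = 0 :=
  MvPowerSeries.killCompl_X_eq_zero (by rintro ⟨k, hk⟩; cases hk)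

theorem bCoeff_zero_eq_killB (f : XBSeries n) : bCoeff 0 f = killB n f := by
  refine MvPowerSeries.ext fun α => ?_
  rw [coeff_bCoeff, killB, MvPowerSeries.coeff_killCompl]
  congr 2
  ext (k | k)
  · exact (Finsupp.embDomain_apply_self (Function.Embedding.inl : Fin n ↪ Fin n ⊕ ℕ) α k).symm
  · rw [Finsupp.embDomain_of_notMem_range]
    · rfl
    · rintro ⟨k, hk⟩; cases hk

/-- The factors of the monomials in `Q_λ(x_n)` or `P_λ(x_n)`. -/
def schurMonX (q : Bool) (n : ℕ) (lam : StrictPartition) (i : Fin lam.length) (k : Fin n) :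
    XSeries n := psi q (X k) * X k ^ (lam.part i - 1)

/-- The function `Q_λ(x_n)` or `P_λ(x_n)`. -/
def schurX (q : Bool) (n : ℕ) (lam : StrictPartition) : XSeries n := killB n (schur q n lam)

theorem isHL_schurX (q : Bool) (n : ℕ) (lam : StrictPartition) :
    IsHL (Function.Embedding.refl _) (schurMonX q n lam) Finset.univ (schurX q n lam) := by
  have h := (isHL_schur q n lam).map (j := Function.Embedding.refl _) (B := Finset.univ)
    (ι' := Function.Embedding.refl _) Finset.map_refl (isCoeffMap_killB n) (fun k => killB_X k)
  convert h using 1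
  swap
  · rfl
  funext i k
  refine (((isCoeffMap_killB n).map_factMon_zero killB_bVar q (constantCoeff_X' _)
    (lam.part_pos i)).trans ?_).symm
  change psi q (killB n (X (Sum.inl k))) * (killB n (X (Sum.inl k))) ^ _ = _
  rw [killB_X]
  rfl

theorem size_le_order_schurX (q : Bool) (n : ℕ) (lam : StrictPartition) :
    (lam.size : ℕ∞) ≤ (schurX q n lam).order :=
  (size_le_order_schur q n lam).trans ((isCoeffMap_killB n).le_order _)

/-- The specialisation `x_{n+1} = 0`. -/
def specX (n : ℕ) : XSeries (n + 1) →ₐ[Lazard] XSeries n := killCompl (R := Lazard) Fin.castSuccEmb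

theorem isCoeffMap_specX (n : ℕ) : IsCoeffMap (specX n) := isCoeffMap_killCompl _

theorem specX_X_castSucc (k : Fin n) : specX n (X k.castSucc) = X k :=
  MvPowerSeries.killCompl_X (R := Lazard) (e := Fin.castSuccEmb) k

theorem specX_X_last : specX n (X (Fin.last n)) = 0 :=
  MvPowerSeries.killCompl_X_eq_zero (by
    rintro ⟨k, hk⟩
    exact (Fin.castSucc_lt_last k).ne hk)

/-- At b = 0 the monomials are divisible by ψ(x) for P as well as for Q, so a single variable can be
dropped in both cases. -/
theorem specX_schurX (q : Bool) (n : ℕ) (lam : StrictPartition) :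
    specX n (schurX q (n + 1) lam) = schurX q n lam := by
  have hB : insert (Fin.last n) (Finset.univ.map Fin.castSuccEmb) = Finset.univ := by
    rw [Fin.univ_castSuccEmb n, Finset.cons_eq_insert]
  have hlast : Fin.last n ∉ Finset.univ.map Fin.castSuccEmb := by simp [Fin.castSucc_ne_last]
  have h := isHL_schurX q (n + 1) lam
  rw [← hB] at h
  have hM : ∀ a, ∀ k ∈ Finset.univ.map Fin.castSuccEmb, zeroOut {Function.Embedding.refl _ (Fin.last n)} (schurMonX q (n + 1) lam a k) =
      schurMonX q (n + 1) lam a k := by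
    intro a k hk
    have hk' : k ∉ ({Function.Embedding.refl _ (Fin.last n)} : Set (Fin (n + 1))) := fun h =>
      hlast (by rwa [← (Set.mem_singleton_iff.mp h : k = Fin.last n)])
    rw [schurMonX, map_mul, (isCoeffMap_zeroOut _).map_psi (constantCoeff_X' _), map_pow,
      zeroOut_X_of_notMem hk']
  obtain ⟨h1, -⟩ := h.single (q := q) hlast (fun a => Dvd.intro _ rfl) hM
  have h2 := h1.map (ι' := Function.Embedding.refl _) rfl (isCoeffMap_specX n)
    specX_X_castSucc
  have h3 : specX n (zeroOut {Function.Embedding.refl _ (Fin.last n)} (schurX q (n + 1) lam)) =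
      specX n (schurX q (n + 1) lam) :=
    killCompl_zeroOut (fun k => (Fin.castSucc_lt_last k).ne) _
  rw [h3] at h2
  refine h2.unique ?_
  convert isHL_schurX q n lam using 1
  funext i k
  change specX n (psi q (X k.castSucc) * X k.castSucc ^ _) = psi q (X k) * X k ^ _
  rw [map_mul, (isCoeffMap_specX n).map_psi (constantCoeff_X' _), map_pow, specX_X_castSucc]

theorem killB_specLast (n : ℕ) (f : XBSeries (n + 1)) :
    killB n (specLast n f) = specX n (killB (n + 1) f) := by
  have := ((isCoeffMap_killB n).comp (isCoeffMap_specLast n)).ext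
    ((isCoeffMap_specX n).comp (isCoeffMap_killB (n + 1))) ?_
  · exact DFunLike.congr_fun this f
  · rintro (k | k)
    · rw [AlgHom.comp_apply, AlgHom.comp_apply, killB_X]
      refine Fin.lastCases ?_ (fun k => ?_) k
      · rw [specX_X_last]
        refine (congrArg (killB n) (MvPowerSeries.killCompl_X_eq_zero ?_)).trans (map_zero _)
        rintro ⟨k | k, hk⟩
        · exact (Fin.castSucc_lt_last k).ne (Sum.inl_injective hk)
        · cases hk
      · rw [specLast_X_castSucc, specX_X_castSucc, killB_X]
    · rw [AlgHom.comp_apply, AlgHom.comp_apply]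
      exact ((congrArg (killB n) (specLast_bVar k)).trans (killB_bVar k)).trans
        ((congrArg (specX n) (killB_bVar k)).trans (map_zero _)).symm

end NonEquivariant

/-! ### The supersymmetry conditions as divisibilities -/

section Gamma

variable {n : ℕ} {q : Bool}

theorem subst_zeroVars (s : Finset (Fin n)) (f : XSeries n) :
    f.subst (zeroVars s) = zeroOut (s : Set (Fin n)) f := by
  have e : (fun k => zeroOut (s : Set (Fin n)) (X k : XSeries n)) = zeroVars s := by
    funext k
    rw [zeroVars]
    split_ifs with hk
    · exact zeroOut_X_of_mem hk
    · exact zeroOut_X_of_notMem hk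
  have h := (isCoeffMap_zeroOut (s : Set (Fin n))).map_subst HasSubst.X
    (by rw [e]; exact hasSubst_zeroVars s) f
  rw [MvPowerSeries.subst_self, e] at h
  exact h.symm

theorem pairVars_eq_update {i j : Fin n} (h : i ≠ j) :
    pairVars i j = Function.update (X : Fin n → XSeries n) j (fneg (X i)) := by
  funext k
  rw [pairVars]
  by_cases hj : k = j
  · subst hj
    rw [if_neg h.symm, if_pos rfl, Function.update_self]
  · rw [Function.update_of_ne hj, if_neg hj]
    split_ifs with hi
    · rw [hi]
    · rfl

/-- The factor theorem for x_j = χ(x_i): up to a unit x_j - χ(x_i) is x_i ⊕ x_j. In the converse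
direction the series with both variables put to zero is unaffected by the substitution. -/
theorem subst_pairVars_eq_iff {i j : Fin n} (h : i ≠ j) (f : XSeries n) :
    f.subst (pairVars i j) = f.subst (zeroVars {i, j}) ↔
      fadd (X i) (X j) ∣ f - zeroOut {i, j} f := by
  have hz : f.subst (zeroVars {i, j}) = zeroOut {i, j} f := by
    rw [subst_zeroVars]
    simp
  have hp : Associated (X j - fneg (X i) : XSeries n) (fadd (X i) (X j)) := by
    rw [fadd_comm (constantCoeff_X' _) (constantCoeff_X' _)]
    exact associated_fadd (constantCoeff_X' _) (constantCoeff_X' _)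
  have hfree : FreeOf j (fneg (X i) : XSeries n) := (freeOf_X h).fneg
  constructor
  · intro h1
    have h2 := X_sub_dvd_sub_subst hfree f
    rw [← pairVars_eq_update h, h1, hz] at h2
    exact hp.symm.dvd.trans h2
  · intro h1
    obtain ⟨g, hg⟩ := hp.dvd.trans h1
    have hs := hasSubst_pairVars i j
    have h2 := congrArg (MvPowerSeries.subst (pairVars i j)) hg
    have h3 : (X j - fneg (X i) : XSeries n).subst (pairVars i j) = 0 := by
      rw [MvPowerSeries.subst_sub hs, subst_fneg hs (constantCoeff_X' _),
        MvPowerSeries.subst_X hs, MvPowerSeries.subst_X hs, pairVars, if_neg h.symm, if_pos rfl,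
        pairVars, if_pos rfl, sub_self]
    rw [MvPowerSeries.subst_mul hs, h3, zero_mul, MvPowerSeries.subst_sub hs, sub_eq_zero, ← hz,
      MvPowerSeries.subst_comp_subst_apply (hasSubst_zeroVars _) hs] at h2
    rw [h2]
    congr 1
    funext k
    rw [zeroVars]
    split_ifs with hk
    · rw [← MvPowerSeries.coe_substAlgHom hs, map_zero]
    · simp only [Finset.mem_insert, Finset.mem_singleton, not_or] at hk
      rw [MvPowerSeries.subst_X hs, pairVars, if_neg hk.1, if_neg hk.2]

/-- The ring `Γ_+(x_n)` or `Γ(x_n)`. -/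
def gamOf (q : Bool) (n : ℕ) : Subalgebra Lazard (XSeries n) := if q then GamPlus n else Gam n

/-- For P the last condition is automatic, since x_i always divides the difference; it is included
so that Γ and Γ_+ have the same description by ψ. -/
theorem mem_gamOf {f : XSeries n} : f ∈ gamOf q n ↔
    (∀ w : Equiv.Perm (Fin n), renameEquiv Lazard w f = f) ∧
    (∀ i j : Fin n, i ≠ j → fadd (X i) (X j) ∣ f - zeroOut {i, j} f) ∧
    ∀ i : Fin n, psi q (X i) ∣ f - zeroOut {i} f := by
  have h1 : f ∈ Gam n ↔ (∀ w : Equiv.Perm (Fin n), renameEquiv Lazard w f = f) ∧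
      (∀ i j : Fin n, i ≠ j → fadd (X i) (X j) ∣ f - zeroOut {i, j} f) :=
    and_congr Iff.rfl (forall₃_congr fun i j hij => subst_pairVars_eq_iff hij f)
  cases q
  · refine h1.trans ?_
    have : ∀ i : Fin n, psi false (X i) ∣ f - zeroOut {i} f := fun i => X_dvd_sub_zeroOut i f
    tauto
  · refine (and_congr h1 (forall_congr' fun i => ?_)).trans and_assoc
    rw [subst_zeroVars, Finset.coe_singleton]
    rfl

/-! ### Closedness -/

/-- In finitely many variables, agreement in all degrees below k is an open condition. A limit of
multiples of p is thus a multiple up to any order, and `dvd_of_forall_le_order` concludes. -/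
theorem isClosed_dvd {p : XSeries n} (hp : p ≠ 0) : IsClosed {f : XSeries n | p ∣ f} := by
  rw [← closure_subset_iff_isClosed]
  intro f hf
  refine dvd_of_forall_le_order hp fun k => ?_
  have hfin : {d : Fin n →₀ ℕ | d.degree < k}.Finite := by
    have := Finsupp.finite_of_degree_le (σ := Fin n) k
    exact this.subset fun d (hd : d.degree < k) => hd.le
  have hopen : IsOpen (⋂ d ∈ {d : Fin n →₀ ℕ | d.degree < k},
      {g : XSeries n | coeff d g = coeff d f}) := by
    refine hfin.isOpen_biInter fun d _ => ?_
    exact (isOpen_discrete {coeff d f}).preimage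
      (MvPowerSeries.WithPiTopology.continuous_coeff Lazard d)
  obtain ⟨g, hg, ⟨h, rfl⟩⟩ := mem_closure_iff.mp hf _ hopen (by simp)
  refine ⟨h, MvPowerSeries.nat_le_order fun d hd => ?_⟩
  simp only [Set.mem_ofPred_eq, Set.mem_iInter] at hg
  rw [map_sub, hg d hd, sub_self]

theorem isClosed_gamOf (q : Bool) (n : ℕ) : IsClosed (gamOf q n : Set (XSeries n)) := by
  have h1 : (gamOf q n : Set (XSeries n)) =
      (⋂ w : Equiv.Perm (Fin n), {f | renameEquiv Lazard w f = f}) ∩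
      ((⋂ (i : Fin n) (j : Fin n) (_ : i ≠ j), {f | fadd (X i) (X j) ∣ f - zeroOut {i, j} f}) ∩
      ⋂ i : Fin n, {f | psi q (X i) ∣ f - zeroOut {i} f}) := by
    ext f
    simp only [SetLike.mem_coe, mem_gamOf, Set.mem_inter_iff, Set.mem_iInter, Set.mem_ofPred_eq]
  rw [h1]
  refine (isClosed_iInter fun w => ?_).inter ((isClosed_iInter fun i => isClosed_iInter fun j =>
    isClosed_iInter fun hij => ?_).inter (isClosed_iInter fun i => ?_))
  · exact isClosed_eq (isCoeffMap_renameEquiv w).continuous continuous_id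
  · exact (isClosed_dvd (prime_fadd_X hij).ne_zero).preimage
      (continuous_id.sub (isCoeffMap_zeroOut _).continuous)
  · exact (isClosed_dvd (psi_X_ne_zero i)).preimage
      (continuous_id.sub (isCoeffMap_zeroOut _).continuous)

theorem continuous_bCoeff (β : ℕ →₀ ℕ) : Continuous (bCoeff β : XBSeries n → XSeries n) :=
  continuous_pi fun α => MvPowerSeries.WithPiTopology.continuous_coeff Lazard (α.sumElim β)

theorem isClosed_bExtend {G : Subalgebra Lazard (XSeries n)} (hG : IsClosed (G : Set (XSeries n))) :
    IsClosed (bExtend G : Set (XBSeries n)) := by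
  have : (bExtend G : Set (XBSeries n)) = ⋂ β, bCoeff β ⁻¹' G := by
    ext f
    simp only [Set.mem_iInter]
    rfl
  rw [this]
  exact isClosed_iInter fun β => hG.preimage (continuous_bCoeff β)

/-! ### Membership of the universal factorial functions -/

theorem sumElim_zero_eq (α : Fin n →₀ ℕ) : α.sumElim (0 : ℕ →₀ ℕ) =
    Finsupp.embDomain (Function.Embedding.inl : Fin n ↪ Fin n ⊕ ℕ) α := by
  ext (k | k)
  · exact (Finsupp.embDomain_apply_self (Function.Embedding.inl : Fin n ↪ Fin n ⊕ ℕ) α k).symm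
  · rw [Finsupp.embDomain_of_notMem_range]
    · rfl
    · rintro ⟨k, hk⟩; cases hk

theorem bCoeff_rename (β : ℕ →₀ ℕ) (p : XSeries n) :
    bCoeff β (rename (Function.Embedding.inl : Fin n ↪ Fin n ⊕ ℕ) p) = if β = 0 then p else 0 := by
  refine MvPowerSeries.ext fun α => ?_
  rw [coeff_bCoeff]
  split_ifs with h
  · rw [h, sumElim_zero_eq, MvPowerSeries.coeff_embDomain_rename]
  · rw [map_zero]
    refine MvPowerSeries.coeff_rename_eq_zero _ _ ?_
    rintro ⟨γ, hγ⟩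
    apply h
    ext k
    have := DFunLike.congr_fun hγ (Sum.inr k)
    rw [Finsupp.mapDomain_of_notMem_range] at this
    · exact this.symm
    · rintro ⟨k, hk⟩; cases hk

theorem bCoeff_rename_mul (β : ℕ →₀ ℕ) (p : XSeries n) (g : XBSeries n) :
    bCoeff β (rename (Function.Embedding.inl : Fin n ↪ Fin n ⊕ ℕ) p * g) = p * bCoeff β g := by
  rw [bCoeff_mul, Finset.sum_eq_single (0, β)]
  · rw [bCoeff_rename, if_pos rfl]
  · rintro ⟨a, b⟩ hab hne
    rw [bCoeff_rename, if_neg, zero_mul]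
    rintro rfl
    rw [Finset.HasAntidiagonal.mem_antidiagonal, zero_add] at hab
    exact hne (by rw [← hab])
  · intro h
    exact absurd (Finset.HasAntidiagonal.mem_antidiagonal.mpr (zero_add β)) h

theorem bCoeff_sub (β : ℕ →₀ ℕ) (f g : XBSeries n) :
    bCoeff β (f - g) = bCoeff β f - bCoeff β g :=
  MvPowerSeries.ext fun α => by simp [coeff_bCoeff]

theorem bCoeff_zeroOut (β : ℕ →₀ ℕ) (s : Set (Fin n)) (f : XBSeries n) :
    bCoeff β (zeroOut (Sum.inl '' s) f) = zeroOut s (bCoeff β f) := by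
  classical
  refine MvPowerSeries.ext fun α => ?_
  rw [coeff_bCoeff, coeff_zeroOut, coeff_zeroOut, coeff_bCoeff]
  have h : (∀ k ∈ Sum.inl '' s, (α.sumElim β) k = 0) ↔ ∀ k ∈ s, α k = 0 := by simp
  by_cases hs : ∀ k ∈ s, α k = 0
  · rw [if_pos (h.mpr hs), if_pos hs]
  · rw [if_neg (fun h' => hs (h.mp h')), if_neg hs]

theorem bCoeff_renameEquiv (β : ℕ →₀ ℕ) (w : Equiv.Perm (Fin n)) (f : XBSeries n) :
    bCoeff β (renameEquiv Lazard (w.viaEmbedding Function.Embedding.inl) f) =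
      renameEquiv Lazard w (bCoeff β f) := by
  refine MvPowerSeries.ext fun α => ?_
  obtain ⟨α, rfl⟩ : ∃ α', α = Finsupp.embDomain w.toEmbedding α' :=
    ⟨Finsupp.equivMapDomain w.symm α, by
      rw [Finsupp.embDomain_eq_mapDomain, Finsupp.equivMapDomain_eq_mapDomain]
      change α = Finsupp.mapDomain w (Finsupp.mapDomain w.symm α)
      rw [← Finsupp.mapDomain_comp, Equiv.self_comp_symm, Finsupp.mapDomain_id]⟩
  have h1 : (Finsupp.embDomain w.toEmbedding α).sumElim β = Finsupp.embDomain
      (w.viaEmbedding (Function.Embedding.inl : Fin n ↪ Fin n ⊕ ℕ)).toEmbedding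
      (α.sumElim β) := by
    ext k
    obtain ⟨k, rfl⟩ := (w.viaEmbedding (Function.Embedding.inl : Fin n ↪ Fin n ⊕ ℕ)).surjective k
    refine Eq.trans ?_ (Finsupp.embDomain_apply_self (w.viaEmbedding
      (Function.Embedding.inl : Fin n ↪ Fin n ⊕ ℕ)).toEmbedding _ k).symm
    rcases k with k | k
    · have := Equiv.Perm.viaEmbedding_apply w (Function.Embedding.inl : Fin n ↪ Fin n ⊕ ℕ) k
      rw [show (Sum.inl k : Fin n ⊕ ℕ) = Function.Embedding.inl k from rfl, this]
      exact Finsupp.embDomain_apply_self w.toEmbedding α k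
    · rw [Equiv.Perm.viaEmbedding_apply_of_notMem]
      · rfl
      · rintro ⟨k, hk⟩; cases hk
  rw [coeff_bCoeff, h1, renameEquiv_eq_rename, renameEquiv_eq_rename]
  refine (MvPowerSeries.coeff_embDomain_rename (w.viaEmbedding
      (Function.Embedding.inl : Fin n ↪ Fin n ⊕ ℕ)).toEmbedding f _).trans ?_
  exact (MvPowerSeries.coeff_embDomain_rename w.toEmbedding (bCoeff β f) α).symm

/-- The divisors x_i ⊕ x_j and ψ(x_i) are free of b, so the divisibilities pass to the coefficient
of each b^β. -/
theorem mem_bExtend_gamOf {f : XBSeries n}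
    (h1 : ∀ w : Equiv.Perm (Fin n),
      renameEquiv Lazard (w.viaEmbedding Function.Embedding.inl) f = f)
    (h2 : ∀ i j : Fin n, i ≠ j →
      fadd (X (Sum.inl i)) (X (Sum.inl j)) ∣ f - zeroOut {Sum.inl i, Sum.inl j} f)
    (h3 : ∀ i : Fin n, psi q (X (Sum.inl i)) ∣ f - zeroOut {Sum.inl i} f) :
    f ∈ bExtend (gamOf q n) := by
  have hr := isCoeffMap_rename (Function.Embedding.inl : Fin n ↪ Fin n ⊕ ℕ)
  have hrX : ∀ i : Fin n, rename (R := Lazard) (Function.Embedding.inl : Fin n ↪ Fin n ⊕ ℕ)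
      (X i) = X (Sum.inl i) := fun i => MvPowerSeries.rename_X _ i
  have key : ∀ (β : ℕ →₀ ℕ) (p : XSeries n) (s : Set (Fin n)),
      rename (Function.Embedding.inl : Fin n ↪ Fin n ⊕ ℕ) p ∣ f - zeroOut (Sum.inl '' s) f →
      p ∣ bCoeff β f - zeroOut s (bCoeff β f) := by
    rintro β p s ⟨g, hg⟩
    rw [← bCoeff_zeroOut, ← bCoeff_sub, hg, bCoeff_rename_mul]
    exact dvd_mul_right _ _
  intro β
  refine mem_gamOf.mpr ⟨fun w => ?_, fun i j hij => key β _ _ ?_, fun i => key β _ _ ?_⟩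
  · rw [← bCoeff_renameEquiv, h1]
  · rw [hr.map_fadd (constantCoeff_X' _) (constantCoeff_X' _), hrX, hrX, Set.image_pair]
    exact h2 i j hij
  · rw [hr.map_psi (constantCoeff_X' _), hrX, Set.image_singleton]
    exact h3 i

theorem schur_mem (q : Bool) (n : ℕ) (lam : StrictPartition) :
    schur q n lam ∈ bExtend (gamOf q n) := by
  have h := isHL_schur q n lam
  have hz : ∀ (s : Set (Fin n)) a k, k ∉ s →
      zeroOut (Sum.inl '' s) (schurMon q n lam a k) = schurMon q n lam a k := by
    intro s a k hk
    refine ((isCoeffMap_zeroOut _).map_factMon (fun l => ?_) q (constantCoeff_X' _) _).trans ?_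
    · exact zeroOut_X_of_notMem (by simp)
    · rw [zeroOut_X_of_notMem]
      · rfl
      · simpa using hk
  refine mem_bExtend_gamOf (h.renameEquiv_eq (isEquivariant_schurMon q lam)) (fun i j hij => ?_)
    fun i => ?_
  · have hA : insert i (insert j (Finset.univ \ {i, j})) = (Finset.univ : Finset (Fin n)) := by
      ext k; simp; tauto
    rw [← hA] at h
    refine (h.pair hij (by simp) (by simp) fun a k hk => ?_).2
    have := hz {i, j} a k (by simpa using hk)
    rwa [Set.image_pair] at this
  · cases q
    · exact X_dvd_sub_zeroOut _ _
    · have hA : insert i (Finset.univ \ {i}) = (Finset.univ : Finset (Fin n)) := by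
        ext k; simp
      rw [← hA] at h
      refine (h.single (by simp) (fun a => psi_dvd_factMon _ (lam.part_pos a))
        fun a k hk => ?_).2
      have := hz {i} a k (by simpa using hk)
      rwa [Set.image_singleton] at this

/-! ### Specialisation -/

theorem specX_zeroOut (s : Set (Fin n)) (f : XSeries (n + 1)) :
    specX n (zeroOut (Fin.castSucc '' s) f) = zeroOut s (specX n f) := by
  have := ((isCoeffMap_specX n).comp (isCoeffMap_zeroOut (Fin.castSucc '' s))).ext
    ((isCoeffMap_zeroOut s).comp (isCoeffMap_specX n)) fun k => by
      rw [AlgHom.comp_apply, AlgHom.comp_apply]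
      refine Fin.lastCases ?_ (fun k => ?_) k
      · rw [zeroOut_X_of_notMem, specX_X_last, map_zero]
        rintro ⟨k, -, hk⟩
        exact (Fin.castSucc_lt_last k).ne hk
      · rw [specX_X_castSucc]
        by_cases hk : k ∈ s
        · rw [zeroOut_X_of_mem (Set.mem_image_of_mem _ hk), zeroOut_X_of_mem hk, map_zero]
        · rw [zeroOut_X_of_notMem, zeroOut_X_of_notMem hk, specX_X_castSucc]
          rwa [(Fin.castSucc_injective n).mem_set_image]
  exact DFunLike.congr_fun this f

theorem specX_renameEquiv (w : Equiv.Perm (Fin n)) (f : XSeries (n + 1)) :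
    specX n (renameEquiv Lazard (w.viaEmbedding Fin.castSuccEmb) f) =
      renameEquiv Lazard w (specX n f) := by
  have := ((isCoeffMap_specX n).comp (isCoeffMap_renameEquiv (w.viaEmbedding Fin.castSuccEmb))).ext
    ((isCoeffMap_renameEquiv w).comp (isCoeffMap_specX n)) fun k => by
      rw [AlgHom.comp_apply, AlgHom.comp_apply]
      change specX n (renameEquiv Lazard _ (X k)) = renameEquiv Lazard w (specX n (X k))
      rw [renameEquiv_X]
      refine Fin.lastCases ?_ (fun k => ?_) k
      · rw [Equiv.Perm.viaEmbedding_apply_of_notMem, specX_X_last, map_zero]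
        rintro ⟨k, hk⟩
        exact (Fin.castSucc_lt_last k).ne hk
      · have := Equiv.Perm.viaEmbedding_apply w Fin.castSuccEmb k
        rw [show k.castSucc = Fin.castSuccEmb k from rfl, this, Fin.coe_castSuccEmb,
          specX_X_castSucc, specX_X_castSucc, renameEquiv_X]
  exact DFunLike.congr_fun this f

theorem specX_mem {f : XSeries (n + 1)} (hf : f ∈ gamOf q (n + 1)) : specX n f ∈ gamOf q n := by
  obtain ⟨h1, h2, h3⟩ := mem_gamOf.mp hf
  refine mem_gamOf.mpr ⟨fun w => ?_, fun i j hij => ?_, fun i => ?_⟩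
  · rw [← specX_renameEquiv, h1]
  · have := map_dvd (specX n) (h2 _ _ ((Fin.castSucc_injective n).ne hij))
    rwa [(isCoeffMap_specX n).map_fadd (constantCoeff_X' _) (constantCoeff_X' _),
      specX_X_castSucc, specX_X_castSucc, map_sub, ← Set.image_pair, specX_zeroOut] at this
  · have := map_dvd (specX n) (h3 i.castSucc)
    rwa [(isCoeffMap_specX n).map_psi (constantCoeff_X' _), specX_X_castSucc, map_sub,
      ← Set.image_singleton, specX_zeroOut] at this

theorem bCoeff_specLast (β : ℕ →₀ ℕ) (f : XBSeries (n + 1)) :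
    bCoeff β (specLast n f) = specX n (bCoeff β f) := by
  refine MvPowerSeries.ext fun α => ?_
  rw [coeff_bCoeff, specLast, MvPowerSeries.coeff_killCompl, specX, MvPowerSeries.coeff_killCompl,
    coeff_bCoeff]
  congr 2
  ext (k | k)
  · refine Fin.lastCases ?_ (fun k => ?_) k
    · rw [Finsupp.embDomain_of_notMem_range, Finsupp.sumElim_inl,
        Finsupp.embDomain_of_notMem_range]
      · rintro ⟨k, hk⟩; exact (Fin.castSucc_lt_last k).ne hk
      · rintro ⟨k | k, hk⟩
        · exact (Fin.castSucc_lt_last k).ne (Sum.inl_injective hk)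
        · cases hk
    · refine (Finsupp.embDomain_apply_self
        (Function.Embedding.sumMap Fin.castSuccEmb (Function.Embedding.refl ℕ))
        (α.sumElim β) (Sum.inl k)).trans ?_
      exact (Finsupp.embDomain_apply_self Fin.castSuccEmb α k).symm
  · exact Finsupp.embDomain_apply_self
      (Function.Embedding.sumMap Fin.castSuccEmb (Function.Embedding.refl ℕ))
      (α.sumElim β) (Sum.inr k)

theorem specLast_mem {f : XBSeries (n + 1)} (hf : f ∈ bExtend (gamOf q (n + 1))) :
    specLast n f ∈ bExtend (gamOf q n) := fun β => by
  rw [bCoeff_specLast]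
  exact specX_mem (hf β)

end Gamma

/-! ### Convergence of families of series of increasing order -/

section Summable

variable {σ ι : Type}

theorem summable_of_finite_order_le {g : ι → MvPowerSeries σ Lazard}
    (h : ∀ d : ℕ, {i | (g i).order ≤ d}.Finite) : Summable g := by
  refine Pi.summable.mpr fun d => summable_of_hasFiniteSupport ((h d.degree).subset fun i hi => ?_)
  exact MvPowerSeries.order_le (d := d) hi

theorem hasSum_iff_forall_coeff {g : ι → MvPowerSeries σ Lazard} {f : MvPowerSeries σ Lazard} :
    HasSum g f ↔ ∀ d, HasSum (fun i => coeff d (g i)) (coeff d f) := Pi.hasSum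

end Summable

/-! ### Products over pairs -/

section LtProd

variable {T T' : Type} [CommRing T] [CommRing T'] {n : ℕ}

/-- The product of `f i j` over the pairs `i < j`. -/
def ltProd (f : Fin n → Fin n → T) : T := ∏ p : Fin n × Fin n with p.1 < p.2, f p.1 p.2

theorem ltProd_eq (f : Fin n → Fin n → T) : ltProd f = ∏ i, ∏ j ∈ Finset.Ioi i, f i j := by
  rw [ltProd, Finset.prod_filter, Fintype.prod_prod_type]
  refine Finset.prod_congr rfl fun i _ => ?_
  rw [← Finset.prod_filter]
  refine Finset.prod_congr ?_ fun _ _ => rfl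
  ext j
  simp

theorem map_ltProd (φ : T →+* T') (f : Fin n → Fin n → T) :
    φ (ltProd f) = ltProd fun i j => φ (f i j) := map_prod _ _ _

theorem ltProd_mul (f g : Fin n → Fin n → T) :
    ltProd (fun i j => f i j * g i j) = ltProd f * ltProd g := Finset.prod_mul_distrib

theorem ltProd_perm_of_symm {f : Fin n → Fin n → T} (hf : ∀ i j, f i j = f j i)
    (w : Equiv.Perm (Fin n)) : ltProd (fun i j => f (w i) (w j)) = ltProd f := by
  have hmem : ∀ p : Fin n × Fin n, p.1 < p.2 → w p.1 ⊓ w p.2 < w p.1 ⊔ w p.2 := fun p hp =>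
    inf_lt_sup.mpr (w.injective.ne hp.ne)
  refine Finset.prod_bij (fun p _ => (w p.1 ⊓ w p.2, w p.1 ⊔ w p.2)) ?_ ?_ ?_ ?_
  · intro p hp
    simp only [Finset.mem_filter, Finset.mem_univ, true_and] at hp ⊢
    exact hmem p hp
  · rintro ⟨a, b⟩ hp ⟨c, d⟩ hq h
    simp only [Finset.mem_filter, Finset.mem_univ, true_and] at hp hq
    simp only [Prod.mk.injEq] at h
    rcases le_total (w a) (w b) with h1 | h1 <;> rcases le_total (w c) (w d) with h2 | h2 <;>
      simp only [h1, h2, inf_of_le_left, inf_of_le_right, sup_of_le_left, sup_of_le_right,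
        w.injective.eq_iff] at h
    · exact Prod.ext h.1 h.2
    · obtain ⟨rfl, rfl⟩ := h
      exact (lt_asymm hp hq).elim
    · obtain ⟨rfl, rfl⟩ := h
      exact (lt_asymm hp hq).elim
    · exact Prod.ext h.2 h.1
  · rintro ⟨a, b⟩ hp
    simp only [Finset.mem_filter, Finset.mem_univ, true_and] at hp
    rcases lt_or_gt_of_ne (w.symm.injective.ne hp.ne) with h | h
    · exact ⟨(w.symm a, w.symm b), by simpa using h, by simp [hp.le]⟩
    · exact ⟨(w.symm b, w.symm a), by simpa using h, by simp [hp.le]⟩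
  · rintro ⟨a, b⟩ _
    rcases le_total (w a) (w b) with h1 | h1
    · simp [h1]
    · simp [h1, hf (w a)]

theorem ltProd_perm_of_antisymm {f : Fin n → Fin n → T} (hf : ∀ i j, f i j = -f j i)
    (w : Equiv.Perm (Fin n)) :
    ltProd (fun i j => f (w i) (w j)) = (w.sign : ℤ) • ltProd f := by
  rw [ltProd_eq, ltProd_eq, Equiv.Perm.prod_Ioi_comp_eq_sign_mul_prod w hf, zsmul_eq_mul]

end LtProd

/-! ### Antisymmetric series -/

section Antisymmetric

variable {n : ℕ}

/-- The series is multiplied by the sign under permutations of the variables. -/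
def IsAntisymm (h : XSeries n) : Prop :=
  ∀ w : Equiv.Perm (Fin n), renameEquiv Lazard w h = (w.sign : ℤ) • h

theorem coeff_renameEquiv (w : Equiv.Perm (Fin n)) (d : Fin n →₀ ℕ) (h : XSeries n) :
    coeff d (renameEquiv Lazard w h) = coeff (Finsupp.equivMapDomain w.symm d) h := by
  have : d = Finsupp.embDomain w.toEmbedding (Finsupp.equivMapDomain w.symm d) := by
    rw [Finsupp.embDomain_eq_mapDomain, Finsupp.equivMapDomain_eq_mapDomain]
    change d = Finsupp.mapDomain w (Finsupp.mapDomain w.symm d)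
    rw [← Finsupp.mapDomain_comp, Equiv.self_comp_symm, Finsupp.mapDomain_id]
  rw [renameEquiv_eq_rename]
  conv_lhs => rw [this]
  exact MvPowerSeries.coeff_embDomain_rename w.toEmbedding h _

theorem equivMapDomain_symm_apply (w : Equiv.Perm (Fin n)) (d : Fin n →₀ ℕ) (i : Fin n) :
    Finsupp.equivMapDomain w.symm d i = d (w i) := rfl

theorem degree_equivMapDomain (w : Equiv.Perm (Fin n)) (d : Fin n →₀ ℕ) :
    (Finsupp.equivMapDomain w d).degree = d.degree := by
  rw [Finsupp.degree_eq_sum, Finsupp.degree_eq_sum]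
  exact Equiv.sum_comp w.symm d

theorem IsAntisymm.sub {g h : XSeries n} (hg : IsAntisymm g) (hh : IsAntisymm h) :
    IsAntisymm (g - h) := fun w => by
  rw [map_sub, hg, hh, smul_sub]

/-- An antisymmetric series is determined by its coefficients at strictly decreasing exponents. -/
theorem IsAntisymm.eq_zero {h : XSeries n} (hh : IsAntisymm h)
    (h0 : ∀ d : Fin n →₀ ℕ, StrictAnti d → coeff d h = 0) : h = 0 := by
  have hw : ∀ (w : Equiv.Perm (Fin n)) d, coeff (Finsupp.equivMapDomain w.symm d) h =
      (w.sign : ℤ) • coeff d h := fun w d => by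
    rw [← coeff_renameEquiv, hh w, map_zsmul]
  refine MvPowerSeries.ext fun d => ?_
  rw [map_zero]
  by_cases hd : Function.Injective d
  · let w : Equiv.Perm (Fin n) := Fin.revPerm.trans (Tuple.sort d)
    have h1 : StrictAnti (Finsupp.equivMapDomain w.symm d) := by
      have h2 : StrictMono (d ∘ Tuple.sort d) :=
        (Tuple.monotone_sort d).strictMono_of_injective (hd.comp (Equiv.injective _))
      intro i j hij
      exact h2 (Fin.rev_lt_rev.mpr hij)
    have h2 := hw w d
    rw [h0 _ h1] at h2
    rcases Int.units_eq_one_or w.sign with h3 | h3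
    · rw [h3] at h2; simpa using h2.symm
    · rw [h3] at h2; simpa using h2.symm
  -- A transposition fixing the exponent shows that the coefficient equals its negative, and 2 is
  -- not a zero divisor.
  · obtain ⟨i, j, hij, hne⟩ : ∃ i j, d i = d j ∧ i ≠ j := by
      simpa [Function.Injective] using hd
    have h1 : Finsupp.equivMapDomain (Equiv.swap i j).symm d = d := by
      ext k
      rw [equivMapDomain_symm_apply]
      by_cases hki : k = i
      · subst hki; rw [Equiv.swap_apply_left, hij]
      · by_cases hkj : k = j
        · subst hkj; rw [Equiv.swap_apply_right, hij]
        · rw [Equiv.swap_apply_of_ne_of_ne hki hkj]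
    have h2 := hw (Equiv.swap i j) d
    rw [h1, Equiv.Perm.sign_swap hne, Units.val_neg, Units.val_one, neg_smul, one_smul] at h2
    have h3 : 2 * coeff d h = 0 := by linear_combination h2
    exact (mul_eq_zero.mp h3).resolve_left prime_two_lazard.ne_zero

/-- The antisymmetrisation of `x ^ β U`. -/
def altSum (U : XSeries n) (β : Fin n →₀ ℕ) : XSeries n :=
  ∑ w : Equiv.Perm (Fin n), (w.sign : ℤ) •
    renameEquiv Lazard w (MvPowerSeries.monomial β (1 : Lazard) * U)

theorem isAntisymm_altSum (U : XSeries n) (β : Fin n →₀ ℕ) : IsAntisymm (altSum U β) := by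
  intro w
  have hmul : ∀ v : Equiv.Perm (Fin n), ∀ f : XSeries n,
      renameEquiv Lazard w (renameEquiv Lazard v f) = renameEquiv Lazard (w * v) f := fun v f => by
    have := AlgEquiv.congr_fun (MvPowerSeries.renameEquiv_trans (R := Lazard) v w) f
    exact this
  rw [altSum, map_sum, Finset.smul_sum]
  refine Fintype.sum_equiv (Equiv.mulLeft w) _ _ fun v => ?_
  rw [map_zsmul, hmul, Equiv.coe_mulLeft, Equiv.Perm.sign_mul, Units.val_mul, smul_smul,
    ← mul_assoc]
  congr 1
  rw [← Units.val_mul, Int.units_mul_self, Units.val_one, one_mul]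

theorem degree_le_order_altSum (U : XSeries n) (β : Fin n →₀ ℕ) :
    (β.degree : ℕ∞) ≤ (altSum U β).order := by
  refine Finset.sum_induction _ (fun g : XSeries n => (β.degree : ℕ∞) ≤ g.order)
    (fun _ _ => le_order_add) (by simp) fun w _ => ?_
  refine MvPowerSeries.nat_le_order fun d hd => ?_
  rw [map_zsmul, coeff_renameEquiv]
  have h1 : coeff (Finsupp.equivMapDomain w.symm d)
      (MvPowerSeries.monomial β (1 : Lazard) * U) = 0 := by
    refine MvPowerSeries.coeff_of_lt_order ?_
    rw [MvPowerSeries.order_mul, MvPowerSeries.order_monomial_of_ne_zero one_ne_zero,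
      degree_equivMapDomain]
    exact lt_of_lt_of_le (Nat.cast_lt.mpr hd) le_self_add
  rw [h1, smul_zero]

/-- Since U = 1 + ⋯, in degree at most |β| the term of w has no monomial other than the permuted
x^β. If this is x^γ with γ and β both strictly decreasing, then w = 1. -/
theorem coeff_altSum {U : XSeries n} (hU : constantCoeff U = 1) {β γ : Fin n →₀ ℕ}
    (hβ : StrictAnti β) (hγ : StrictAnti γ) (h : γ.degree ≤ β.degree) :
    coeff γ (altSum U β) = if γ = β then 1 else 0 := by
  classical
  have h1 : ∀ w : Equiv.Perm (Fin n), coeff γ ((w.sign : ℤ) •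
      renameEquiv Lazard w (MvPowerSeries.monomial β (1 : Lazard) * U)) =
      if w = 1 then (if γ = β then 1 else 0) else 0 := by
    intro w
    rw [map_zsmul, coeff_renameEquiv, MvPowerSeries.coeff_monomial_mul]
    by_cases hle : β ≤ Finsupp.equivMapDomain w.symm γ
    · have heq : β = Finsupp.equivMapDomain w.symm γ := by
        have h2 : β.degree + (Finsupp.equivMapDomain w.symm γ - β).degree =
            (Finsupp.equivMapDomain w.symm γ).degree := by
          rw [← map_add, add_tsub_cancel_of_le hle]
        rw [degree_equivMapDomain] at h2
        have h3 : (Finsupp.equivMapDomain w.symm γ - β).degree = 0 := by omega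
        rw [Finsupp.degree_eq_zero_iff] at h3
        exact le_antisymm hle (tsub_eq_zero_iff_le.mp h3)
      have hw : w = 1 := by
        have h2 : StrictMono w := fun i j hij => by
          have h3 := hβ hij
          rw [heq, equivMapDomain_symm_apply, equivMapDomain_symm_apply] at h3
          exact hγ.lt_iff_gt.mp h3
        have h3 : Set.range w = Set.range (id : Fin n → Fin n) := by
          rw [w.surjective.range_eq, Set.range_id]
        ext i
        have := StrictMono.range_inj h2 strictMono_id |>.mp h3
        rw [this]; rfl
      subst hw
      have h4 : γ = β := by rw [heq]; ext i; rfl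
      rw [if_pos hle, if_pos rfl, if_pos h4, ← heq, tsub_self,
        MvPowerSeries.coeff_zero_eq_constantCoeff_apply, hU]
      simp
    · rw [if_neg hle, smul_zero]
      split_ifs with hw h4
      · subst hw
        exact (hle (le_of_eq (by rw [h4]; ext i; rfl))).elim
      · rfl
      · rfl
  rw [altSum, map_sum, Finset.sum_congr rfl fun w _ => h1 w, Finset.sum_ite_eq' Finset.univ,
    if_pos (Finset.mem_univ _)]

/-- Strictly decreasing exponents. -/
abbrev AntiExp (n : ℕ) : Type := {β : Fin n →₀ ℕ // StrictAnti β}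

theorem finite_antiExp_degree_le (d : ℕ) : {β : AntiExp n | β.1.degree ≤ d}.Finite :=
  (Finsupp.finite_of_degree_le (σ := Fin n) d).preimage Subtype.val_injective.injOn

theorem summable_altSum (U : XSeries n) (c : AntiExp n → Lazard) :
    Summable fun β => c β • altSum U β.1 := by
  refine summable_of_finite_order_le fun d => (finite_antiExp_degree_le d).subset fun β hβ => ?_
  have h1 := (degree_le_order_altSum U β.1).trans (MvPowerSeries.le_order_smul (a := c β))
  exact_mod_cast h1.trans hβ

/-- The equations at strictly decreasing exponents form a unitriangular system by `coeff_altSum`,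
solved by recursion on the degree. They suffice because sums of the given form are antisymmetric. -/
theorem existsUnique_hasSum_altSum {U h : XSeries n} (hU : constantCoeff U = 1)
    (hh : IsAntisymm h) : ∃! c : AntiExp n → Lazard, HasSum (fun β => c β • altSum U β.1) h := by
  classical
  have hfin : ∀ β : AntiExp n, {γ : AntiExp n | γ.1.degree < β.1.degree}.Finite := fun β =>
    (finite_antiExp_degree_le β.1.degree).subset fun γ (hγ : γ.1.degree < _) => hγ.le
  have hanti : ∀ (c : AntiExp n → Lazard) F, HasSum (fun β => c β • altSum U β.1) F →
      IsAntisymm F := by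
    intro c F hF w
    have h1 := hF.map (renameEquiv Lazard w) (isCoeffMap_renameEquiv w).continuous
    have h2 := hF.const_smul (w.sign : ℤ)
    refine h1.unique ?_
    convert h2 using 2 with β
    rw [Function.comp_apply, map_smul, isAntisymm_altSum U β.1 w, smul_comm]
  have hcoeff : ∀ (c : AntiExp n → Lazard) F, HasSum (fun β => c β • altSum U β.1) F →
      ∀ β : AntiExp n, coeff β.1 F =
        c β + ∑ γ ∈ (hfin β).toFinset, c γ * coeff β.1 (altSum U γ.1) := by
    intro c F hF β
    have h1 := hasSum_iff_forall_coeff.mp hF β.1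
    have h2 : HasSum (fun γ => coeff β.1 (c γ • altSum U γ.1))
        (∑ γ ∈ insert β (hfin β).toFinset, coeff β.1 (c γ • altSum U γ.1)) := by
      refine hasSum_sum_of_ne_finset_zero fun γ hγ => ?_
      simp only [Finset.mem_insert, Set.Finite.mem_toFinset, Set.mem_ofPred_eq, not_or,
        not_lt] at hγ
      rw [MvPowerSeries.coeff_smul, coeff_altSum hU γ.2 β.2 hγ.2, if_neg, mul_zero]
      exact fun h => hγ.1 (Subtype.ext h.symm)
    rw [h1.unique h2, Finset.sum_insert]
    · rw [MvPowerSeries.coeff_smul, coeff_altSum hU β.2 β.2 le_rfl, if_pos rfl, mul_one]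
      rfl
    · simp
  have hiff : ∀ c : AntiExp n → Lazard, HasSum (fun β => c β • altSum U β.1) h ↔
      ∀ β : AntiExp n, c β =
        coeff β.1 h - ∑ γ ∈ (hfin β).toFinset, c γ * coeff β.1 (altSum U γ.1) := by
    intro c
    constructor
    · intro hc β
      rw [hcoeff c h hc β, add_sub_cancel_right]
    · intro hc
      obtain ⟨F, hF⟩ := summable_altSum U c
      have : F - h = 0 := ((hanti c F hF).sub hh).eq_zero fun d hd => by
        rw [map_sub, hcoeff c F hF ⟨d, hd⟩, hc ⟨d, hd⟩]
        ring
      rwa [← sub_eq_zero.mp this]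
  have hwf : WellFounded fun γ β : AntiExp n => γ.1.degree < β.1.degree :=
    (measure fun β : AntiExp n => β.1.degree).wf
  obtain ⟨c, hc, huniq⟩ := existsUnique_forall_eq_of_wellFounded hwf (C := fun _ => Lazard)
    fun β prev => coeff β.1 h - ∑ γ ∈ (hfin β).toFinset.attach,
      prev γ.1 ((hfin β).mem_toFinset.mp γ.2) * coeff β.1 (altSum U γ.1.1)
  have hatt : ∀ (c : AntiExp n → Lazard) (β : AntiExp n),
      ∑ γ ∈ (hfin β).toFinset.attach, c γ.1 * coeff β.1 (altSum U γ.1.1) =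
      ∑ γ ∈ (hfin β).toFinset, c γ * coeff β.1 (altSum U γ.1) := fun c β =>
    Finset.sum_attach _ fun γ : AntiExp n => c γ * coeff β.1 (altSum U γ.1)
  simp only [hatt] at hc huniq
  exact ⟨c, (hiff c).mpr hc, fun c' hc' => huniq c' ((hiff c').mp hc')⟩

end Antisymmetric

/-! ### Functions of maximal length -/

section MaximalLength

variable {n : ℕ} {q : Bool}

/-- For r = n the injections are permutations, and every unordered pair contributes exactly one plus
and one minus factor. -/
theorem hlSum_eq_sum_perm {T : Type} [CommRing T] {r : ℕ} (pl mi : Fin n → Fin n → T)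
    (M : Fin r → Fin n → T) (hr : r = n) :
    hlSum pl mi M Finset.univ = ∑ w : Equiv.Perm (Fin n),
      (∏ i, M (Fin.cast hr.symm i) (w i)) *
        ltProd fun i j => pl (w i) (w j) * mi (w j) (w i) := by
  subst hr
  have h1 := sum_permToEmb le_rfl fun e : Fin r ↪ Fin r =>
    (∏ i, M i (e i)) * offDiagProd (hlFactor pl mi e) Finset.univ
  rw [Nat.sub_self, Nat.factorial_zero, Nat.cast_one, one_mul] at h1
  simp only [hlSum, Finset.mem_univ, implies_true, Finset.filter_true]
  rw [← h1]
  refine Finset.sum_congr rfl fun w _ => ?_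
  congr 1
  have h2 := offDiagProd_map (hlFactor pl mi (permToEmb le_rfl w)) w.toEmbedding Finset.univ
  rw [Finset.map_univ_equiv] at h2
  rw [h2, offDiagProd_univ_eq]
  refine Finset.prod_congr rfl fun p hp => ?_
  have hp' := (Finset.mem_filter.mp hp).2
  simp only [Equiv.coe_toEmbedding, hlFactor_permToEmb]
  rw [if_pos ⟨p.1.2, hp'⟩, if_neg fun h => lt_asymm hp' h.2]

/-- The strict partition `β + 1`. -/
def ofAntiExp (β : AntiExp n) : StrictPartition where
  parts := List.ofFn fun i => β.1 i + 1
  strict := List.pairwise_ofFn.mpr fun _ _ hij => Nat.succ_lt_succ (β.2 hij)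
  pos p hp := by
    obtain ⟨i, rfl⟩ := (List.mem_ofFn' _ _).mp hp
    exact Nat.succ_pos _

theorem length_ofAntiExp (β : AntiExp n) : (ofAntiExp β).length = n := List.length_ofFn

theorem part_ofAntiExp (β : AntiExp n) (i : Fin n) : (ofAntiExp β).part i = β.1 i + 1 := by
  rw [StrictPartition.part, ofAntiExp, List.getD_eq_getElem _ _ (by simp)]
  simp

theorem ofAntiExp_injective : Function.Injective (ofAntiExp : AntiExp n → StrictPartition) := by
  intro β γ h
  ext i
  have h1 := part_ofAntiExp β i
  rw [h, part_ofAntiExp γ i] at h1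
  omega

theorem mem_range_ofAntiExp {lam : StrictPartition} (h : lam.length = n) :
    lam ∈ Set.range (ofAntiExp : AntiExp n → StrictPartition) := by
  have hlt : ∀ i : Fin n, i.val < lam.parts.length := fun i => i.2.trans_eq h.symm
  have hpos : ∀ i : Fin n, 0 < lam.parts[i.val]'(hlt i) := fun i =>
    lam.pos _ (List.getElem_mem _)
  refine ⟨⟨Finsupp.equivFunOnFinite.symm fun i => lam.parts[i.val]'(hlt i) - 1, ?_⟩, ?_⟩
  · intro i j hij
    have h1 : lam.parts[j.val]'(hlt j) < lam.parts[i.val]'(hlt i) :=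
      List.pairwise_iff_getElem.mp lam.strict _ _ _ _ hij
    have h2 := hpos j
    change lam.parts[j.val]'(hlt j) - 1 < lam.parts[i.val]'(hlt i) - 1
    omega
  · refine StrictPartition.ext_parts (List.ext_getElem ?_ fun i h1 h2 => ?_)
    · exact (length_ofAntiExp _).trans h.symm
    · have h3 : i < n := by rwa [← h]
      have := hpos ⟨i, h3⟩
      simp only [ofAntiExp, List.getElem_ofFn]
      change lam.parts[i] - 1 + 1 = _
      exact Nat.sub_add_cancel this

/-- The greatest common divisor of the functions of length `n`. -/
def psiProd (q : Bool) (n : ℕ) : XSeries n :=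
  (∏ i, psi q (X i)) * ltProd (plX (Function.Embedding.refl (Fin n)))

theorem psi_renameEquiv (w : Equiv.Perm (Fin n)) (i : Fin n) :
    renameEquiv Lazard w (psi q (X i)) = psi q (X (w i)) := by
  refine ((isCoeffMap_renameEquiv w).map_psi (constantCoeff_X' i)).trans ?_
  exact congrArg _ (renameEquiv_X w i)

theorem renameEquiv_plX_refl (w : Equiv.Perm (Fin n)) (k l : Fin n) :
    renameEquiv Lazard w (plX (Function.Embedding.refl _) k l) =
      plX (Function.Embedding.refl _) (w k) (w l) := by
  refine ((isCoeffMap_renameEquiv w).map_fadd (constantCoeff_X' k) (constantCoeff_X' l)).trans ?_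
  exact congrArg₂ fadd (renameEquiv_X w k) (renameEquiv_X w l)

theorem renameEquiv_miX_refl (w : Equiv.Perm (Fin n)) (k l : Fin n) :
    renameEquiv Lazard w (miX (Function.Embedding.refl _) k l) =
      miX (Function.Embedding.refl _) (w k) (w l) := by
  refine ((isCoeffMap_renameEquiv w).map_fadd (constantCoeff_X' k) (constantCoeff_fneg_X l)).trans
    (congrArg₂ fadd (renameEquiv_X w k) ?_)
  exact ((isCoeffMap_renameEquiv w).map_fneg (constantCoeff_X' l)).trans
    (congrArg fneg (renameEquiv_X w l))

theorem plX_comm {σ : Type} (ι : Fin n ↪ σ) (k l : Fin n) : plX ι k l = plX ι l k :=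
  fadd_comm (constantCoeff_X' _) (constantCoeff_X' _)

theorem renameEquiv_psiProd (w : Equiv.Perm (Fin n)) :
    renameEquiv Lazard w (psiProd q n) = psiProd q n := by
  have h1 := map_ltProd (renameEquiv Lazard w : XSeries n →+* XSeries n)
    (plX (Function.Embedding.refl (Fin n)))
  simp only [RingHom.coe_coe, renameEquiv_plX_refl] at h1
  rw [ltProd_perm_of_symm (plX_comm _)] at h1
  rw [psiProd, map_mul, map_prod]
  refine congrArg₂ (· * ·) ?_ h1
  simp only [psi_renameEquiv]
  exact Equiv.prod_comp w fun i => psi q (X i)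

theorem psiProd_ne_zero : psiProd q n ≠ 0 :=
  mul_ne_zero (Finset.prod_ne_zero_iff.mpr fun i _ => psi_X_ne_zero i)
    (Finset.prod_ne_zero_iff.mpr fun _ hp => (prime_fadd_X (Finset.mem_filter.mp hp).2.ne).ne_zero)

/-- The Vandermonde product. -/
def vdm (n : ℕ) : XSeries n := ltProd fun i j => X j - X i

theorem vdm_ne_zero : vdm n ≠ 0 :=
  Finset.prod_ne_zero_iff.mpr fun _ hp => (prime_X_sub_X (Finset.mem_filter.mp hp).2.ne').ne_zero

theorem isAntisymm_vdm : IsAntisymm (vdm n) := fun w => by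
  have h1 := map_ltProd (renameEquiv Lazard w : XSeries n →+* XSeries n) fun i j => X j - X i
  simp only [RingHom.coe_coe, map_sub, renameEquiv_X] at h1
  refine h1.trans ?_
  exact ltProd_perm_of_antisymm (f := fun i j : Fin n => (X j - X i : XSeries n))
    (fun i j => (neg_sub _ _).symm) w

theorem exists_ltProd_miX_eq (n : ℕ) : ∃ U : XSeries n, constantCoeff U = 1 ∧
    ltProd (fun i j => miX (Function.Embedding.refl (Fin n)) j i) = vdm n * U := by
  have h1 : ∀ i j : Fin n, ∃ u : XSeries n, constantCoeff u = 1 ∧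
      miX (Function.Embedding.refl (Fin n)) j i = (X j - X i) * u := fun i j =>
    exists_fadd_fneg_eq (constantCoeff_X' _) (constantCoeff_X' _)
  choose u hu hu' using h1
  refine ⟨ltProd u, ?_, ?_⟩
  · rw [map_ltProd]
    simp only [hu]
    exact Finset.prod_const_one
  · simp only [hu', ltProd_mul, vdm]

/-- The factors ψ(x_i) and the product of all x_i ⊕ x_j are symmetric and come out of the sum over
w. The remaining minus factors are w applied to the Vandermonde product times U, and the Vandermonde
product contributes the sign. -/
theorem offDiagProd_mul_schurX {U : XSeries n}
    (hU : ltProd (fun i j => miX (Function.Embedding.refl (Fin n)) j i) = vdm n * U)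
    (β : AntiExp n) :
    offDiagProd (miX (Function.Embedding.refl (Fin n))) Finset.univ * schurX q n (ofAntiExp β) =
      psiProd q n * vdm n * altSum U β.1 := by
  rw [isHL_schurX q n (ofAntiExp β), hlSum_eq_sum_perm _ _ _ (length_ofAntiExp β), altSum,
    Finset.mul_sum]
  refine Finset.sum_congr rfl fun w _ => ?_
  have h1 : (∏ i : Fin n, schurMonX q n (ofAntiExp β) (Fin.cast (length_ofAntiExp β).symm i) (w i)) =
      (∏ i, psi q (X i)) * renameEquiv Lazard w (MvPowerSeries.monomial β.1 (1 : Lazard)) := by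
    rw [MvPowerSeries.monomial_one_eq, Finsupp.prod_fintype _ _ (fun i => pow_zero _), map_prod,
      ← Equiv.prod_comp w fun i => psi q (X i), ← Finset.prod_mul_distrib]
    refine Finset.prod_congr rfl fun i _ => ?_
    rw [map_pow, renameEquiv_X, schurMonX]
    congr 2
    change (ofAntiExp β).part i - 1 = _
    rw [part_ofAntiExp, Nat.add_sub_cancel]
  have h2 : ltProd (fun i j => miX (Function.Embedding.refl (Fin n)) (w j) (w i)) =
      (w.sign : ℤ) • vdm n * renameEquiv Lazard w U := by
    have h3 := map_ltProd (renameEquiv Lazard w : XSeries n →+* XSeries n) fun i j =>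
      miX (Function.Embedding.refl (Fin n)) j i
    simp only [RingHom.coe_coe, renameEquiv_miX_refl] at h3
    rw [← h3, hU, map_mul, isAntisymm_vdm w]
  rw [ltProd_mul, ltProd_perm_of_symm (plX_comm _), h1, h2, psiProd, map_mul, smul_mul_assoc,
    mul_smul_comm, mul_smul_comm, mul_smul_comm]
  congr 1
  ring

theorem not_plX_dvd_psi {i j k : Fin n} (hij : i ≠ j) :
    ¬ (fadd (X i) (X j) : XSeries n) ∣ psi q (X k) := by
  intro h
  have c := constantCoeff_X' (σ := Fin n)
  obtain ⟨a, ha⟩ := exists_lin_eq_of_dvd (constantCoeff_fadd (c i) (c j)) h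
  have hi := ha i
  have hj := ha j
  have hk := ha k
  rw [lin_fadd _ (c i) (c j), lin_X, lin_X, if_pos rfl, if_neg hij, add_zero, one_mul] at hi
  rw [lin_fadd _ (c i) (c j), lin_X, lin_X, if_pos rfl, if_neg hij.symm, zero_add, one_mul] at hj
  have ha0 : a = 0 := by
    by_cases hki : i = k
    · rw [lin_psi_X, if_neg fun h => hij (hki.trans h.symm)] at hj
      exact hj.symm
    · rw [lin_psi_X, if_neg hki] at hi
      exact hi.symm
  rw [ha0, mul_zero] at hk
  exact lin_psi_X_self _ hk

theorem not_plX_dvd_plX {i j k l : Fin n} (hkl : k ≠ l)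
    (h : ¬ ((k = i ∨ k = j) ∧ (l = i ∨ l = j))) :
    ¬ (fadd (X i) (X j) : XSeries n) ∣ fadd (X k) (X l) := by
  have c := constantCoeff_X' (σ := Fin n)
  have key : ∀ m : Fin n, m ≠ i → m ≠ j → (m = k ∨ m = l) →
      ¬ (fadd (X i) (X j) : XSeries n) ∣ fadd (X k) (X l) := by
    intro m hmi hmj hm
    refine not_dvd_of_lin (i := m) (constantCoeff_fadd (c i) (c j)) ?_ ?_
    · rw [lin_fadd _ (c i) (c j), lin_X, lin_X, if_neg hmi, if_neg hmj, add_zero]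
    · rw [lin_fadd _ (c k) (c l), lin_X, lin_X]
      rcases hm with rfl | rfl
      · rw [if_pos rfl, if_neg hkl]; simp
      · rw [if_pos rfl, if_neg hkl.symm]; simp
  by_cases h1 : k = i ∨ k = j
  · have h2 : ¬ (l = i ∨ l = j) := fun h2 => h ⟨h1, h2⟩
    push Not at h2
    exact key l h2.1 h2.2 (Or.inr rfl)
  · push Not at h1
    exact key k h1.1 h1.2 (Or.inl rfl)

/-- If f vanishes wherever a variable does, the defining congruences say that f itself is divisible
by each ψ(x_i) and each x_i ⊕ x_j, and these are regular modulo each other. -/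
theorem psiProd_dvd {f : XSeries n} (hf : f ∈ gamOf q n) (h0 : ∀ i, zeroOut {i} f = 0) :
    psiProd q n ∣ f := by
  classical
  obtain ⟨-, h2, h3⟩ := mem_gamOf.mp hf
  have h4 : ∀ i j : Fin n, i ≠ j → (fadd (X i) (X j) : XSeries n) ∣ f := by
    intro i j hij
    have h5 := h2 i j hij
    have h6 : zeroOut {i, j} f = 0 := by
      refine MvPowerSeries.ext fun d => ?_
      have h7 := congrArg (coeff d) (h0 i)
      rw [coeff_zeroOut] at h7 ⊢
      rw [map_zero] at h7 ⊢
      split_ifs with h8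
      · rwa [if_pos (by simpa using h8 i (by simp))] at h7
      · rfl
    rwa [h6, sub_zero] at h5
  obtain ⟨g, hg⟩ : (∏ i, psi q (X i) : XSeries n) ∣ f := by
    refine prod_dvd_of_regularMod _ (fun i _ j _ hij => regularMod_psi_X hij.symm) fun i _ => ?_
    have := h3 i
    rwa [h0, sub_zero] at this
  rw [psiProd, hg]
  refine mul_dvd_mul_left _ (prod_dvd_of_regularMod _ ?_ ?_)
  · rintro ⟨a, b⟩ hp ⟨c, d⟩ hq hne
    simp only [Finset.mem_filter, Finset.mem_univ, true_and] at hp hq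
    refine RegularMod.of_prime_left (prime_fadd_X hp.ne)
      (not_plX_dvd_plX (i := a) (j := b) (k := c) (l := d) hq.ne ?_)
    rintro ⟨rfl | rfl, rfl | rfl⟩
    · exact lt_irrefl _ hq
    · exact hne rfl
    · exact lt_asymm hp hq
    · exact lt_irrefl _ hq
  · rintro ⟨a, b⟩ hp
    have hab := (Finset.mem_filter.mp hp).2.ne
    have hreg : RegularMod (fadd (X a) (X b) : XSeries n) (∏ i, psi q (X i)) :=
      RegularMod.prod fun i _ => RegularMod.of_prime_left (prime_fadd_X hab) (not_plX_dvd_psi hab)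
    exact hreg g (hg ▸ h4 a b hab)

theorem hasSum_mul_left_iff_of_summable {σ ι : Type} {a : MvPowerSeries σ Lazard} (ha : a ≠ 0)
    {g : ι → MvPowerSeries σ Lazard} (hg : Summable g) {f : MvPowerSeries σ Lazard} :
    HasSum (fun i => a * g i) (a * f) ↔ HasSum g f := by
  refine ⟨fun h => ?_, fun h => h.mul_left a⟩
  obtain ⟨F, hF⟩ := hg
  rwa [← mul_left_cancel₀ ha ((hF.mul_left a).unique h)]

theorem summable_smul_schurX (c : StrictPartition → Lazard) :
    Summable fun lam => c lam • schurX q n lam := by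
  refine summable_of_finite_order_le fun d =>
    (StrictPartition.finite_size_le d).subset fun lam hlam => ?_
  have h1 := (size_le_order_schurX q n lam).trans (MvPowerSeries.le_order_smul (a := c lam))
  exact_mod_cast h1.trans hlam

/-- Write f = `psiProd` · g and D = W · `vdm` · U. By `offDiagProd_mul_schurX`, expansions of f in
functions of length n correspond to expansions of U W g in alternating sums. The series U W g is
antisymmetric because its product with the Vandermonde product is D g, which is symmetric. -/
theorem existsUnique_hasSum_schurX_ofAntiExp {f : XSeries n} (hf : f ∈ gamOf q n)
    (h0 : ∀ i, zeroOut {i} f = 0) :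
    ∃! c : AntiExp n → Lazard, HasSum (fun β => c β • schurX q n (ofAntiExp β)) f := by
  obtain ⟨g, hg⟩ := psiProd_dvd hf h0
  obtain ⟨U, hU1, hU⟩ := exists_ltProd_miX_eq n
  set D := offDiagProd (miX (Function.Embedding.refl (Fin n))) Finset.univ with hD
  set W := ltProd (fun i j => miX (Function.Embedding.refl (Fin n)) i j) with hW
  have hDW : D = W * (vdm n * U) := by rw [hD, offDiagProd_univ_eq, ← hU, hW, ← ltProd_mul]; rfl
  have hDs : ∀ w : Equiv.Perm (Fin n), renameEquiv Lazard w D = D := fun w => by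
    have h1 := map_offDiagProd (renameEquiv Lazard w : XSeries n →+* XSeries n)
      (miX (Function.Embedding.refl (Fin n))) Finset.univ
    simp only [RingHom.coe_coe, renameEquiv_miX_refl] at h1
    have h2 := offDiagProd_map (miX (Function.Embedding.refl (Fin n))) w.toEmbedding Finset.univ
    rw [Finset.map_univ_equiv] at h2
    exact h1.trans h2.symm
  have hgs : ∀ w : Equiv.Perm (Fin n), renameEquiv Lazard w g = g := fun w => by
    have h1 := (mem_gamOf.mp hf).1 w
    rw [hg, map_mul, renameEquiv_psiProd] at h1
    exact mul_left_cancel₀ psiProd_ne_zero h1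
  have hh : IsAntisymm (U * W * g) := fun w => by
    have h1 : renameEquiv Lazard w (vdm n * (U * W * g)) = vdm n * (U * W * g) := by
      rw [show vdm n * (U * W * g) = D * g by rw [hDW]; ring, map_mul, hDs, hgs]
    rw [map_mul, isAntisymm_vdm w, smul_mul_assoc, ← mul_smul_comm] at h1
    have h2 := mul_left_cancel₀ vdm_ne_zero h1
    rw [← h2, smul_smul, ← Units.val_mul, Int.units_mul_self, Units.val_one, one_smul, h2]
  have hiff : ∀ c : AntiExp n → Lazard, HasSum (fun β => c β • altSum U β.1) (U * W * g) ↔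
      HasSum (fun β => c β • schurX q n (ofAntiExp β)) f := by
    intro c
    have hs : Summable fun β => c β • schurX q n (ofAntiExp β) := by
      refine summable_of_finite_order_le fun d =>
        ((StrictPartition.finite_size_le d).preimage ofAntiExp_injective.injOn).subset
          fun β hβ => ?_
      have h1 := (size_le_order_schurX q n (ofAntiExp β)).trans
        (MvPowerSeries.le_order_smul (a := c β))
      exact_mod_cast h1.trans hβ
    rw [← hasSum_mul_left_iff_of_summable (mul_ne_zero psiProd_ne_zero vdm_ne_zero)
      (a := psiProd q n * vdm n) (summable_altSum U c),
      ← hasSum_mul_left_iff_of_summable (a := D) (offDiagProd_miX_ne_zero Finset.univ) hs]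
    have e1 : psiProd q n * vdm n * (U * W * g) = D * f := by rw [hg, hDW]; ring
    rw [e1]
    simp only [mul_smul_comm, hD, offDiagProd_mul_schurX hU]
  simp only [← hiff]
  exact existsUnique_hasSum_altSum hU1 hh

end MaximalLength

/-! ### The nonequivariant bases -/

section Basis

variable {n : ℕ} {q : Bool}

theorem schurX_eq_zero {lam : StrictPartition} (h : n < lam.length) : schurX q n lam = 0 := by
  have : schur q n lam = 0 := by
    cases q
    · exact if_neg (not_le.mpr h)
    · exact if_neg (not_le.mpr h)
  rw [schurX, this, map_zero]

theorem schurX_mem (q : Bool) (n : ℕ) (lam : StrictPartition) : schurX q n lam ∈ gamOf q n := by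
  rw [schurX, ← bCoeff_zero_eq_killB]
  exact schur_mem q n lam 0

theorem mem_of_hasSum {A M ι : Type} [CommRing A] [CommRing M] [Algebra A M] [TopologicalSpace M]
    {G : Subalgebra A M} (hG : IsClosed (G : Set M)) {e : ι → M} {F : M} (hF : HasSum e F)
    (he : ∀ i, e i ∈ G) : F ∈ G :=
  hG.mem_of_tendsto hF (Filter.Eventually.of_forall fun _ => sum_mem fun i _ => he i)

theorem exists_hasSum_schurX_of_zeroOut {f : XSeries n} (hf : f ∈ gamOf q n)
    (h0 : ∀ i, zeroOut {i} f = 0) :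
    ∃ c : StrictPartition → Lazard, HasSum (fun lam => c lam • schurX q n lam) f := by
  obtain ⟨c, hc, -⟩ := existsUnique_hasSum_schurX_ofAntiExp hf h0
  refine ⟨Function.extend ofAntiExp c 0, ?_⟩
  rw [← ofAntiExp_injective.hasSum_iff]
  · convert hc using 2 with β
    rw [Function.comp_apply, ofAntiExp_injective.extend_apply]
  · intro lam hlam
    rw [Function.extend_apply' _ _ _ hlam, Pi.zero_apply, zero_smul]

theorem eq_zero_of_hasSum_schurX {c : StrictPartition → Lazard}
    (hc : HasSum (fun lam => c lam • schurX q n lam) 0) (h : ∀ lam, lam.length < n → c lam = 0)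
    {lam : StrictPartition} (hlam : lam.length = n) : c lam = 0 := by
  rw [← ofAntiExp_injective.hasSum_iff] at hc
  · obtain ⟨β, rfl⟩ := mem_range_ofAntiExp hlam
    have := (existsUnique_hasSum_schurX_ofAntiExp (q := q) (n := n) (f := 0) (zero_mem _)
      fun i => map_zero _).unique (y₁ := c ∘ ofAntiExp) (y₂ := 0) hc (by simp [hasSum_zero])
    exact congrFun this β
  · intro mu hmu
    rcases lt_trichotomy mu.length n with h1 | h1 | h1
    · rw [h mu h1, zero_smul]
    · exact (hmu (mem_range_ofAntiExp h1)).elim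
    · rw [schurX_eq_zero h1, smul_zero]

theorem zeroOut_eq_zero_of_specX {f : XSeries (n + 1)}
    (hs : ∀ w : Equiv.Perm (Fin (n + 1)), renameEquiv Lazard w f = f) (h : specX n f = 0)
    (i : Fin (n + 1)) : zeroOut {i} f = 0 := by
  classical
  have h1 : ∀ d : Fin (n + 1) →₀ ℕ, d (Fin.last n) = 0 → coeff d f = 0 := by
    intro d hd
    obtain ⟨d', rfl⟩ : d ∈ Set.range (Finsupp.embDomain Fin.castSuccEmb) := by
      rw [Finsupp.mem_range_embDomain_iff]
      intro k hk
      induction k using Fin.lastCases with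
      | last => exact (Finsupp.mem_support_iff.mp hk hd).elim
      | cast k => exact ⟨k, rfl⟩
    rw [← MvPowerSeries.coeff_killCompl]
    change coeff d' (specX n f) = 0
    rw [h, map_zero]
  refine MvPowerSeries.ext fun d => ?_
  rw [coeff_zeroOut, map_zero]
  split_ifs with hd
  · rw [← hs (Equiv.swap i (Fin.last n)), coeff_renameEquiv]
    refine h1 _ ?_
    rw [equivMapDomain_symm_apply, Equiv.swap_apply_right]
    exact hd i rfl
  · rfl

theorem hasSum_specX {c : StrictPartition → Lazard} {f : XSeries (n + 1)}
    (h : HasSum (fun lam => c lam • schurX q (n + 1) lam) f) :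
    HasSum (fun lam => c lam • schurX q n lam) (specX n f) := by
  convert h.map (specX n) (isCoeffMap_specX n).continuous using 2 with lam
  rw [Function.comp_apply, map_smul, specX_schurX]

/-- The functions `Q_λ(x_n)` (or `P_λ(x_n)`) span. -/
theorem exists_hasSum_schurX : ∀ {n : ℕ} {f : XSeries n}, f ∈ gamOf q n →
    ∃ c : StrictPartition → Lazard, HasSum (fun lam => c lam • schurX q n lam) f
  | 0, _, hf => exists_hasSum_schurX_of_zeroOut hf fun i => i.elim0
  | n + 1, f, hf => by
    obtain ⟨c, hc⟩ := exists_hasSum_schurX (specX_mem hf)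
    -- The coefficients found in n variables are reused in n + 1 variables. By stability the error f
    -- - F vanishes at x_{n+1} = 0, so it is a combination of functions of length n + 1.
    obtain ⟨F, hF⟩ := summable_smul_schurX (q := q) (n := n + 1) c
    have hFm : F ∈ gamOf q (n + 1) := mem_of_hasSum (isClosed_gamOf q (n + 1)) hF
      fun lam => (gamOf q (n + 1)).smul_mem (schurX_mem q (n + 1) lam) (c lam)
    have h1 : specX n (f - F) = 0 := by
      rw [map_sub, sub_eq_zero]
      exact hc.unique (hasSum_specX hF)
    have hm := sub_mem hf hFm
    obtain ⟨c', hc'⟩ := exists_hasSum_schurX_of_zeroOut hm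
      (zeroOut_eq_zero_of_specX (mem_gamOf.mp hm).1 h1)
    refine ⟨c + c', ?_⟩
    have h2 := hF.add hc'
    rw [add_sub_cancel] at h2
    simpa only [Pi.add_apply, add_smul] using h2

/-- The nonzero functions `Q_λ(x_n)` (or `P_λ(x_n)`) are independent. -/
theorem eq_zero_of_hasSum_schurX_zero : ∀ {n : ℕ} {c : StrictPartition → Lazard},
    HasSum (fun lam => c lam • schurX q n lam) 0 → ∀ {lam : StrictPartition},
    lam.length ≤ n → c lam = 0
  | 0, _, hc, _, hlam => eq_zero_of_hasSum_schurX hc (fun _ h => absurd h (Nat.not_lt_zero _))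
      (Nat.le_zero.mp hlam)
  | n + 1, c, hc, lam, hlam => by
    have h1 := hasSum_specX hc
    rw [map_zero] at h1
    -- The specialised relation kills the coefficients of length at most n; what is left involves
    -- only length n + 1, where uniqueness is known.
    rcases Nat.lt_or_ge n lam.length with h2 | h2
    · exact eq_zero_of_hasSum_schurX hc
        (fun mu hmu => eq_zero_of_hasSum_schurX_zero h1 (Nat.le_of_lt_succ hmu))
        (le_antisymm hlam h2)
    · exact eq_zero_of_hasSum_schurX_zero h1 h2

end Basis

/-! ### Lifting bases to equivariant coefficients -/

section Lift

variable {n : ℕ}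

theorem bCoeff_smul (β : ℕ →₀ ℕ) (c : BSeries) (f : XBSeries n) :
    bCoeff β (c • f) = ∑ p ∈ Finset.HasAntidiagonal.antidiagonal β,
      coeff p.1 c • bCoeff p.2 f := by
  rw [Algebra.smul_def, bCoeff_mul]
  refine Finset.sum_congr rfl fun p _ => ?_
  rw [Algebra.smul_def, ← bCoeff_bIncl]
  rfl

theorem order_le_order_smul (c : BSeries) (f : XBSeries n) : f.order ≤ (c • f).order := by
  rw [Algebra.smul_def, MvPowerSeries.order_mul]
  exact le_add_self

theorem degree_sumElim (α : Fin n →₀ ℕ) (β : ℕ →₀ ℕ) :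
    (α.sumElim β).degree = α.degree + β.degree := by
  have h : α.sumElim β = Finsupp.embDomain (Function.Embedding.inl : Fin n ↪ Fin n ⊕ ℕ) α +
      Finsupp.embDomain (Function.Embedding.inr : ℕ ↪ Fin n ⊕ ℕ) β := by
    ext (k | k)
    · rw [Finsupp.add_apply, Finsupp.embDomain_of_notMem_range Function.Embedding.inr,
        add_zero]
      · exact (Finsupp.embDomain_apply_self
          (Function.Embedding.inl : Fin n ↪ Fin n ⊕ ℕ) α k).symm
      · rintro ⟨k, hk⟩; cases hk
    · rw [Finsupp.add_apply, Finsupp.embDomain_of_notMem_range Function.Embedding.inl,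
        zero_add]
      · exact (Finsupp.embDomain_apply_self
          (Function.Embedding.inr : ℕ ↪ Fin n ⊕ ℕ) β k).symm
      · rintro ⟨k, hk⟩; cases hk
  rw [h, map_add, degree_embDomain, degree_embDomain]

theorem exists_eq_sumElim (d : Fin n ⊕ ℕ →₀ ℕ) :
    ∃ (α : Fin n →₀ ℕ) (β : ℕ →₀ ℕ), d = α.sumElim β :=
  ⟨_, _, (Finsupp.comapDomain_sumElim_comapDomain d).symm⟩

theorem hasSum_iff_forall_bCoeff {ι : Type} {g : ι → XBSeries n} {F : XBSeries n} :
    HasSum g F ↔ ∀ β, HasSum (fun i => bCoeff β (g i)) (bCoeff β F) := by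
  rw [hasSum_iff_forall_coeff]
  constructor
  · intro h β
    rw [hasSum_iff_forall_coeff]
    exact fun α => h (α.sumElim β)
  · intro h d
    obtain ⟨α, β, rfl⟩ := exists_eq_sumElim d
    exact hasSum_iff_forall_coeff.mp (h β) α

variable {ι : Type} {e : ι → XBSeries n}

/-- Taking the coefficient of a monomial in b that divides b^β lowers the order by at most |β|. -/
theorem finite_order_bCoeff_le (he : ∀ d : ℕ, {i | (e i).order ≤ d}.Finite) {β : ℕ →₀ ℕ}
    (P : (ℕ →₀ ℕ) × (ℕ →₀ ℕ) → Prop) [DecidablePred P] (C : (ℕ →₀ ℕ) → ι → Lazard) (d : ℕ) :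
    {i | (∑ p ∈ Finset.HasAntidiagonal.antidiagonal β,
      if P p then C p.1 i • bCoeff p.2 (e i) else 0 : XSeries n).order ≤ d}.Finite := by
  refine (he (d + β.degree)).subset fun i hi => ?_
  by_contra hlt
  have hlt : ((d + β.degree : ℕ) : ℕ∞) < (e i).order := not_le.mp hlt
  have h1 : ((d + 1 : ℕ) : ℕ∞) ≤ (∑ p ∈ Finset.HasAntidiagonal.antidiagonal β,
      if P p then C p.1 i • bCoeff p.2 (e i) else 0 : XSeries n).order := by
    refine MvPowerSeries.nat_le_order fun α hα => ?_
    rw [map_sum]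
    refine Finset.sum_eq_zero fun p hp => ?_
    split_ifs
    · have h2 : coeff (α.sumElim p.2) (e i) = 0 := by
        refine MvPowerSeries.coeff_of_lt_order (lt_of_le_of_lt ?_ hlt)
        rw [degree_sumElim]
        have h3 : p.1.degree + p.2.degree = β.degree := by
          rw [← map_add, Finset.HasAntidiagonal.mem_antidiagonal.mp hp]
        exact_mod_cast (by omega : α.degree + p.2.degree ≤ d + β.degree)
      rw [MvPowerSeries.coeff_smul, coeff_bCoeff, h2, mul_zero]
    · exact map_zero _
  have h2 : ((d + 1 : ℕ) : ℕ∞) ≤ d := h1.trans hi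
  have h3 : d + 1 ≤ d := by exact_mod_cast h2
  omega

/-- A family of series with `b`-coefficients in `G` is a formal basis of `𝕃[[b]] ⊗̂ G` if it is
one of `G` modulo `b`. -/
theorem isFormalBasis_bExtend {G : Subalgebra Lazard (XSeries n)}
    (hG : IsClosed (G : Set (XSeries n))) (hmem : ∀ i, e i ∈ bExtend G)
    (he : ∀ d : ℕ, {i | (e i).order ≤ d}.Finite)
    (hspan : ∀ f ∈ G, ∃ c : ι → Lazard, HasSum (fun i => c i • bCoeff 0 (e i)) f)
    (hind : ∀ c : ι → Lazard, HasSum (fun i => c i • bCoeff 0 (e i)) 0 → c = 0) :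
    IsFormalBasis (bExtend G) e := by
  classical
  refine ⟨hmem, fun c => ?_, fun F hF => ?_⟩
  · obtain ⟨F, hF⟩ : Summable fun i => c i • e i := summable_of_finite_order_le fun d =>
      (he d).subset fun i hi => (order_le_order_smul (c i) (e i)).trans hi
    exact ⟨F, mem_of_hasSum (isClosed_bExtend hG) hF fun i => (bExtend G).smul_mem (hmem i) _, hF⟩
  have hco : ∀ f : XSeries n, ∃ co : ι → Lazard, f ∈ G →
      ∀ c, HasSum (fun i => c i • bCoeff 0 (e i)) f ↔ c = co := by
    intro f
    by_cases hf : f ∈ G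
    · obtain ⟨co, hco⟩ := hspan f hf
      refine ⟨co, fun _ c => ⟨fun hc => ?_, fun hc => hc ▸ hco⟩⟩
      have h1 := hc.sub hco
      rw [sub_self] at h1
      refine sub_eq_zero.mp (hind (c - co) ?_)
      simpa only [Pi.sub_apply, sub_smul] using h1
    · exact ⟨0, fun h => absurd h hf⟩
  choose co hco using hco
  -- The part of the coefficient of b^β in c_i e_i that is due to coefficients of c_i of degree less
  -- than |β|; it is known when degree |β| is treated.
  let R : ((ℕ →₀ ℕ) → ι → Lazard) → (ℕ →₀ ℕ) → ι → XSeries n := fun C β i =>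
    ∑ p ∈ Finset.HasAntidiagonal.antidiagonal β,
      if p.1.degree < β.degree then C p.1 i • bCoeff p.2 (e i) else 0
  have hR : ∀ C β, Summable (R C β) := fun C β => summable_of_finite_order_le
    (finite_order_bCoeff_le he (fun p => p.1.degree < β.degree) C)
  have hRG : ∀ C β, ∑' i, R C β i ∈ G := fun C β =>
    mem_of_hasSum hG (hR C β).hasSum fun i => sum_mem fun p _ => by
      split_ifs
      · exact G.smul_mem (hmem i p.2) _
      · exact zero_mem _
  have hsplit : ∀ (c : ι → BSeries) β i, bCoeff β (c i • e i) =
      coeff β (c i) • bCoeff 0 (e i) + R (fun β i => coeff β (c i)) β i := by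
    intro c β i
    rw [bCoeff_smul]
    have h1 : ∀ p ∈ Finset.HasAntidiagonal.antidiagonal β, coeff p.1 (c i) • bCoeff p.2 (e i) =
        (if p = (β, 0) then coeff p.1 (c i) • bCoeff p.2 (e i) else 0) +
          if p.1.degree < β.degree then coeff p.1 (c i) • bCoeff p.2 (e i) else 0 := by
      intro p hp
      have h2 := Finset.HasAntidiagonal.mem_antidiagonal.mp hp
      have h3 : p.1.degree + p.2.degree = β.degree := by rw [← map_add, h2]
      by_cases hp0 : p = (β, 0)
      · rw [if_pos hp0, if_neg (by rw [hp0]; exact lt_irrefl _), add_zero]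
      -- Every decomposition of β other than (β, 0) has a first component of smaller degree.
      · rw [if_neg hp0, if_pos, zero_add]
        have h4 : p.2.degree ≠ 0 := fun h4 => by
          rw [Finsupp.degree_eq_zero_iff] at h4
          rw [h4, add_zero] at h2
          exact hp0 (Prod.ext h2 h4)
        omega
    rw [Finset.sum_congr rfl h1, Finset.sum_add_distrib, Finset.sum_ite_eq', if_pos]
    exact Finset.HasAntidiagonal.mem_antidiagonal.mpr (add_zero β)
  have hiff : ∀ c : ι → BSeries, HasSum (fun i => c i • e i) F ↔
      ∀ β, (fun i => coeff β (c i)) =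
        co (bCoeff β F - ∑' i, R (fun β i => coeff β (c i)) β i) := by
    intro c
    rw [hasSum_iff_forall_bCoeff]
    refine forall_congr' fun β => ?_
    refine Iff.trans ?_ (hco _ (sub_mem (hF β) (hRG (fun β i => coeff β (c i)) β))
      (fun i => coeff β (c i)))
    have h1 := (hR (fun β i => coeff β (c i)) β).hasSum
    simp only [hsplit]
    constructor
    · intro h2
      simpa only [add_sub_cancel_right] using h2.sub h1
    · intro h2
      simpa only [sub_add_cancel] using h2.add h1
  have hwf : WellFounded fun γ β : ℕ →₀ ℕ => γ.degree < β.degree :=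
    (measure fun β : ℕ →₀ ℕ => β.degree).wf
  obtain ⟨C, hC, huniq⟩ := existsUnique_forall_eq_of_wellFounded hwf (C := fun _ => ι → Lazard)
    fun β prev => co (bCoeff β F - ∑' i, ∑ p ∈ Finset.HasAntidiagonal.antidiagonal β,
      if h : p.1.degree < β.degree then prev p.1 h i • bCoeff p.2 (e i) else 0)
  simp only [dite_eq_ite] at hC huniq
  let c : ι → BSeries := fun i β => C β i
  refine ⟨c, (hiff c).mpr hC, fun c' hc' => ?_⟩
  have h1 := huniq (fun β i => coeff β (c' i)) ((hiff c').mp hc')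
  funext i
  refine MvPowerSeries.ext fun β => ?_
  exact congrFun (congrFun h1 β) i

end Lift

/-! ### The limit -/

section Limit

theorem specLast_smul (n : ℕ) (c : BSeries) (f : XBSeries (n + 1)) :
    specLast n (c • f) = c • specLast n f := by
  rw [Algebra.smul_def, Algebra.smul_def, map_mul]
  congr 1
  exact specLast_bIncl n c

/-- The even n are cofinal, and uniqueness at the levels 2m makes the coefficient of λ independent
of m once 2m ≥ ℓ(λ). Vanishing for long λ is required at even levels only: in an odd number n of
variables P_λ⁺ with ℓ(λ) = n + 1 need not vanish. -/
theorem isFormalBasis_limRing {G : ∀ n, Subalgebra BSeries (XBSeries n)}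
    {e : StrictPartition → ∀ n, XBSeries n} (hG : ∀ n, IsClosed (G n : Set (XBSeries n)))
    (hmem : ∀ lam n, e lam n ∈ G n) (hspec : ∀ lam n, specLast n (e lam (n + 1)) = e lam n)
    (hord : ∀ lam n, (lam.size : ℕ∞) ≤ (e lam n).order)
    (hzero : ∀ lam m, 2 * m < lam.length → e lam (2 * m) = 0)
    (hbasis : ∀ m, IsFormalBasis (G (2 * m)) fun lam : SP (2 * m) => e lam (2 * m)) :
    IsFormalBasis (limRing G) e := by
  have hlim : ∀ lam, e lam ∈ limRing G := fun lam => ⟨hmem lam, hspec lam⟩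
  have hsum : ∀ (c : StrictPartition → BSeries) n, Summable fun lam => c lam • e lam n :=
    fun c n => summable_of_finite_order_le fun d =>
      (StrictPartition.finite_size_le d).subset fun lam hlam => by
        have := ((hord lam n).trans (order_le_order_smul (c lam) (e lam n))).trans hlam
        exact_mod_cast this
  have hdown : ∀ (c : StrictPartition → BSeries) n F, HasSum (fun lam => c lam • e lam (n + 1)) F →
      HasSum (fun lam => c lam • e lam n) (specLast n F) := by
    intro c n F hF
    convert hF.map (specLast n) (isCoeffMap_specLast n).continuous using 2 with lam
    rw [Function.comp_apply, specLast_smul, hspec]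
  refine ⟨hlim, fun c => ?_, fun F hF => ?_⟩
  · choose F hF using hsum c
    refine ⟨F, ⟨fun n => mem_of_hasSum (hG n) (hF n) fun lam => (G n).smul_mem (hmem lam n) _,
      fun n => (hdown c n _ (hF (n + 1))).unique (hF n)⟩, Pi.hasSum.mpr hF⟩
  have hex : ∀ m, ∃ c : StrictPartition → BSeries,
      HasSum (fun lam => c lam • e lam (2 * m)) (F (2 * m)) := by
    intro m
    obtain ⟨c, hc, -⟩ := (hbasis m).2.2 _ (hF.1 (2 * m))
    refine ⟨Function.extend Subtype.val c 0, ?_⟩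
    rw [← Subtype.val_injective.hasSum_iff]
    · have h1 : (fun lam => Function.extend Subtype.val c 0 lam • e lam (2 * m)) ∘ Subtype.val =
          fun lam : SP (2 * m) => c lam • e lam (2 * m) := by
        funext lam
        rw [Function.comp_apply, Subtype.val_injective.extend_apply]
      rw [h1]
      exact hc
    · intro lam hlam
      rw [Function.extend_apply' _ _ _ hlam, Pi.zero_apply, zero_smul]
  have huniq : ∀ m (c c' : StrictPartition → BSeries),
      HasSum (fun lam => c lam • e lam (2 * m)) (F (2 * m)) →
      HasSum (fun lam => c' lam • e lam (2 * m)) (F (2 * m)) →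
      ∀ lam : StrictPartition, lam.length ≤ 2 * m → c lam = c' lam := by
    intro m c c' hc hc' lam hlam
    have hres : ∀ c : StrictPartition → BSeries,
        HasSum (fun lam => c lam • e lam (2 * m)) (F (2 * m)) →
        HasSum (fun lam : SP (2 * m) => c lam • e lam (2 * m)) (F (2 * m)) := by
      intro c hc
      rw [← Subtype.val_injective (p := fun lam : StrictPartition =>
        lam.length ≤ 2 * m).hasSum_iff] at hc
      · exact hc
      · intro lam hlam
        rw [hzero lam m, smul_zero]
        by_contra hle
        exact hlam ⟨⟨lam, not_lt.mp hle⟩, rfl⟩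
    have := ((hbasis m).2.2 _ (hF.1 (2 * m))).unique (y₁ := fun lam => c lam)
      (y₂ := fun lam => c' lam) (hres c hc) (hres c' hc')
    exact congrFun this ⟨lam, hlam⟩
  choose c hc using hex
  have hstep : ∀ m (lam : StrictPartition), lam.length ≤ 2 * m → c (m + 1) lam = c m lam := by
    intro m
    refine huniq m _ _ ?_ (hc m)
    have h1 := hdown _ _ _ (hdown (c (m + 1)) (2 * m + 1) _ (hc (m + 1)))
    have h2 : specLast (2 * m + 1) (F (2 * (m + 1))) = F (2 * m + 1) := hF.2 (2 * m + 1)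
    rw [h2, hF.2 (2 * m)] at h1
    exact h1
  have hmono : ∀ m k (lam : StrictPartition), lam.length ≤ 2 * m → c (m + k) lam = c m lam := by
    intro m k lam hlam
    induction k with
    | zero => rfl
    | succ k ih => rw [← add_assoc, hstep _ _ (by omega), ih]
  -- The stable coefficient of λ is read off at level 2ℓ(λ), which is certainly large enough. At
  -- level 2m it may be used for all λ, as those longer than 2m contribute zero.
  have heven : ∀ m, HasSum (fun lam => c lam.length lam • e lam (2 * m)) (F (2 * m)) := by
    intro m
    convert hc m using 2 with lam
    rcases Nat.lt_or_ge (2 * m) lam.length with h | h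
    · rw [hzero lam m h, smul_zero, smul_zero]
    · rcases Nat.le_total lam.length m with h' | h'
      · obtain ⟨k, rfl⟩ := Nat.exists_eq_add_of_le h'
        rw [hmono _ _ _ (by omega)]
      · obtain ⟨k, hk⟩ := Nat.exists_eq_add_of_le h'
        have h1 := hmono m k lam h
        rw [← hk] at h1
        rw [h1]
  refine ⟨fun lam => c lam.length lam, Pi.hasSum.mpr fun n => ?_, fun c' hc' => funext fun lam => ?_⟩
  · rcases Nat.even_or_odd' n with ⟨m, rfl | rfl⟩
    · exact heven m
    · have h1 := hdown _ (2 * m + 1) _ (heven (m + 1))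
      have h2 : specLast (2 * m + 1) (F (2 * (m + 1))) = F (2 * m + 1) := hF.2 (2 * m + 1)
      rw [h2] at h1
      exact h1
  · exact huniq lam.length _ _ (Pi.hasSum.mp hc' _) (heven lam.length) lam (by omega)

end Limit

/-! ### The bases -/

section Main

variable {n : ℕ} {q : Bool}

/-- `Q_λ(x_n|b)` or `P_λ(x_n|b)⁺`. -/
def schurEven (q : Bool) (n : ℕ) (lam : StrictPartition) : XBSeries n :=
  if q then schurQ n lam else schurPEven n lam

theorem schurEven_mem (q : Bool) (n : ℕ) (lam : StrictPartition) :
    schurEven q n lam ∈ bExtend (gamOf q n) := by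
  cases q
  · change schurPEven n lam ∈ _
    rw [schurPEven]
    split_ifs
    · exact schur_mem false n lam
    · exact specLast_mem (schur_mem false (n + 1) lam)
  · exact schur_mem true n lam

theorem size_le_order_schurEven (q : Bool) (n : ℕ) (lam : StrictPartition) :
    (lam.size : ℕ∞) ≤ (schurEven q n lam).order := by
  cases q
  · change _ ≤ (schurPEven n lam).order
    rw [schurPEven]
    split_ifs
    · exact size_le_order_schur false n lam
    · exact (size_le_order_schur false (n + 1) lam).trans ((isCoeffMap_specLast n).le_order _)
  · exact size_le_order_schur true n lam

/-- The distinction between even and odd n disappears at b = 0, where P is stable under x_{n+1} = 0.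
-/
theorem bCoeff_zero_schurEven (q : Bool) (n : ℕ) (lam : StrictPartition) :
    bCoeff 0 (schurEven q n lam) = schurX q n lam := by
  rw [bCoeff_zero_eq_killB]
  cases q
  · change killB n (schurPEven n lam) = _
    rw [schurPEven]
    split_ifs
    · rfl
    · rw [killB_specLast]
      exact specX_schurX false n lam
  · rfl

theorem specLast_schurEven (q : Bool) (n : ℕ) (lam : StrictPartition) :
    specLast n (schurEven q (n + 1) lam) = schurEven q n lam := by
  cases q
  · change specLast n (schurPEven (n + 1) lam) = schurPEven n lam
    rw [schurPEven, schurPEven]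
    by_cases h : Even n
    · rw [if_pos h, if_neg (by rwa [Nat.even_add_one, not_not]), specLast_specLast_schurP]
    · rw [if_neg h, if_pos (by rwa [Nat.even_add_one])]
  · exact specLast_schurQ n lam

theorem schurEven_eq_zero (q : Bool) {m : ℕ} {lam : StrictPartition} (h : 2 * m < lam.length) :
    schurEven q (2 * m) lam = 0 := by
  cases q
  · change schurPEven (2 * m) lam = 0
    rw [schurPEven, if_pos (even_two_mul m), schurP, if_neg (not_le.mpr h)]
  · exact if_neg (not_le.mpr h)

theorem isFormalBasis_schurEven (q : Bool) (n : ℕ) :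
    IsFormalBasis (bExtend (gamOf q n)) fun lam : SP n => schurEven q n lam := by
  refine isFormalBasis_bExtend (isClosed_gamOf q n) (fun lam => schurEven_mem q n lam)
    (fun d => ?_) (fun f hf => ?_) fun c hc => ?_
  · refine ((StrictPartition.finite_size_le d).preimage Subtype.val_injective.injOn).subset
      fun lam hlam => ?_
    have := (size_le_order_schurEven q n lam).trans hlam
    exact_mod_cast this
  · obtain ⟨c, hc⟩ := exists_hasSum_schurX hf
    refine ⟨fun lam => c lam, ?_⟩
    simp only [bCoeff_zero_schurEven]
    rw [← Subtype.val_injective (p := fun lam : StrictPartition => lam.length ≤ n).hasSum_iff] at hc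
    · exact hc
    · intro lam hlam
      rw [schurX_eq_zero, smul_zero]
      by_contra hle
      exact hlam ⟨⟨lam, not_lt.mp hle⟩, rfl⟩
  · simp only [bCoeff_zero_schurEven] at hc
    have h1 : HasSum (fun lam => Function.extend Subtype.val c 0 lam • schurX q n lam) 0 := by
      rw [← Subtype.val_injective.hasSum_iff]
      · convert hc using 2 with lam
        rw [Function.comp_apply, Subtype.val_injective.extend_apply]
      · intro lam hlam
        rw [Function.extend_apply' _ _ _ hlam, Pi.zero_apply, zero_smul]
    funext lam
    rw [← Subtype.val_injective.extend_apply c 0 lam]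
    exact eq_zero_of_hasSum_schurX_zero h1 lam.2

theorem isFormalBasis_schurEven_lim (q : Bool) :
    IsFormalBasis (limRing fun n => bExtend (gamOf q n)) fun lam n => schurEven q n lam :=
  isFormalBasis_limRing (fun n => isClosed_bExtend (isClosed_gamOf q n))
    (fun lam n => schurEven_mem q n lam) (fun lam n => specLast_schurEven q n lam)
    (fun lam n => size_le_order_schurEven q n lam) (fun _ _ h => schurEven_eq_zero q h)
    fun m => isFormalBasis_schurEven q (2 * m)

end Main

end UnivSchur
end

theorem mainTheorem7 :
    -- `P_λ(x_n|b)` and `Q_λ(x_n|b)`, defined by sums of fractions, are power series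
    (∀ (n : ℕ) (lam : UnivSchur.SP n),
      algebraMap (UnivSchur.XBSeries n) (UnivSchur.XBFrac n) (UnivSchur.schurP n lam) =
          UnivSchur.hallLittlewoodSum n UnivSchur.factPow lam ∧
        algebraMap (UnivSchur.XBSeries n) (UnivSchur.XBFrac n) (UnivSchur.schurQ n lam) =
          UnivSchur.hallLittlewoodSum n UnivSchur.factPowQ lam) ∧
    -- finitely many variables
    (∀ n : ℕ,
      UnivSchur.IsFormalBasis (UnivSchur.GamB n)
          (fun lam : UnivSchur.SP n => UnivSchur.schurPEven n lam) ∧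
        UnivSchur.IsFormalBasis (UnivSchur.GamPlusB n)
          (fun lam : UnivSchur.SP n => UnivSchur.schurQ n lam)) ∧
    -- the limit `n → ∞`
    UnivSchur.IsFormalBasis UnivSchur.GamBLim
      (fun (lam : UnivSchur.StrictPartition) (n : ℕ) => UnivSchur.schurPEven n lam) ∧
    UnivSchur.IsFormalBasis UnivSchur.GamPlusBLim
      (fun (lam : UnivSchur.StrictPartition) (n : ℕ) => UnivSchur.schurQ n lam) := by
  refine ⟨fun n lam => ⟨(UnivSchur.algebraMap_schur_and_isHL false lam.2).1,
    (UnivSchur.algebraMap_schur_and_isHL true lam.2).1⟩, fun n =>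
    ⟨UnivSchur.isFormalBasis_schurEven false n, UnivSchur.isFormalBasis_schurEven true n⟩,
    UnivSchur.isFormalBasis_schurEven_lim false, UnivSchur.isFormalBasis_schurEven_lim true⟩
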